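/- Let $N\ge 0$. An \emph{orthant} of rank $k$ in $\mathbb Z^N$ is a set $L=a+\langle Y\rangle$, where $a\in\mathbb Z^N$ is its base point, $Y$ (the \emph{canonical directions} of $L$) consists of $k$ vectors $\pm e_i$ with pairwise different indices $i$, and $\langle Y\rangle$ is the monoid generated by $Y$. For $y\in Y$ the corank-1 face of $L$ orthogonal to $y$ is $a+\langle Y\setminus\{y\}\rangle$. Two orthants $L,L'$ are \emph{commensurable} if they have the same rank $k$ and $L\cap L'$ contains an orthant of rank $k$; commensurability classes are called \emph{germs}. Let $S\subseteq\mathbb Z^N$ be orthohedral, i.e. a finite union of orthants; its rank $\mathrm{rk}\,S$ is the maximal rank of an orthant contained in $S$, and $\Gamma^k(S)$ is the set of germs of rank-$k$ orthants contained in $S$. For a germ $\gamma$, $\langle\gamma\rangle\subseteq\mathbb Z^N$ denotes the union of all orthants in $\gamma$ (a coset of a coordinate subgroup), $X(\gamma)$ the set of canonical directions of the orthants in $\gamma$ (the same for all of them), and $\mathrm{Trans}\langle\gamma\rangle$ the group of translations of $\langle\gamma\rangle$. Let $\mathrm{pei}(S)$ be the group of all permutations $g$ of $S$ (extended by the identity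 to $\mathbb Z^N$) such that $S$ is a finite disjoint union of orthants on each of which $g$ is an isometric embedding for the Euclidean distance. The support $\mathrm{supp}(g)$ is the union of all orthants of $\mathbb Z^N$ on which $g$ restricts to an isometric embedding different from the identity. For $k\ge -1$ let $G_k(S)$ consist of those $g\in\mathrm{pei}(S)$ such that all orthants contained in $\mathrm{supp}(g)$ have rank $\le k$; so $G_{-1}(S)=1$. If $\gamma\in\Gamma^k(S)$ and $g\in \mathrm{pei}(S)$, then $g$ maps some orthant $L\in\gamma$ isometrically onto an orthant, whose germ $g\gamma$ depends only on $g$ and $\gamma$; if $g\gamma=\gamma$, then $g|_L$ extends to an isometry of $\langle\gamma\rangle$, which permutes $X(\gamma)$. Let $C(\Gamma^k(S))$ be the set of all $g\in G_k(S)$ that fix every germ in $\Gamma^k(S)$, and $C^{ord}(\Gamma^k(S))$ the set of those that moreover fix every direction in $X(\gamma)$ for all $\gamma\in\Gamma^k(S)$; these $g$ act on each $\langle\gamma\rangle$ as a translation $\varphi_\gamma(g)$. For $k\ge1$, $\gamma\in\Gamma^k(S)$, $t\in \mathrm{Trans}\langle\gamma\rangle$ and any $L\in\gamma$ put $fl_\gamma(t)=h(L\setminus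 t(L))-h(t(L)\setminus L)$, where $h$ is the number of rank-$(k-1)$ germs of a set. An \emph{orthant-transposition} exchanges two disjoint orthants by mutually inverse isometries and is the identity elsewhere. A \emph{unit-translation} of rank $k$ in $S$ is a permutation $g$ with $\mathrm{supp}(g)=L\cup L'$ for two disjoint rank-$k$ orthants $L,L'\subseteq S$ with corank-1 faces $F\subset L$, $F'\subset L'$, which shifts $L\setminus F$ onto $L$ and $L'$ onto $L'\setminus F'$ by one unit and maps $F$ onto $F'$ by the isometry that preserves the order of the coordinate axes. A \emph{unit-endotranslation} of rank $k$ in $S$ is a permutation $g$ with $\mathrm{supp}(g)\subseteq L$ for a rank-$k$ orthant $L\subseteq S$ with two different corank-1 faces $F_x,F_y$ (orthogonal to the directions $x$, $y$), which shifts $L\setminus F_x$ by $y-x$ onto $L\setminus F_y$ and maps $F_x$ onto $F_y$ by the reflection of $L$ that interchanges the axes $x$ and $y$. \textbf{Theorem.} Let $0\le k\le \mathrm{rk}\,S$. Then $G_{k-1}(S)\le C^{ord}(\Gamma^k(S))\le C(\Gamma^k(S))\le G_k(S)$ are groups, each normal in the next, and the following holds. (i) For all $\gamma\neq\gamma'$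 in $\Gamma^k(S)$ there is an orthant-transposition in $G_k(S)$, of two orthants in $S$ that represent $\gamma$ and $\gamma'$, which induces the transposition $(\gamma,\gamma')$ on $\Gamma^k(S)$. The action of $G_k(S)$ on $\Gamma^k(S)$ induces an isomorphism of $G_k(S)/C(\Gamma^k(S))$ onto the finitary symmetric group of $\Gamma^k(S)$. (ii) $|X(\gamma)|=k$ for all $\gamma\in\Gamma^k(S)$, and the action of $C(\Gamma^k(S))$ on the sets $X(\gamma)$ induces an isomorphism $C(\Gamma^k(S))/C^{ord}(\Gamma^k(S))\cong\bigoplus_{\gamma\in\Gamma^k(S)}\mathrm{Sym}(X(\gamma))$ (the finitary direct product). (iii) Let $k\ge 1$. Then $\varphi=(\varphi_\gamma)_\gamma$ and $fl=\sum_\gamma fl_\gamma$ define a short exact sequence of groups $$0\to C^{ord}(\Gamma^k(S))/G_{k-1}(S)\xrightarrow{\ \varphi\ }\bigoplus_{\gamma\in\Gamma^k(S)}\mathrm{Trans}\langle\gamma\rangle\xrightarrow{\ fl\ }\mathbb Z\to 0 .$$ In particular $A^k(S)=C^{ord}(\Gamma^k(S))/G_{k-1}(S)$ is free abelian of rank $k\,|\Gamma^k(S)|-1$,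 which is infinite if $k<\mathrm{rk}\,S$. Every $a\in A^k(S)$ is represented by an element $g\in C^{ord}(\Gamma^k(S))$ such that $\mathrm{supp}(g)$ is the union of pairwise disjoint orthants $L_\gamma\subseteq S$ with $L_\gamma\in\gamma$, one for each of the finitely many $\gamma$ with $\varphi(a)_\gamma\ne0$. The unit-translations and unit-endotranslations of rank $k$ in $S$ lie in $C^{ord}(\Gamma^k(S))$, and their classes generate $A^k(S)$. -/

import Mathlib

/-- The integral lattice `ℤ^N`. -/
abbrev ZLat (N : ℕ) : Type := Fin N → ℤ

/-- Square of the Euclidean distance on `ℤ^N`. -/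
def sqDist {N : ℕ} (x y : ZLat N) : ℤ := ∑ i, (x i - y i) ^ 2

/-- An integral orthant of `ℤ^N`, given by its base point and, for every coordinate axis `i`, the
sign of the unit vector `± e_i` spanning it along that axis (`0` if the orthant does not extend
along this axis). An orthant, as a subset of `ℤ^N`, determines these data. -/
@[ext]
structure Orthant (N : ℕ) where
  base : ZLat N
  dir : Fin N → SignType

namespace Orthant

variable {N : ℕ}

/-- The underlying subset `a + ⟨Y⟩` of `ℤ^N`, where `⟨Y⟩` is the monoid generated by the
directions. -/
def carrier (L : Orthant N) : Set (ZLat N) :=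
  {x | ∀ i, ∃ n : ℕ, x i = L.base i + n * (L.dir i : ℤ)}

/-- The rank of an orthant: the number of its directions. -/
def rank (L : Orthant N) : ℕ := (Finset.univ.filter fun i => L.dir i ≠ 0).card

/-- The vector `± e_i` by which `L` extends along the `i`-th axis. -/
def unit (L : Orthant N) (i : Fin N) : ZLat N := Pi.single i (L.dir i : ℤ)

/-- The canonical basis of an orthant. -/
def directions (L : Orthant N) : Set (ZLat N) := {y | ∃ i, L.dir i ≠ 0 ∧ y = L.unit i}

/-- The face of `L` through the base point and orthogonal to the `i`-th axis. It has corank 1 if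
`L.dir i ≠ 0`. -/
def face (L : Orthant N) (i : Fin N) : Orthant N := ⟨L.base, Function.update L.dir i 0⟩

/-- The reflection of `L` that interchanges its `i`-th and `j`-th axis and fixes the other ones. -/
def reflect (L : Orthant N) (i j : Fin N) (x : ZLat N) : ZLat N := fun l =>
  if l = i then L.base i + (L.dir i : ℤ) * ((L.dir j : ℤ) * (x j - L.base j))
  else if l = j then L.base j + (L.dir j : ℤ) * ((L.dir i : ℤ) * (x i - L.base i))
  else x l

/-- `L` and `L'` are commensurable: `rk L = rk (L ∩ L') = rk L'`, where the rank of a set is the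
largest rank of an orthant that it contains. -/
def Commensurable (L L' : Orthant N) : Prop :=
  L.rank = L'.rank ∧ ∃ M : Orthant N, M.carrier ⊆ L.carrier ∩ L'.carrier ∧ M.rank = L.rank

/-- The germ of `L`: its commensurability class. -/
def germ (L : Orthant N) : Set (Orthant N) := {L' | L.Commensurable L'}

end Orthant

section

variable {N : ℕ}

/-- Orthohedral sets: finite unions of orthants. -/
def IsOrthohedral (S : Set (ZLat N)) : Prop :=
  ∃ Λ : Finset (Orthant N), S = ⋃ L ∈ Λ, L.carrier

/-- `Γ^k(S)`: the germs of the rank-`k` orthants contained in `S`. -/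
def germs (k : ℕ) (S : Set (ZLat N)) : Set (Set (Orthant N)) :=
  {γ | ∃ L : Orthant N, L.rank = k ∧ L.carrier ⊆ S ∧ γ = L.germ}

/-- The number of rank-`k` germs of a set; if the set is orthohedral of rank `k`, this is its
height. -/
noncomputable def height (k : ℕ) (T : Set (ZLat N)) : ℕ := (germs k T).ncard

/-- The tangent coset `⟨γ⟩`: the union of all members of the germ `γ`. -/
def tangentCoset (γ : Set (Orthant N)) : Set (ZLat N) := ⋃ L ∈ γ, L.carrier

/-- The set `X(γ)` of canonical coordinate directions of `⟨γ⟩`. -/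
def germDirections (γ : Set (Orthant N)) : Set (ZLat N) := {y | ∃ L ∈ γ, y ∈ L.directions}

open Pointwise in
/-- `Trans⟨γ⟩`: the group of the translations of `ℤ^N` that map `⟨γ⟩` onto itself, written as
translation vectors. -/
def TransGroup (γ : Set (Orthant N)) : AddSubgroup (ZLat N) :=
  AddAction.stabilizer (ZLat N) (tangentCoset γ)

/-- `g` restricts to an isometric embedding of `L`. -/
def IsometricOn (g : Equiv.Perm (ZLat N)) (L : Orthant N) : Prop :=
  ∀ x ∈ L.carrier, ∀ y ∈ L.carrier, sqDist (g x) (g y) = sqDist x y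

/-- `pei(S)`: the piecewise Euclidean isometric permutations of `S`, extended by the identity
to `ℤ^N`. -/
def pei (S : Set (ZLat N)) : Set (Equiv.Perm (ZLat N)) :=
  {g | (∀ x, x ∉ S → g x = x) ∧
    ∃ Λ : Finset (Orthant N), S = ⋃ L ∈ Λ, L.carrier ∧
      (∀ L ∈ Λ, ∀ L' ∈ Λ, L ≠ L' → Disjoint L.carrier L'.carrier) ∧
      ∀ L ∈ Λ, IsometricOn g L}

/-- The support of `g`: the union of all orthants on which `g` restricts to an isometric embedding
different from the identity. -/
def peiSupp (g : Equiv.Perm (ZLat N)) : Set (ZLat N) :=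
  ⋃ L ∈ {L : Orthant N | IsometricOn g L ∧ ∃ x ∈ L.carrier, g x ≠ x}, L.carrier

/-- `G_k(S)`: the elements of `pei(S)` whose support has rank at most `k`. For `k = -1` the
condition says that the support is empty. -/
def rankGroup (k : ℤ) (S : Set (ZLat N)) : Set (Equiv.Perm (ZLat N)) :=
  {g | g ∈ pei S ∧ ∀ L : Orthant N, L.carrier ⊆ peiSupp g → (L.rank : ℤ) ≤ k}

/-- `g` maps the germ `γ` to the germ `γ'`: it maps some orthant that represents `γ` isometrically
onto an orthant that represents `γ'`. -/
def SendsGerm (g : Equiv.Perm (ZLat N)) (γ γ' : Set (Orthant N)) : Prop :=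
  ∃ L ∈ γ, ∃ L' ∈ γ', IsometricOn g L ∧ g '' L.carrier = L'.carrier

/-- `g` fixes the germ `γ`, and the isometry of `⟨γ⟩` that it induces permutes the canonical
directions by `σ`. -/
def PermutesDirections (g : Equiv.Perm (ZLat N)) (γ : Set (Orthant N))
    (σ : Equiv.Perm (germDirections γ)) : Prop :=
  ∃ L ∈ γ, ∃ L' ∈ γ, IsometricOn g L ∧ g '' L.carrier = L'.carrier ∧
    ∀ x ∈ L.carrier, ∀ y : germDirections γ, g (x + y) = g x + σ y

/-- `C(Γ^k(S))`: the elements of `G_k(S)` that fix all rank-`k` germs of `S`. -/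
def germFixer (k : ℕ) (S : Set (ZLat N)) : Set (Equiv.Perm (ZLat N)) :=
  {g | g ∈ rankGroup k S ∧ ∀ γ ∈ germs k S, SendsGerm g γ γ}

/-- `C^ord(Γ^k(S))`: the elements of `G_k(S)` that fix all rank-`k` germs of `S` together with an
ordering of their directions (i.e. fix each direction). -/
def germFixerOrd (k : ℕ) (S : Set (ZLat N)) : Set (Equiv.Perm (ZLat N)) :=
  {g | g ∈ rankGroup k S ∧ ∀ γ ∈ germs k S, PermutesDirections g γ 1}

/-- `g` acts on `⟨γ⟩` as the translation by `v`. -/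
def TranslatesGerm (g : Equiv.Perm (ZLat N)) (γ : Set (Orthant N)) (v : ZLat N) : Prop :=
  ∃ L ∈ γ, ∀ x ∈ L.carrier, g x = v + x

/-- The corank-1 germ flow `h(L - Lt) - h(Lt - L)` of the translation `t` by `v`, computed at the
rank-`k` orthant `L`. -/
noncomputable def flowAt (k : ℕ) (L : Orthant N) (v : ZLat N) : ℤ :=
  (height (k - 1) (L.carrier \ ((fun x => v + x) '' L.carrier)) : ℤ) -
    height (k - 1) (((fun x => v + x) '' L.carrier) \ L.carrier)

/-- `g` is an orthant-transposition of `L` and `L'`. -/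
def IsOrthantTransposition (g : Equiv.Perm (ZLat N)) (L L' : Orthant N) : Prop :=
  Disjoint L.carrier L'.carrier ∧ IsometricOn g L ∧ g '' L.carrier = L'.carrier ∧
    (∀ x ∈ L.carrier, g (g x) = x) ∧ ∀ x, x ∉ L.carrier ∪ L'.carrier → g x = x

/-- `g` is the unit-translation from `L` to `L'` given by the corank-1 faces `F = L.face i` and
`F' = L'.face j`: it shifts `L - F` onto `L` and `L'` onto `L' - F'` by one unit, and it maps `F`
onto `F'` by the isometry that preserves the orderings of the axes. -/
def IsUnitTranslation (g : Equiv.Perm (ZLat N)) (L L' : Orthant N) (i j : Fin N) : Prop :=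
  Disjoint L.carrier L'.carrier ∧ L.rank = L'.rank ∧ L.dir i ≠ 0 ∧ L'.dir j ≠ 0 ∧
    peiSupp g = L.carrier ∪ L'.carrier ∧
    (∀ x ∈ L.carrier \ (L.face i).carrier, g x = x - L.unit i) ∧
    (∀ x ∈ L'.carrier, g x = x + L'.unit j) ∧
    ∃ σ : {l // (L.face i).dir l ≠ 0} ≃o {l // (L'.face j).dir l ≠ 0},
      ∀ x ∈ (L.face i).carrier, g x ∈ (L'.face j).carrier ∧
        ∀ l, (L'.dir (σ l) : ℤ) * (g x (σ l) - L'.base (σ l)) =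
          (L.dir l : ℤ) * (x l - L.base l)

/-- `g` is the unit-endotranslation of `L` given by the different corank-1 faces `F = L.face i` and
`F' = L.face j`: it is supported on `L`, shifts `L - F` onto `L - F'`, and maps `F` onto `F'` by
the restriction of the reflection of `L` that interchanges the two axes. -/
def IsUnitEndotranslation (g : Equiv.Perm (ZLat N)) (L : Orthant N) (i j : Fin N) : Prop :=
  i ≠ j ∧ L.dir i ≠ 0 ∧ L.dir j ≠ 0 ∧ peiSupp g ⊆ L.carrier ∧
    (∀ x ∈ L.carrier \ (L.face i).carrier, g x = x - L.unit i + L.unit j) ∧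
    ∀ x ∈ (L.face i).carrier, g x = L.reflect i j x

/-- The unit-translations and unit-endotranslations of rank `k` on orthants of `S`. -/
def unitGenerators (k : ℕ) (S : Set (ZLat N)) : Set (Equiv.Perm (ZLat N)) :=
  {g | (∃ L L' : Orthant N, L.rank = k ∧ L.carrier ⊆ S ∧ L'.carrier ⊆ S ∧
          ∃ i j, IsUnitTranslation g L L' i j) ∨
       (∃ L : Orthant N, L.rank = k ∧ L.carrier ⊆ S ∧ ∃ i j, IsUnitEndotranslation g L i j)}

end

/-- The finitary symmetric group of `X`: the permutations that move only finitely many points. -/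
def finitarySym (X : Type*) : Subgroup (Equiv.Perm X) where
  carrier := {σ | {x | σ x ≠ x}.Finite}
  one_mem' := by simp
  mul_mem' {a b} ha hb := by
    refine (Set.Finite.union ha hb).subset fun x hx => ?_
    by_contra h
    simp only [Set.mem_union, Set.mem_ofPred_eq, not_or, not_not] at h
    exact hx (by rw [Equiv.Perm.mul_apply, h.2, h.1])
  inv_mem' {a} ha := by
    refine Set.Finite.subset ha fun x hx h => hx ?_
    rw [Equiv.Perm.inv_eq_iff_eq]
    exact h.symm

/-- The finitary direct product of a family of groups. -/
def finitaryProd {ι : Type*} (H : ι → Type*) [∀ i, Group (H i)] : Subgroup (∀ i, H i) where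
  carrier := {f | {i | f i ≠ 1}.Finite}
  one_mem' := by simp
  mul_mem' {a b} ha hb := by
    refine (Set.Finite.union ha hb).subset fun x hx => ?_
    by_contra h
    simp only [Set.mem_union, Set.mem_ofPred_eq, not_or, not_not] at h
    exact hx (by rw [Pi.mul_apply, h.2, h.1, one_mul])
  inv_mem' {a} ha := by
    refine Set.Finite.subset ha fun x hx h => hx ?_
    rw [Pi.inv_apply, h, inv_one]

/-! Far out on an orthant `L` a piecewise isometric permutation coincides with a single signed
affine map (`IsometricOn.exists_signedAffine`, `PiecewiseIsometric.exists_tailEq`), and the values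
far out determine this map on all of `L` (`TailEq.eqOn`). So `g` acts on every germ through one
affine datum, from which the image germ, the permutation of the directions and the translation are
read off. An element of `pei S` lies in `G_k` exactly if its moved points are covered by finitely
many orthants of rank at most `k` (`mem_rankGroup_iff`). Hence all but finitely many rank-`k` germs
carry the identity datum, which is the source of the finitary symmetric group, the finitary product
and the direct sum.

Each quotient then comes from a homomorphism with the right kernel. Surjectivity in (i) and (ii) is
explicit: transpositions of two disjoint orthants, and permutations of the axes of one orthant. In
(iii) an element with zero translations is the identity far out on all orthants of rank at least
`k`, and rigidity makes its moved set one rank smaller (`thin_of_tailEq_id`).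

The flow is the sum of the signed coordinates of the translations (`flowAt_eq`). It vanishes on the
image of `φ` by counting: let `A` be a union of disjoint representatives of the relevant germs and
`B` its image under `g`, inside a `g`-invariant set `U` containing all moved points. Then `g`
carries `U \ A` onto `U \ B`, so these have equally many rank-`(k-1)` germs, finitely many;
cancelling the common part gives `h(A \ B) = h(B \ A)` (`exists_sum_flow_eq_zero`). Conversely, in
the basis of unit vectors the flow is the sum of the coordinates, so its kernel is spanned by
differences of two basis vectors, and each difference is realized by a unit-translation or a
unit-endotranslation (`exists_unitGenerator`).

Supports need extra care, since they also contain fixed points of nontrivial isometries. Orthants in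
standard position have a gap around them that keeps the support from growing
(`peiSupp_subset_of_standard`), and a correction of rank `k - 1` makes it fill them completely
(`exists_mul_movesEverywhere`). -/

/-! ### Signs, coordinates of orthants, and germs as classes of parallel orthants. -/

theorem SignType.cases_int (s : SignType) :
    (s = 0 ∧ (s : ℤ) = 0) ∨ (s = 1 ∧ (s : ℤ) = 1) ∨ (s = -1 ∧ (s : ℤ) = -1) := by
  cases s <;> simp

theorem SignType.intCast_eq_zero {s : SignType} : (s : ℤ) = 0 ↔ s = 0 := by
  cases s <;> simp

theorem SignType.intCast_mul_self {s : SignType} (hs : s ≠ 0) : (s : ℤ) * s = 1 := by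
  cases s <;> simp_all

theorem SignType.intCast_injective : Function.Injective (fun s : SignType => (s : ℤ)) := by
  intro s t
  cases s <;> cases t <;> simp

namespace Orthant

variable {N : ℕ}

/-- Trades the natural number along each axis for a sign condition, so that membership questions
split over the three signs and become linear arithmetic. -/
theorem mem_carrier_iff {L : Orthant N} {x : ZLat N} :
    x ∈ L.carrier ↔ ∀ i, (L.dir i = 0 → x i = L.base i) ∧
      (0 ≤ (L.dir i : ℤ) * (x i - L.base i)) := by
  refine forall_congr' fun i => ?_
  rcases SignType.cases_int (L.dir i) with ⟨h, h'⟩ | ⟨h, h'⟩ | ⟨h, h'⟩ <;> rw [h', h]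
  · simp
  · constructor
    · rintro ⟨n, hn⟩
      exact ⟨fun h => absurd h (by decide), by omega⟩
    · rintro ⟨-, h2⟩
      exact ⟨(x i - L.base i).toNat, by omega⟩
  · constructor
    · rintro ⟨n, hn⟩
      exact ⟨fun h => absurd h (by decide), by omega⟩
    · rintro ⟨-, h2⟩
      exact ⟨(L.base i - x i).toNat, by omega⟩

theorem base_mem (L : Orthant N) : L.base ∈ L.carrier :=
  mem_carrier_iff.2 fun i => ⟨fun _ => rfl, by simp⟩

theorem unit_apply_self (L : Orthant N) (i : Fin N) : L.unit i i = L.dir i := by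
  simp [unit]

theorem unit_apply_of_ne (L : Orthant N) {i j : Fin N} (h : j ≠ i) : L.unit i j = 0 := by
  simp [unit, h]

theorem add_unit_mem {L : Orthant N} {x : ZLat N} (hx : x ∈ L.carrier) (i : Fin N) :
    x + L.unit i ∈ L.carrier := by
  rw [mem_carrier_iff] at hx ⊢
  intro j
  by_cases h : j = i
  · subst h
    have := hx j
    rw [Pi.add_apply, unit_apply_self]
    rcases SignType.cases_int (L.dir j) with ⟨h, h'⟩ | ⟨h, h'⟩ | ⟨h, h'⟩ <;> rw [h'] at this ⊢ <;>
      rw [h] at this ⊢ <;> simp_all <;> omega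
  · rw [Pi.add_apply, unit_apply_of_ne L h, add_zero]
    exact hx j

/-- The suborthant of `L` obtained by moving the base point `t` units along every direction. -/
def push (L : Orthant N) (t : ℕ) : Orthant N := ⟨fun i => L.base i + t * (L.dir i : ℤ), L.dir⟩

@[simp] theorem push_dir (L : Orthant N) (t : ℕ) : (L.push t).dir = L.dir := rfl

@[simp] theorem push_rank (L : Orthant N) (t : ℕ) : (L.push t).rank = L.rank := rfl

theorem push_base (L : Orthant N) (t : ℕ) (i : Fin N) :
    (L.push t).base i = L.base i + t * (L.dir i : ℤ) := rfl

theorem push_zero (L : Orthant N) : L.push 0 = L := by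
  ext <;> simp [push]

theorem mem_push_iff {L : Orthant N} {t : ℕ} {x : ZLat N} :
    x ∈ (L.push t).carrier ↔ ∀ i, (L.dir i = 0 → x i = L.base i) ∧
      (L.dir i ≠ 0 → (t : ℤ) ≤ (L.dir i : ℤ) * (x i - L.base i)) := by
  rw [mem_carrier_iff]
  refine forall_congr' fun i => ?_
  rw [push_base, push_dir]
  rcases SignType.cases_int (L.dir i) with ⟨h, h'⟩ | ⟨h, h'⟩ | ⟨h, h'⟩ <;> rw [h', h] <;> simp <;>
    omega

theorem push_anti (L : Orthant N) {s t : ℕ} (h : s ≤ t) :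
    (L.push t).carrier ⊆ (L.push s).carrier := fun x hx => by
  rw [mem_push_iff] at hx ⊢
  intro i
  exact ⟨(hx i).1, fun h0 => by have := (hx i).2 h0; omega⟩

theorem push_subset (L : Orthant N) (t : ℕ) : (L.push t).carrier ⊆ L.carrier := by
  simpa [push_zero] using L.push_anti (Nat.zero_le t)

/-- Parallel orthants: same directions, and same coordinates orthogonally to them. -/
def Parallel (L L' : Orthant N) : Prop :=
  L.dir = L'.dir ∧ ∀ i, L.dir i = 0 → L.base i = L'.base i

theorem Parallel.refl (L : Orthant N) : L.Parallel L := ⟨rfl, fun _ _ => rfl⟩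

theorem Parallel.symm {L L' : Orthant N} (h : L.Parallel L') : L'.Parallel L :=
  ⟨h.1.symm, fun i hi => (h.2 i (by rw [h.1, hi])).symm⟩

theorem Parallel.trans {L L' L'' : Orthant N} (h : L.Parallel L') (h' : L'.Parallel L'') :
    L.Parallel L'' :=
  ⟨h.1.trans h'.1, fun i hi => (h.2 i hi).trans (h'.2 i (by rw [← h.1, hi]))⟩

theorem parallel_push (L : Orthant N) (t : ℕ) : L.Parallel (L.push t) :=
  ⟨rfl, fun i hi => by simp [push_base, hi]⟩

theorem Parallel.rank_eq {L L' : Orthant N} (h : L.Parallel L') : L.rank = L'.rank := by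
  simp only [rank, h.1]

theorem dir_of_subset {M L : Orthant N} (h : M.carrier ⊆ L.carrier) (i : Fin N)
    (hi : M.dir i ≠ 0) : L.dir i = M.dir i := by
  have h0 := (mem_carrier_iff.1 (h M.base_mem) i)
  -- A point of `M` so far out along axis `i` that it passes the base point of `L`, whatever the two
  -- base coordinates are; it can stay in `L` only if `L` runs the same way.
  let x : ZLat N := fun j => if j = i then M.base i +
    (|L.base i| + |M.base i| + 1) * (M.dir i : ℤ) else M.base j
  have hx : x ∈ M.carrier := by
    rw [mem_carrier_iff]
    intro j
    by_cases hj : j = i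
    · subst hj
      refine ⟨fun h => absurd h hi, ?_⟩
      have := SignType.intCast_mul_self hi
      simp only [x, if_true]
      have h3 : (M.dir j : ℤ) * (M.base j + (|L.base j| + |M.base j| + 1) * (M.dir j : ℤ) - M.base j)
        = (|L.base j| + |M.base j| + 1) * ((M.dir j : ℤ) * M.dir j) := by ring
      rw [h3, this]; positivity
    · simp [x, hj]
  have h1 := mem_carrier_iff.1 (h hx) i
  simp only [x, if_true] at h1
  have a1 := neg_abs_le (L.base i)
  have a2 := le_abs_self (L.base i)
  have a3 := neg_abs_le (M.base i)
  have a4 := le_abs_self (M.base i)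
  generalize |L.base i| = p at *
  generalize |M.base i| = q at *
  rcases SignType.cases_int (L.dir i) with ⟨h, h'⟩ | ⟨h, h'⟩ | ⟨h, h'⟩ <;>
  rcases SignType.cases_int (M.dir i) with ⟨k, k'⟩ | ⟨k, k'⟩ | ⟨k, k'⟩ <;>
  simp_all <;> omega

/-- Along each of its axes `M` runs in the same direction as `L` (`dir_of_subset`), and equal ranks
leave `L` no further axis. The base point of `M`, lying in `L`, settles the remaining coordinates.
-/
theorem parallel_of_subset {M L : Orthant N} (h : M.carrier ⊆ L.carrier) (hr : M.rank = L.rank) :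
    L.Parallel M := by
  have key : ∀ i, M.dir i ≠ 0 → L.dir i = M.dir i := fun i => dir_of_subset h i
  have hs : (Finset.univ.filter fun i => M.dir i ≠ 0) = Finset.univ.filter fun i => L.dir i ≠ 0 := by
    refine Finset.eq_of_subset_of_card_le (fun i => ?_) hr.ge
    simp only [Finset.mem_filter, Finset.mem_univ, true_and]
    intro hi
    rwa [key i hi]
  have hd : L.dir = M.dir := by
    funext i
    by_cases hi : M.dir i = 0
    · have := Finset.ext_iff.1 hs i
      simp only [Finset.mem_filter, Finset.mem_univ, true_and] at this
      rw [hi]; by_contra hc; exact this.2 hc hi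
    · exact key i hi
  exact ⟨hd, fun i hi => ((mem_carrier_iff.1 (h M.base_mem) i).1 hi).symm⟩

theorem rank_le_of_subset {M L : Orthant N} (h : M.carrier ⊆ L.carrier) : M.rank ≤ L.rank := by
  refine Finset.card_le_card fun i => ?_
  simp only [Finset.mem_filter, Finset.mem_univ, true_and]
  intro hi
  rwa [dir_of_subset h i hi]

/-- A push by the sum of all differences between the two base points outweighs each of them. -/
theorem Parallel.exists_push_subset {L L' : Orthant N} (h : L.Parallel L') :
    ∃ t, (L.push t).carrier ⊆ L'.carrier := by
  refine ⟨∑ i, (L'.base i - L.base i).natAbs, fun x hx => ?_⟩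
  rw [mem_push_iff] at hx
  rw [mem_carrier_iff]
  intro i
  have h1 : (L'.base i - L.base i).natAbs ≤ ∑ i, (L'.base i - L.base i).natAbs :=
    Finset.single_le_sum (f := fun i => (L'.base i - L.base i).natAbs) (fun _ _ => Nat.zero_le _)
      (Finset.mem_univ i)
  generalize ∑ i, (L'.base i - L.base i).natAbs = t at *
  have h2 := hx i
  have h3 := h.2 i
  rw [← h.1]
  rcases SignType.cases_int (L.dir i) with ⟨h, h'⟩ | ⟨h, h'⟩ | ⟨h, h'⟩ <;> rw [h'] at h2 ⊢ <;>
    rw [h] at h2 h3 ⊢ <;> simp at h2 h3 ⊢ <;> omega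

/-- From here on germs are handled through sign vectors and orthogonal coordinates, without the
intermediate orthant in the definition of commensurability. -/
theorem commensurable_iff {L L' : Orthant N} : L.Commensurable L' ↔ L.Parallel L' := by
  constructor
  · rintro ⟨hr, M, hM, hMr⟩
    exact (parallel_of_subset (fun x hx => (hM hx).1) hMr).trans
      (parallel_of_subset (fun x hx => (hM hx).2) (hMr.trans hr)).symm
  · intro h
    obtain ⟨t, ht⟩ := h.exists_push_subset
    exact ⟨h.rank_eq, L.push t, fun x hx => ⟨L.push_subset t hx, ht hx⟩, rfl⟩

theorem mem_germ {L L' : Orthant N} : L' ∈ L.germ ↔ L.Parallel L' := commensurable_iff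

theorem germ_eq_iff {L L' : Orthant N} : L.germ = L'.germ ↔ L.Parallel L' := by
  constructor
  · intro h
    rw [← mem_germ, h, mem_germ]
    exact Parallel.refl _
  · intro h
    ext M
    rw [mem_germ, mem_germ]
    exact ⟨fun k => h.symm.trans k, fun k => h.trans k⟩

theorem self_mem_germ (L : Orthant N) : L ∈ L.germ := mem_germ.2 (Parallel.refl _)

end Orthant

/-! ### Signed affine maps and their action on orthants. -/

/-- A signed permutation of the coordinates followed by a translation. -/
structure SignedAffine (N : ℕ) where
  perm : Equiv.Perm (Fin N)
  sgn : Fin N → ℤˣ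
  shift : ZLat N

namespace SignedAffine

variable {N : ℕ}

/-- The map given by a signed affine datum. -/
def app (f : SignedAffine N) (x : ZLat N) : ZLat N :=
  fun j => f.shift j + f.sgn j * x (f.perm j)

/-- The linear part. -/
def lin (f : SignedAffine N) (x : ZLat N) : ZLat N := fun j => f.sgn j * x (f.perm j)

theorem app_add (f : SignedAffine N) (x y : ZLat N) : f.app (x + y) = f.app x + f.lin y := by
  funext j
  simp only [app, lin, Pi.add_apply]; ring

theorem lin_nsmul (f : SignedAffine N) (n : ℕ) (y : ZLat N) : f.lin (n • y) = n • f.lin y := by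
  funext j
  simp only [lin, Pi.smul_apply, nsmul_eq_mul]; ring

/-- The translation by `v`. -/
def translation (v : ZLat N) : SignedAffine N := ⟨1, 1, v⟩

@[simp] theorem translation_app (v x : ZLat N) : (translation v).app x = v + x := by
  funext j
  simp [translation, app]

/-- Composition. -/
def comp (f h : SignedAffine N) : SignedAffine N :=
  ⟨f.perm.trans h.perm, fun j => f.sgn j * h.sgn (f.perm j), f.app h.shift⟩

@[simp] theorem comp_app (f h : SignedAffine N) (x : ZLat N) :
    (f.comp h).app x = f.app (h.app x) := by
  funext j
  simp only [comp, app, Equiv.trans_apply, Units.val_mul]; ring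

@[simp] theorem comp_lin (f h : SignedAffine N) (x : ZLat N) :
    (f.comp h).lin x = f.lin (h.lin x) := by
  funext j
  simp only [comp, lin, Equiv.trans_apply, Units.val_mul]; ring

/-- The inverse. -/
def inv (f : SignedAffine N) : SignedAffine N :=
  ⟨f.perm.symm, fun j => f.sgn (f.perm.symm j),
    fun j => -(f.sgn (f.perm.symm j) * f.shift (f.perm.symm j))⟩

theorem _root_.Int.units_val_mul_val (u : ℤˣ) : (u : ℤ) * u = 1 := by
  rcases Int.units_eq_one_or u with h | h <;> simp [h]

@[simp] theorem inv_app_app (f : SignedAffine N) (x : ZLat N) : f.inv.app (f.app x) = x := by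
  funext j
  have := Int.units_val_mul_val (f.sgn (f.perm.symm j))
  simp only [inv, app, Equiv.apply_symm_apply]
  linear_combination (x j) * this

@[simp] theorem app_inv_app (f : SignedAffine N) (x : ZLat N) : f.app (f.inv.app x) = x := by
  funext j
  have := Int.units_val_mul_val (f.sgn j)
  simp only [inv, app, Equiv.symm_apply_apply]
  linear_combination (x j - f.shift j) * this

theorem app_injective (f : SignedAffine N) : Function.Injective f.app :=
  Function.LeftInverse.injective f.inv_app_app

theorem sqDist_app (f : SignedAffine N) (x y : ZLat N) :
    sqDist (f.app x) (f.app y) = sqDist x y := by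
  unfold sqDist
  rw [← Equiv.sum_comp f.perm (fun i => (x i - y i) ^ 2)]
  refine Finset.sum_congr rfl fun j _ => ?_
  have := Int.units_val_mul_val (f.sgn j)
  simp only [app]
  linear_combination (x (f.perm j) - y (f.perm j)) ^ 2 * this

/-- The image of an orthant. -/
noncomputable def map (f : SignedAffine N) (L : Orthant N) : Orthant N :=
  ⟨f.app L.base, fun j => SignType.sign (f.sgn j : ℤ) * L.dir (f.perm j)⟩

theorem map_dir_cast (f : SignedAffine N) (L : Orthant N) (j : Fin N) :
    ((f.map L).dir j : ℤ) = f.sgn j * L.dir (f.perm j) := by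
  simp only [map, SignType.coe_mul]
  rcases Int.units_eq_one_or (f.sgn j) with h | h <;> simp [h]

theorem map_dir_eq_zero (f : SignedAffine N) (L : Orthant N) (j : Fin N) :
    (f.map L).dir j = 0 ↔ L.dir (f.perm j) = 0 := by
  rw [← SignType.intCast_eq_zero, map_dir_cast, ← SignType.intCast_eq_zero]
  rcases Int.units_eq_one_or (f.sgn j) with h | h <;> simp [h]

theorem map_rank (f : SignedAffine N) (L : Orthant N) : (f.map L).rank = L.rank := by
  unfold Orthant.rank
  refine Finset.card_bij (fun j _ => f.perm j) ?_ ?_ ?_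
  · intro j
    simp only [Finset.mem_filter, Finset.mem_univ, true_and, ne_eq, map_dir_eq_zero, imp_self]
  · intro a _ b _ h
    exact f.perm.injective h
  · intro b hb
    refine ⟨f.perm.symm b, ?_, by simp⟩
    simpa [map_dir_eq_zero] using hb

theorem app_mem_map {f : SignedAffine N} {L : Orthant N} {x : ZLat N} :
    f.app x ∈ (f.map L).carrier ↔ x ∈ L.carrier := by
  rw [Orthant.mem_carrier_iff, Orthant.mem_carrier_iff]
  refine Equiv.forall_congr f.perm fun j => ?_
  rw [map_dir_eq_zero, map_dir_cast]
  simp only [map, app]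
  rcases Int.units_eq_one_or (f.sgn j) with h | h
  · simp [h]
  · simp only [h, Units.val_neg, Units.val_one, add_right_inj, mul_eq_mul_left_iff]
    have : -1 * (L.dir (f.perm j) : ℤ) * (f.shift j + -1 * x (f.perm j) -
      (f.shift j + -1 * L.base (f.perm j))) =
        L.dir (f.perm j) * (x (f.perm j) - L.base (f.perm j)) := by ring
    rw [this]
    simp

theorem image_carrier (f : SignedAffine N) (L : Orthant N) :
    f.app '' L.carrier = (f.map L).carrier := by
  ext y
  constructor
  · rintro ⟨x, hx, rfl⟩
    exact app_mem_map.2 hx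
  · intro hy
    refine ⟨f.inv.app y, ?_, by simp⟩
    rw [← app_mem_map (f := f)]
    simpa using hy

theorem map_push (f : SignedAffine N) (L : Orthant N) (t : ℕ) :
    f.map (L.push t) = (f.map L).push t := by
  ext j
  · rw [Orthant.push_base, map_dir_cast]
    simp only [map, app, Orthant.push]; ring
  · rfl

theorem map_parallel (f : SignedAffine N) {L L' : Orthant N} (h : L.Parallel L') :
    (f.map L).Parallel (f.map L') := by
  refine ⟨?_, fun i hi => ?_⟩
  · simp only [map, h.1]
  · rw [map_dir_eq_zero] at hi
    simp only [map, app, h.2 _ hi]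

theorem map_comp (f h : SignedAffine N) (L : Orthant N) : (f.comp h).map L = f.map (h.map L) := by
  ext j
  · simp [map]
  · apply SignType.intCast_injective
    simp only [map_dir_cast]
    simp only [comp, Equiv.trans_apply, Units.val_mul]; ring

/-- The unit neighbours of `y` determine the linear part along the axes of `L`, and every point of
`L` differs from `y` by a combination of these axes. This rigidity makes the affine datum of a germ
unique. -/
theorem eqOn_of_add_unit {f h : SignedAffine N} {L : Orthant N} {y : ZLat N} (hy : y ∈ L.carrier)
    (h0 : f.app y = h.app y)
    (h1 : ∀ i, L.dir i ≠ 0 → f.app (y + L.unit i) = h.app (y + L.unit i)) :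
    Set.EqOn f.app h.app L.carrier := by
  have hlin : ∀ i, L.dir i ≠ 0 → f.lin (Pi.single i 1) = h.lin (Pi.single i 1) := by
    intro i hi
    have := h1 i hi
    rw [app_add, app_add, h0, add_right_inj] at this
    funext j
    have hj := congrFun this j
    simp only [lin, Orthant.unit, Pi.single_apply] at hj ⊢
    rcases SignType.cases_int (L.dir i) with ⟨k, k'⟩ | ⟨k, k'⟩ | ⟨k, k'⟩
    · exact absurd k hi
    · simpa [k'] using hj
    · rw [k'] at hj
      split_ifs at hj ⊢ <;> simp_all
  intro x hx
  have hxy : x = y + ∑ i, (x i - y i) • (Pi.single i 1 : ZLat N) := by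
    funext j
    simp [Finset.sum_apply, Pi.single_apply]
  have hsum : ∀ f : SignedAffine N, f.lin (∑ i, (x i - y i) • (Pi.single i 1 : ZLat N)) =
      ∑ i, (x i - y i) • f.lin (Pi.single i 1) := by
    intro f
    funext j
    simp only [lin, Finset.sum_apply, Pi.smul_apply, smul_eq_mul, Finset.mul_sum]
    exact Finset.sum_congr rfl fun i _ => by ring
  rw [hxy, app_add, app_add, h0, hsum, hsum]
  congr 1
  refine Finset.sum_congr rfl fun i _ => ?_
  by_cases hi : L.dir i = 0
  · rw [(Orthant.mem_carrier_iff.1 hx i).1 hi, (Orthant.mem_carrier_iff.1 hy i).1 hi]; simp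
  · rw [hlin i hi]

end SignedAffine

/-! ### Isometric embeddings of orthants are signed affine. -/

section

variable {N : ℕ}

open Matrix

/-- A sum of integer squares equal to 1 has a single nonzero term. This discreteness is what forces
isometries to permute the axes up to sign. -/
theorem Int.exists_eq_single_of_dotProduct_self {w : ZLat N} (h : w ⬝ᵥ w = 1) :
    ∃ j, ∃ s : ℤˣ, w = Pi.single j (s : ℤ) := by
  have h1 : ∃ j, w j ≠ 0 := by
    by_contra! hc
    simp [dotProduct, hc] at h
  obtain ⟨j, hj⟩ := h1
  have hsplit : w j * w j + ∑ i ∈ Finset.univ.erase j, w i * w i = 1 := by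
    rw [Finset.add_sum_erase _ (fun i => w i * w i) (Finset.mem_univ j)]; exact h
  have hnn : ∀ i ∈ Finset.univ.erase j, 0 ≤ w i * w i := fun i _ => mul_self_nonneg _
  have hpos : 0 < w j * w j := mul_self_pos.2 hj
  have h0 : ∑ i ∈ Finset.univ.erase j, w i * w i = 0 := by
    have := Finset.sum_nonneg hnn; omega
  rw [h0, add_zero] at hsplit
  refine ⟨j, ⟨w j, w j, hsplit, hsplit⟩, ?_⟩
  funext i
  by_cases hi : i = j
  · subst hi; simp
  · have := (Finset.sum_eq_zero_iff_of_nonneg hnn).1 h0 i (by simp [hi])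
    simpa [hi] using this

/-- Polarization: inner products based at `L.base` are combinations of squared distances. -/
theorem IsometricOn.dotProduct_eq {g : Equiv.Perm (ZLat N)} {L : Orthant N}
    (hg : IsometricOn g L) {x y : ZLat N} (hx : x ∈ L.carrier) (hy : y ∈ L.carrier) :
    (g x - g L.base) ⬝ᵥ (g y - g L.base) = (x - L.base) ⬝ᵥ (y - L.base) := by
  have e1 := hg x hx y hy
  have e2 := hg x hx _ L.base_mem
  have e3 := hg y hy _ L.base_mem
  have pol : ∀ a b c : ZLat N, 2 * ((a - c) ⬝ᵥ (b - c)) = sqDist a c + sqDist b c - sqDist a b := by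
    intro a b c
    simp only [sqDist, dotProduct, Finset.mul_sum, ← Finset.sum_add_distrib,
      ← Finset.sum_sub_distrib, Pi.sub_apply]
    exact Finset.sum_congr rfl fun i _ => by ring
  have p1 := pol (g x) (g y) (g L.base)
  have p2 := pol x y L.base
  omega

theorem Orthant.unit_dotProduct (L : Orthant N) (i : Fin N) (x : ZLat N) :
    x ⬝ᵥ L.unit i = x i * L.dir i := by
  simp [Orthant.unit]

/-- An isometric embedding of an orthant is the restriction of a signed affine map. -/
theorem IsometricOn.exists_signedAffine {g : Equiv.Perm (ZLat N)} {L : Orthant N}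
    (hg : IsometricOn g L) : ∃ f : SignedAffine N, Set.EqOn g f.app L.carrier := by
  classical
  let I := {i : Fin N // L.dir i ≠ 0}
  have hdiff : ∀ i : Fin N, L.base + L.unit i - L.base = L.unit i := fun i => by simp
  -- The images of the unit steps are orthonormal integer vectors, hence signed basis vectors on
  -- pairwise different axes `τ i`.
  let w : I → ZLat N := fun i => g (L.base + L.unit i) - g L.base
  have hmem : ∀ i : I, L.base + L.unit i ∈ L.carrier :=
    fun i => Orthant.add_unit_mem L.base_mem i
  have hxw : ∀ (i : I), ∀ x ∈ L.carrier,
      (g x - g L.base) ⬝ᵥ w i = (x i - L.base i) * L.dir i := by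
    intro i x hx
    rw [hg.dotProduct_eq hx (hmem i), hdiff, Orthant.unit_dotProduct, Pi.sub_apply]
  have hww : ∀ i j : I, w i ⬝ᵥ w j = if i = j then 1 else 0 := by
    intro i j
    have := hxw j _ (hmem i)
    rw [show w i ⬝ᵥ w j = (g (L.base + L.unit i) - g L.base) ⬝ᵥ w j from rfl, this]
    split_ifs with h
    · subst h
      simp [Orthant.unit_apply_self, SignType.intCast_mul_self i.2]
    · have : (j : Fin N) ≠ i := fun hc => h (Subtype.ext hc.symm)
      simp [Orthant.unit_apply_of_ne L this]
  have hs : ∀ i : I, ∃ j, ∃ s : ℤˣ, w i = Pi.single j (s : ℤ) := fun i =>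
    Int.exists_eq_single_of_dotProduct_self (by simpa using hww i i)
  choose τ s hτ using hs
  have hinj : Function.Injective τ := by
    intro i j hij
    by_contra hne
    have := hww i j
    rw [if_neg hne, hτ i, hτ j, hij] at this
    simp at this
  have hcoord : ∀ (i : I), ∀ x ∈ L.carrier,
      g x (τ i) - g L.base (τ i) = s i * L.dir i * (x i - L.base i) := by
    intro i x hx
    have h1 := hxw i x hx
    rw [hτ i] at h1
    simp only [dotProduct_single, Pi.sub_apply] at h1
    have := Int.units_val_mul_val (s i)
    linear_combination (s i : ℤ) * h1 - (g x (τ i) - g L.base (τ i)) * this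
  -- The coordinates on the axes `τ i` already account for the whole norm of `x - L.base`, so
  -- nothing is left for the other ones.
  have hrest : ∀ x ∈ L.carrier, ∀ j, j ∉ Set.range τ → g x j = g L.base j := by
    intro x hx j hj
    have hn : (g x - g L.base) ⬝ᵥ (g x - g L.base) = (x - L.base) ⬝ᵥ (x - L.base) :=
      hg.dotProduct_eq hx hx
    let F : Finset (Fin N) := Finset.univ.image τ
    have hF : ∑ j ∈ F, (g x j - g L.base j) * (g x j - g L.base j) =
        (x - L.base) ⬝ᵥ (x - L.base) := by
      rw [Finset.sum_image (fun a _ b _ h => hinj h)]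
      have e1 : ∀ i : I, (g x (τ i) - g L.base (τ i)) * (g x (τ i) - g L.base (τ i)) =
          (x i - L.base i) * (x i - L.base i) := by
        intro i
        rw [hcoord i x hx]
        have h1 := Int.units_val_mul_val (s i)
        have h2 := SignType.intCast_mul_self i.2
        linear_combination (x i - L.base i) ^ 2 * ((L.dir i : ℤ) * L.dir i) * h1 +
          (x i - L.base i) ^ 2 * h2
      simp only [e1]
      have e2 := Finset.sum_subtype (Finset.univ.filter fun i => L.dir i ≠ 0)
        (p := fun i => L.dir i ≠ 0) (F := inferInstance) (by simp)
        (fun i => (x i - L.base i) * (x i - L.base i))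
      rw [show (∑ i : I, (x i - L.base i) * (x i - L.base i)) = _ from e2.symm]
      simp only [dotProduct, Pi.sub_apply]
      refine Finset.sum_subset (Finset.subset_univ _) fun i _ hi => ?_
      have : L.dir i = 0 := by simpa using hi
      rw [(Orthant.mem_carrier_iff.1 hx i).1 this]; simp
    have hj' : j ∉ F := by simpa [F] using hj
    have hle : ∑ l ∈ insert j F, (g x l - g L.base l) * (g x l - g L.base l) ≤
        (g x - g L.base) ⬝ᵥ (g x - g L.base) := by
      simp only [dotProduct, Pi.sub_apply]
      exact Finset.sum_le_sum_of_subset_of_nonneg (Finset.subset_univ _)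
        fun i _ _ => mul_self_nonneg _
    rw [Finset.sum_insert hj', hF, hn] at hle
    have : (g x j - g L.base j) * (g x j - g L.base j) ≤ 0 := by linarith
    have := mul_self_eq_zero.1 (le_antisymm this (mul_self_nonneg _))
    omega
  let e : I ≃ {j // j ∈ Set.range τ} := Equiv.ofInjective τ hinj
  -- Axes orthogonal to `L` may be matched arbitrarily: the coordinates there are constant on `L`
  -- and are absorbed by the shift.
  let π : Equiv.Perm (Fin N) := Equiv.extendSubtype (p := fun i => L.dir i ≠ 0) e
  have hπ : ∀ i : I, π i = τ i := fun i => Equiv.extendSubtype_apply_of_mem e i.1 i.2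
  -- `s` is the sign of the image of `L.unit i`, which already contains `L.dir i`; the extra factor
  -- converts it into the sign of the image of `e_i`.
  let u : Fin N → ℤˣ := fun i => if h : L.dir i ≠ 0 then s ⟨i, h⟩ *
    ⟨L.dir i, L.dir i, SignType.intCast_mul_self h, SignType.intCast_mul_self h⟩ else 1
  refine ⟨⟨π.symm, fun j => u (π.symm j),
    fun j => g L.base j - u (π.symm j) * L.base (π.symm j)⟩, fun x hx => ?_⟩
  funext j
  obtain ⟨i, rfl⟩ := π.surjective j
  simp only [SignedAffine.app, Equiv.symm_apply_apply]
  by_cases hi : L.dir i ≠ 0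
  · have h1 := hcoord ⟨i, hi⟩ x hx
    have h2 := hπ ⟨i, hi⟩
    simp only at h1 h2
    rw [h2]
    simp only [u, dif_pos hi, Units.val_mul]
    linear_combination h1
  · have h2 : π i ∉ Set.range τ := by
      rintro ⟨i', hi'⟩
      rw [← hπ i'] at hi'
      exact hi (π.injective hi' ▸ i'.2)
    rw [hrest x hx _ h2, (Orthant.mem_carrier_iff.1 hx i).1 (not_not.1 hi)]
    ring

theorem isometricOn_of_eqOn {g : Equiv.Perm (ZLat N)} {L : Orthant N} {f : SignedAffine N}
    (h : Set.EqOn g f.app L.carrier) : IsometricOn g L := fun x hx y hy => by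
  rw [h hx, h hy, f.sqDist_app]

/-! ### Cell decompositions of `ℤ^N`, and orthohedral sets as unions of cells. -/

/-- Truncation of all coordinates to the interval `[-(R + 1), R + 1]`. -/
def clampBox (R : ℕ) (x : ZLat N) : ZLat N := fun i => max (-(R + 1)) (min (R + 1) (x i))

theorem clampBox_eq_iff {R : ℕ} {x y : ZLat N} : clampBox R x = clampBox R y ↔
    ∀ i, x i = y i ∨ ((R : ℤ) < x i ∧ (R : ℤ) < y i) ∨ (x i < -R ∧ y i < -R) := by
  rw [funext_iff]
  refine forall_congr' fun i => ?_
  simp only [clampBox]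
  omega

theorem clampBox_mono {R R' : ℕ} (h : R ≤ R') {x y : ZLat N} (hxy : clampBox R' x = clampBox R' y) :
    clampBox R x = clampBox R y := by
  rw [clampBox_eq_iff] at hxy ⊢
  intro i
  have := hxy i
  omega

theorem clampBox_idem (R : ℕ) (x : ZLat N) : clampBox R (clampBox R x) = clampBox R x := by
  funext i
  simp only [clampBox]
  omega

theorem finite_range_clampBox (N R : ℕ) : (Set.range (clampBox (N := N) R)).Finite := by
  refine (Set.finite_Icc (fun _ => -((R : ℤ) + 1)) (fun _ => (R : ℤ) + 1)).subset ?_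
  rintro _ ⟨x, rfl⟩
  refine ⟨fun i => ?_, fun i => ?_⟩ <;> simp only [clampBox] <;> omega

/-- The fibre of `clampBox R` through `c`, as an orthant. -/
def cell (R : ℕ) (c : ZLat N) : Orthant N :=
  ⟨clampBox R c, fun i => if (R : ℤ) < c i then 1 else if c i < -R then -1 else 0⟩

theorem mem_cell {R : ℕ} {c x : ZLat N} :
    x ∈ (cell R c).carrier ↔ clampBox R x = clampBox R c := by
  rw [Orthant.mem_carrier_iff, funext_iff]
  refine forall_congr' fun i => ?_
  simp only [cell, clampBox]
  split_ifs <;> simp <;> omega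

/-- `T` is a union of fibres of `clampBox R`. -/
def Cellular (R : ℕ) (T : Set (ZLat N)) : Prop :=
  ∀ x y, clampBox R x = clampBox R y → x ∈ T → y ∈ T

theorem Cellular.mono {R R' : ℕ} {T : Set (ZLat N)} (h : Cellular R T) (hR : R ≤ R') :
    Cellular R' T := fun x y hxy => h x y (clampBox_mono hR hxy)

theorem Cellular.compl {R : ℕ} {T : Set (ZLat N)} (h : Cellular R T) : Cellular R Tᶜ :=
  fun x y hxy hx hy => hx (h y x hxy.symm hy)

theorem Cellular.inter {R : ℕ} {T T' : Set (ZLat N)} (h : Cellular R T) (h' : Cellular R T') :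
    Cellular R (T ∩ T') := fun x y hxy hx => ⟨h x y hxy hx.1, h' x y hxy hx.2⟩

theorem Orthant.exists_cellular (L : Orthant N) : ∃ R, Cellular R L.carrier := by
  refine ⟨∑ i, (L.base i).natAbs + 1, fun x y hxy hx => ?_⟩
  rw [clampBox_eq_iff] at hxy
  rw [Orthant.mem_carrier_iff] at hx ⊢
  intro i
  have h1 : (L.base i).natAbs ≤ ∑ i, (L.base i).natAbs :=
    Finset.single_le_sum (f := fun i => (L.base i).natAbs) (fun _ _ => Nat.zero_le _)
      (Finset.mem_univ i)
  generalize ∑ i, (L.base i).natAbs = t at *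
  have h2 := hx i
  have h3 := hxy i
  rcases SignType.cases_int (L.dir i) with ⟨h, h'⟩ | ⟨h, h'⟩ | ⟨h, h'⟩ <;> rw [h'] at h2 ⊢ <;>
    rw [h] at h2 ⊢ <;> simp at h2 h3 ⊢ <;> omega

theorem exists_cellular_of_finite {ι : Type*} {s : Set ι} (hs : s.Finite)
    {T : ι → Set (ZLat N)} (h : ∀ i ∈ s, ∃ R, Cellular R (T i)) :
    ∃ R, ∀ i ∈ s, Cellular R (T i) := by
  choose! R hR using h
  refine ⟨hs.toFinset.sup R, fun i hi => (hR i hi).mono ?_⟩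
  exact Finset.le_sup (f := R) (hs.mem_toFinset.2 hi)

theorem Cellular.biUnion {ι : Type*} {s : Set ι} {T : ι → Set (ZLat N)} {R : ℕ}
    (h : ∀ i ∈ s, Cellular R (T i)) : Cellular R (⋃ i ∈ s, T i) := by
  intro x y hxy hx
  simp only [Set.mem_iUnion] at hx ⊢
  obtain ⟨i, hi, hx⟩ := hx
  exact ⟨i, hi, h i hi x y hxy hx⟩

/-- Clamping has finite range and is idempotent, so the clamped points of `T` represent all its
fibres. -/
theorem Cellular.exists_cells {R : ℕ} {T : Set (ZLat N)} (h : Cellular R T) :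
    ∃ Λ : Finset (Orthant N), T = ⋃ L ∈ Λ, L.carrier ∧
      (∀ L ∈ Λ, ∀ L' ∈ Λ, L ≠ L' → Disjoint L.carrier L'.carrier) ∧
      ∀ L ∈ Λ, ∃ c ∈ T, L = cell R c := by
  classical
  have hfin : (T ∩ Set.range (clampBox R)).Finite := (finite_range_clampBox N R).inter_of_right _
  refine ⟨hfin.toFinset.image (cell R), ?_, ?_, ?_⟩
  · ext x
    simp only [Finset.mem_image, Set.Finite.mem_toFinset, Set.iUnion_exists, Set.mem_iUnion]
    constructor
    · intro hx
      refine ⟨_, _, ⟨⟨h x _ (clampBox_idem R x).symm hx, Set.mem_range_self x⟩, rfl⟩, ?_⟩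
      rw [mem_cell, clampBox_idem]
    · rintro ⟨_, c, ⟨hc, rfl⟩, hx⟩
      rw [mem_cell] at hx
      exact h _ _ hx.symm hc.1
  · intro L hL L' hL' hne
    simp only [Finset.mem_image, Set.Finite.mem_toFinset] at hL hL'
    obtain ⟨c, ⟨-, d, rfl⟩, rfl⟩ := hL
    obtain ⟨c', ⟨-, d', rfl⟩, rfl⟩ := hL'
    rw [Set.disjoint_left]
    intro x hx hx'
    rw [mem_cell, clampBox_idem] at hx hx'
    exact hne (by rw [← hx, ← hx'])
  · intro L hL
    simp only [Finset.mem_image, Set.Finite.mem_toFinset] at hL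
    obtain ⟨c, hc, rfl⟩ := hL
    exact ⟨c, hc.1, rfl⟩

/-- Unions of fibres of one level form a Boolean algebra, and levels can be raised. So complements,
intersections and differences of orthohedral sets are orthohedral, and each such set splits into
disjoint orthants. -/
theorem isOrthohedral_iff {T : Set (ZLat N)} : IsOrthohedral T ↔ ∃ R, Cellular R T := by
  constructor
  · rintro ⟨Λ, rfl⟩
    obtain ⟨R, hR⟩ := exists_cellular_of_finite Λ.finite_toSet
      (T := fun L : Orthant N => L.carrier) fun L _ => L.exists_cellular
    exact ⟨R, Cellular.biUnion hR⟩
  · rintro ⟨R, hR⟩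
    obtain ⟨Λ, h, -⟩ := hR.exists_cells
    exact ⟨Λ, h⟩

theorem Orthant.isOrthohedral (L : Orthant N) : IsOrthohedral L.carrier :=
  isOrthohedral_iff.2 L.exists_cellular

theorem IsOrthohedral.compl {T : Set (ZLat N)} (h : IsOrthohedral T) : IsOrthohedral Tᶜ := by
  rw [isOrthohedral_iff] at h ⊢
  exact h.imp fun R hR => hR.compl

theorem IsOrthohedral.inter {T T' : Set (ZLat N)} (h : IsOrthohedral T) (h' : IsOrthohedral T') :
    IsOrthohedral (T ∩ T') := by
  rw [isOrthohedral_iff] at *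
  obtain ⟨R, hR⟩ := h
  obtain ⟨R', hR'⟩ := h'
  exact ⟨max R R', (hR.mono (le_max_left _ _)).inter (hR'.mono (le_max_right _ _))⟩

theorem IsOrthohedral.diff {T T' : Set (ZLat N)} (h : IsOrthohedral T) (h' : IsOrthohedral T') :
    IsOrthohedral (T \ T') := h.inter h'.compl

theorem IsOrthohedral.biUnion {ι : Type*} {s : Set ι} (hs : s.Finite) {T : ι → Set (ZLat N)}
    (h : ∀ i ∈ s, IsOrthohedral (T i)) : IsOrthohedral (⋃ i ∈ s, T i) := by
  simp only [isOrthohedral_iff] at h ⊢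
  obtain ⟨R, hR⟩ := exists_cellular_of_finite hs h
  exact ⟨R, Cellular.biUnion hR⟩

theorem IsOrthohedral.union {T T' : Set (ZLat N)} (h : IsOrthohedral T) (h' : IsOrthohedral T') :
    IsOrthohedral (T ∪ T') := by
  have := (h.compl.inter h'.compl).compl
  rwa [Set.compl_inter, compl_compl, compl_compl] at this

/-- Once `t` exceeds `R` plus all base coordinates, the coordinates along the axes of `L` lie beyond
`R` with a fixed sign and the others are constant, so the tail stays in one fibre. -/
theorem Orthant.exists_push_clampBox (L : Orthant N) (R : ℕ) :
    ∃ t₀, ∀ t, t₀ ≤ t → ∀ x ∈ (L.push t).carrier, ∀ y ∈ (L.push t).carrier,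
      clampBox R x = clampBox R y := by
  refine ⟨R + ∑ i, (L.base i).natAbs + 1, fun t ht x hx y hy => ?_⟩
  rw [Orthant.mem_push_iff] at hx hy
  rw [clampBox_eq_iff]
  intro i
  have h1 : (L.base i).natAbs ≤ ∑ i, (L.base i).natAbs :=
    Finset.single_le_sum (f := fun i => (L.base i).natAbs) (fun _ _ => Nat.zero_le _)
      (Finset.mem_univ i)
  generalize ∑ i, (L.base i).natAbs = t at *
  have h2 := hx i
  have h3 := hy i
  rcases SignType.cases_int (L.dir i) with ⟨h, h'⟩ | ⟨h, h'⟩ | ⟨h, h'⟩ <;> rw [h'] at h2 h3 <;>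
    rw [h] at h2 h3 <;> simp at h2 h3 ⊢ <;> omega

/-- Far out, an orthant is either contained in a given orthohedral set or disjoint from it. -/
theorem IsOrthohedral.push_dichotomy {T : Set (ZLat N)} (hT : IsOrthohedral T) (L : Orthant N) :
    ∃ t₀, (∀ t, t₀ ≤ t → (L.push t).carrier ⊆ T) ∨
      ∀ t, t₀ ≤ t → Disjoint (L.push t).carrier T := by
  obtain ⟨R, hR⟩ := isOrthohedral_iff.1 hT
  obtain ⟨t₀, ht₀⟩ := L.exists_push_clampBox R
  refine ⟨t₀, ?_⟩
  by_cases hb : (L.push t₀).base ∈ T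
  · left
    intro t ht x hx
    exact hR _ _ (ht₀ t₀ le_rfl _ (Orthant.base_mem _) _ (L.push_anti ht hx)) hb
  · right
    intro t ht
    rw [Set.disjoint_left]
    intro x hx hxT
    exact hb (hR _ _ (ht₀ t₀ le_rfl _ (L.push_anti ht hx) _ (Orthant.base_mem _)) hxT)

end

/-! ### Piecewise isometric permutations as maps that are signed affine on the cells of some level.
-/

section

variable {N : ℕ}

/-- A signed permutation of the coordinates respects fibres, and a shift by at most `B` costs `B`
levels. -/
theorem SignedAffine.clampBox_app {f : SignedAffine N} {B R : ℕ}
    (hB : ∀ j, (f.shift j).natAbs ≤ B) {x y : ZLat N}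
    (h : clampBox (R + B) x = clampBox (R + B) y) :
    clampBox R (f.app x) = clampBox R (f.app y) := by
  rw [clampBox_eq_iff] at h ⊢
  intro j
  have h1 := h (f.perm j)
  have h2 := hB j
  simp only [SignedAffine.app]
  rcases Int.units_eq_one_or (f.sgn j) with h | h <;> rw [h] <;> push_cast at h1 ⊢ <;> omega

/-- `g` agrees with a signed affine map on every cell of some level. -/
def PiecewiseIsometric (g : Equiv.Perm (ZLat N)) : Prop :=
  ∃ R, ∀ c, ∃ f : SignedAffine N, ∀ y, clampBox R y = clampBox R c → g y = f.app y

/-- There are only finitely many fibres, so the shifts have a common bound. Composition and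
inversion need it to compare levels before and after applying `g`. -/
theorem PiecewiseIsometric.exists_bounded {g : Equiv.Perm (ZLat N)} (hg : PiecewiseIsometric g) :
    ∃ R B : ℕ, ∀ c, ∃ f : SignedAffine N, (∀ j, (f.shift j).natAbs ≤ B) ∧
      ∀ y, clampBox R y = clampBox R c → g y = f.app y := by
  obtain ⟨R, hR⟩ := hg
  choose F hF using hR
  let s : Finset (ZLat N) := (finite_range_clampBox N R).toFinset
  refine ⟨R, s.sup fun c => ∑ j, ((F c).shift j).natAbs,
    fun c => ⟨F (clampBox R c), fun j => ?_, fun y hy => hF _ y ?_⟩⟩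
  · have h1 : ∑ j, ((F (clampBox R c)).shift j).natAbs ≤
        s.sup fun c => ∑ j, ((F c).shift j).natAbs :=
      Finset.le_sup (f := fun c => ∑ j, ((F c).shift j).natAbs)
        ((finite_range_clampBox N R).mem_toFinset.2 (Set.mem_range_self c))
    exact (Finset.single_le_sum (f := fun j => ((F (clampBox R c)).shift j).natAbs)
      (fun _ _ => Nat.zero_le _) (Finset.mem_univ j)).trans h1
  · rw [hy, clampBox_idem]

theorem PiecewiseIsometric.mul {g h : Equiv.Perm (ZLat N)} (hg : PiecewiseIsometric g)
    (hh : PiecewiseIsometric h) : PiecewiseIsometric (g * h) := by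
  obtain ⟨R, B, hR⟩ := hh.exists_bounded
  obtain ⟨R', hR'⟩ := hg
  refine ⟨max R (R' + B), fun c => ?_⟩
  obtain ⟨f, hfB, hf⟩ := hR c
  obtain ⟨f', hf'⟩ := hR' (f.app c)
  refine ⟨f'.comp f, fun y hy => ?_⟩
  rw [Equiv.Perm.mul_apply, hf y (clampBox_mono (le_max_left _ _) hy), f'.comp_app]
  exact hf' _ (SignedAffine.clampBox_app hfB (clampBox_mono (le_max_right _ _) hy))

/-- If `g` is `f` on the fibre of `g⁻¹ c`, then `f.inv` maps a finer fibre around `c` into that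
fibre and therefore equals `g⁻¹` on it. -/
theorem PiecewiseIsometric.inv {g : Equiv.Perm (ZLat N)} (hg : PiecewiseIsometric g) :
    PiecewiseIsometric g⁻¹ := by
  obtain ⟨R, B, hR⟩ := hg.exists_bounded
  refine ⟨R + B, fun c => ?_⟩
  obtain ⟨f, hfB, hf⟩ := hR (g⁻¹ c)
  have hB : ∀ j, (f.inv.shift j).natAbs ≤ B := by
    intro j
    simp only [SignedAffine.inv]
    rcases Int.units_eq_one_or (f.sgn (f.perm.symm j)) with h | h <;> rw [h] <;>
      simpa using hfB (f.perm.symm j)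
  have hc : f.app (g⁻¹ c) = c := by rw [← hf _ rfl]; simp
  refine ⟨f.inv, fun y hy => ?_⟩
  have h1 := SignedAffine.clampBox_app hB hy
  rw [← hc, f.inv_app_app] at h1
  rw [Equiv.Perm.inv_eq_iff_eq, hf _ h1, f.app_inv_app]

theorem PiecewiseIsometric.one : PiecewiseIsometric (1 : Equiv.Perm (ZLat N)) :=
  ⟨0, fun _ => ⟨SignedAffine.translation 0, fun y _ => by simp⟩⟩

theorem PiecewiseIsometric.of_cover {ι : Type*} {s : Set ι} (hs : s.Finite)
    {A : ι → Set (ZLat N)} (hA : ∀ i ∈ s, IsOrthohedral (A i)) (hcov : ∀ x, ∃ i ∈ s, x ∈ A i)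
    {f : ι → SignedAffine N} {g : Equiv.Perm (ZLat N)}
    (hg : ∀ i ∈ s, ∀ x ∈ A i, g x = (f i).app x) : PiecewiseIsometric g := by
  simp only [isOrthohedral_iff] at hA
  obtain ⟨R, hR⟩ := exists_cellular_of_finite hs hA
  refine ⟨R, fun c => ?_⟩
  obtain ⟨i, hi, hc⟩ := hcov c
  exact ⟨f i, fun y hy => hg i hi y (hR i hi c y hy.symm hc)⟩

/-- Partitions into orthants are replaced by levels: comparing two partitions takes a common
refinement, comparing two levels only a maximum. -/
theorem mem_pei_iff {S : Set (ZLat N)} (hS : IsOrthohedral S) {g : Equiv.Perm (ZLat N)} :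
    g ∈ pei S ↔ (∀ x, x ∉ S → g x = x) ∧ PiecewiseIsometric g := by
  constructor
  · rintro ⟨hfix, Λ, hΛ, -, hiso⟩
    refine ⟨hfix, ?_⟩
    have hex : ∀ L : Orthant N, ∃ f : SignedAffine N, L ∈ Λ → Set.EqOn g f.app L.carrier := by
      intro L
      by_cases hL : L ∈ Λ
      · obtain ⟨f, hf⟩ := (hiso L hL).exists_signedAffine
        exact ⟨f, fun _ => hf⟩
      · exact ⟨SignedAffine.translation 0, fun h => absurd h hL⟩
    choose F hF using hex
    refine PiecewiseIsometric.of_cover (s := insert none (some '' (Λ : Set (Orthant N))))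
      (A := fun o => o.elim Sᶜ Orthant.carrier)
      (f := fun o => o.elim (SignedAffine.translation 0) F)
      ((Λ.finite_toSet.image _).insert _) ?_ ?_ ?_
    · rintro i (rfl | ⟨L, -, rfl⟩)
      · exact hS.compl
      · exact L.isOrthohedral
    · intro x
      by_cases hx : x ∈ S
      · rw [hΛ] at hx
        simp only [Set.mem_iUnion] at hx
        obtain ⟨L, hL, hx⟩ := hx
        exact ⟨some L, Or.inr ⟨L, hL, rfl⟩, hx⟩
      · exact ⟨none, Or.inl rfl, hx⟩
    · rintro i (rfl | ⟨L, hL, rfl⟩) x hx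
      · simpa using hfix x hx
      · exact hF L hL hx
  · rintro ⟨hfix, R, hR⟩
    obtain ⟨R', hR'⟩ := isOrthohedral_iff.1 hS
    obtain ⟨Λ, hΛ, hdis, hcell⟩ := (hR'.mono (le_max_right R R')).exists_cells
    refine ⟨hfix, Λ, hΛ, hdis, fun L hL => ?_⟩
    obtain ⟨c, -, rfl⟩ := hcell L hL
    obtain ⟨f, hf⟩ := hR c
    exact isometricOn_of_eqOn (f := f) fun x hx =>
      hf x (clampBox_mono (le_max_left R R') (mem_cell.1 hx))

/-! ### Thin sets, and the rank condition in terms of moved points. -/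

/-- `T` is covered by finitely many orthants of rank at most `k`. -/
def Thin (k : ℤ) (T : Set (ZLat N)) : Prop :=
  ∃ Λ : Finset (Orthant N), (∀ L ∈ Λ, (L.rank : ℤ) ≤ k) ∧ T ⊆ ⋃ L ∈ Λ, L.carrier

theorem Thin.mono {k : ℤ} {T T' : Set (ZLat N)} (h : Thin k T) (hT : T' ⊆ T) : Thin k T' :=
  h.imp fun _ hΛ => ⟨hΛ.1, hT.trans hΛ.2⟩

theorem Thin.mono_rank {k k' : ℤ} {T : Set (ZLat N)} (h : Thin k T) (hk : k ≤ k') : Thin k' T :=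
  h.imp fun _ hΛ => ⟨fun L hL => (hΛ.1 L hL).trans hk, hΛ.2⟩

theorem thin_carrier (L : Orthant N) {k : ℤ} (h : (L.rank : ℤ) ≤ k) : Thin k L.carrier :=
  ⟨{L}, by simpa using h, by simp⟩

theorem Thin.biUnion {ι : Type*} {s : Set ι} (hs : s.Finite) {k : ℤ} {T : ι → Set (ZLat N)}
    (h : ∀ i ∈ s, Thin k (T i)) : Thin k (⋃ i ∈ s, T i) := by
  classical
  choose! Λ hΛ using h
  refine ⟨hs.toFinset.biUnion Λ, fun L hL => ?_, fun x hx => ?_⟩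
  · simp only [Finset.mem_biUnion, Set.Finite.mem_toFinset] at hL
    obtain ⟨i, hi, hL⟩ := hL
    exact (hΛ i hi).1 L hL
  · simp only [Set.mem_iUnion] at hx
    obtain ⟨i, hi, hx⟩ := hx
    have := (hΛ i hi).2 hx
    simp only [Set.mem_iUnion] at this ⊢
    obtain ⟨L, hL, hx⟩ := this
    exact ⟨L, Finset.mem_biUnion.2 ⟨i, hs.mem_toFinset.2 hi, hL⟩, hx⟩

theorem Thin.union {k : ℤ} {T T' : Set (ZLat N)} (h : Thin k T) (h' : Thin k T') :
    Thin k (T ∪ T') := by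
  classical
  obtain ⟨Λ, h1, h2⟩ := h
  obtain ⟨Λ', h1', h2'⟩ := h'
  refine ⟨Λ ∪ Λ', fun L hL => (Finset.mem_union.1 hL).elim (h1 L) (h1' L), ?_⟩
  rw [Finset.set_biUnion_union]
  exact Set.union_subset_union h2 h2'

theorem thin_empty (k : ℤ) : Thin k (∅ : Set (ZLat N)) := ⟨∅, by simp, by simp⟩

/-- At a level where every orthant of `Λ` is a union of fibres, a tail of `L` inside one fibre lies
in `M` as soon as its base point does. -/
theorem Orthant.exists_push_subset_of_cover {L : Orthant N} {Λ : Finset (Orthant N)}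
    (h : L.carrier ⊆ ⋃ M ∈ Λ, M.carrier) : ∃ M ∈ Λ, ∃ t, (L.push t).carrier ⊆ M.carrier := by
  obtain ⟨R, hR⟩ := exists_cellular_of_finite Λ.finite_toSet
    (T := fun L : Orthant N => L.carrier) fun L _ => L.exists_cellular
  obtain ⟨t, ht⟩ := L.exists_push_clampBox R
  have hb := h (L.push_subset t (Orthant.base_mem _))
  simp only [Set.mem_iUnion] at hb
  obtain ⟨M, hM, hb⟩ := hb
  exact ⟨M, hM, t, fun x hx => hR M hM _ _ (ht t le_rfl _ (Orthant.base_mem _) _ hx) hb⟩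

theorem Thin.rank_le {k : ℤ} {T : Set (ZLat N)} (h : Thin k T) {L : Orthant N}
    (hL : L.carrier ⊆ T) : (L.rank : ℤ) ≤ k := by
  obtain ⟨Λ, h1, h2⟩ := h
  obtain ⟨M, hM, t, ht⟩ := Orthant.exists_push_subset_of_cover (hL.trans h2)
  have := Orthant.rank_le_of_subset ht
  rw [Orthant.push_rank] at this
  have := h1 M hM
  omega

/-- A tail of a rank-`k` orthant in `T` lies in one covering orthant, and the rank bound makes the
two parallel. So every germ counted is the germ of a covering orthant. -/
theorem Thin.finite_germs {k : ℕ} {T : Set (ZLat N)} (h : Thin k T) : (germs k T).Finite := by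
  obtain ⟨Λ, h1, h2⟩ := h
  refine (Λ.finite_toSet.image Orthant.germ).subset ?_
  rintro _ ⟨L, hr, hL, rfl⟩
  obtain ⟨M, hM, t, ht⟩ := Orthant.exists_push_subset_of_cover (hL.trans h2)
  refine ⟨M, hM, ?_⟩
  have hle := Orthant.rank_le_of_subset ht
  rw [Orthant.push_rank] at hle
  have := h1 M hM
  rw [Orthant.germ_eq_iff]
  refine (Orthant.parallel_of_subset ht ?_).trans (L.parallel_push t).symm
  rw [Orthant.push_rank]; omega

/-- The coset of a coordinate subgroup that contains `L`. -/
def Orthant.span (L : Orthant N) : Set (ZLat N) := {x | ∀ i, L.dir i = 0 → x i = L.base i}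

theorem Orthant.carrier_subset_span (L : Orthant N) : L.carrier ⊆ L.span :=
  fun _ hx i hi => (Orthant.mem_carrier_iff.1 hx i).1 hi

/-- The coset is covered by the orthants at `L.base`, one for each choice of signs on the axes of
`L`. -/
theorem thin_span (L : Orthant N) {k : ℤ} (h : (L.rank : ℤ) ≤ k) : Thin k L.span := by
  classical
  let D : Finset (Fin N → SignType) := Finset.univ.filter fun d => ∀ i, d i = 0 ↔ L.dir i = 0
  refine ⟨D.image fun d => ⟨L.base, d⟩, fun M hM => ?_, fun x hx => ?_⟩
  · simp only [Finset.mem_image, D, Finset.mem_filter, Finset.mem_univ, true_and] at hM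
    obtain ⟨d, hd, rfl⟩ := hM
    simp only [Orthant.rank, ne_eq, hd]
    exact h
  · simp only [Set.mem_iUnion]
    refine ⟨⟨L.base, fun i => if L.dir i = 0 then 0 else if L.base i ≤ x i then 1 else -1⟩,
      Finset.mem_image.2 ⟨_, ?_, rfl⟩, ?_⟩
    · simp only [D, Finset.mem_filter, Finset.mem_univ, true_and]
      intro i
      split_ifs <;> simp_all
    · rw [Orthant.mem_carrier_iff]
      intro i
      dsimp only
      split_ifs with h1 h2
      · simpa using hx i h1
      · simpa using h2
      · simp; omega

theorem IsometricOn.add_nsmul {g : Equiv.Perm (ZLat N)} {f : SignedAffine N} {K : Orthant N}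
    (hf : Set.EqOn g f.app K.carrier) {y : ZLat N} (hy : y ∈ K.carrier) (i : Fin N) (n : ℕ) :
    y + n • K.unit i ∈ K.carrier ∧ g (y + n • K.unit i) = g y + n • f.lin (K.unit i) := by
  have hmem : y + n • K.unit i ∈ K.carrier := by
    induction n with
    | zero => simpa using hy
    | succ n ih =>
      rw [succ_nsmul, ← add_assoc]
      exact Orthant.add_unit_mem ih i
  refine ⟨hmem, ?_⟩
  rw [hf hmem, hf hy, SignedAffine.app_add, SignedAffine.lin_nsmul]

/-- If `g` is a nontrivial isometric embedding on `K` and fixes a point `y` of `K`, then it moves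
a whole coordinate ray at `y`, except for `y`. -/
theorem IsometricOn.exists_moved_ray {g : Equiv.Perm (ZLat N)} {K : Orthant N}
    {f : SignedAffine N} (hf : Set.EqOn g f.app K.carrier) (hne : ∃ x ∈ K.carrier, g x ≠ x)
    {y : ZLat N} (hy : y ∈ K.carrier) (hgy : g y = y) :
    ∃ i, K.dir i ≠ 0 ∧ f.lin (K.unit i) ≠ K.unit i ∧
      ∀ n : ℕ, 1 ≤ n → g (y + n • K.unit i) ≠ y + n • K.unit i := by
  have h1 : ∃ i, K.dir i ≠ 0 ∧ f.lin (K.unit i) ≠ K.unit i := by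
    -- If the linear part fixed every unit vector of `K`, then `f`, which fixes `y`, would be the
    -- identity on `K`.
    by_contra! hc
    obtain ⟨x, hx, hgx⟩ := hne
    apply hgx
    have := SignedAffine.eqOn_of_add_unit (f := f) (h := SignedAffine.translation 0) hy
      (by rw [← hf hy, hgy]; simp)
      (fun i hi => by rw [f.app_add, ← hf hy, hgy, hc i hi]; simp)
    rw [hf hx, this hx]; simp
  obtain ⟨i, hi, hfi⟩ := h1
  refine ⟨i, hi, hfi, fun n hn h => hfi ?_⟩
  rw [(IsometricOn.add_nsmul hf hy i n).2, hgy, add_right_inj] at h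
  exact smul_right_injective _ (by omega) h

theorem moved_subset_peiSupp (g : Equiv.Perm (ZLat N)) : {x | g x ≠ x} ⊆ peiSupp g := by
  intro x hx
  simp only [peiSupp, Set.mem_iUnion]
  have hmem : ∀ y, y ∈ (⟨x, 0⟩ : Orthant N).carrier ↔ y = x := by
    intro y
    rw [Orthant.mem_carrier_iff]
    simp [funext_iff]
  refine ⟨⟨x, 0⟩, ⟨fun y hy z hz => ?_, x, (hmem x).2 rfl, hx⟩, (hmem x).2 rfl⟩
  rw [(hmem y).1 hy, (hmem z).1 hz]; simp [sqDist]

/-- The support may contain fixed points. At such a point `y` some coordinate ray is moved, so a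
tail of it lies in one covering orthant `L`. Then `L` extends along the ray, and `y`, differing from
the tail only in that coordinate, lies in `L.span`; passing to spans does not raise the rank. -/
theorem Thin.peiSupp {k : ℤ} {g : Equiv.Perm (ZLat N)} (h : Thin k {x | g x ≠ x}) :
    Thin k (peiSupp g) := by
  obtain ⟨Λ, h1, h2⟩ := h
  refine (Thin.biUnion Λ.finite_toSet (T := Orthant.span) fun L hL => thin_span L (h1 L hL)).mono ?_
  intro y hy
  simp only [_root_.peiSupp, Set.mem_iUnion] at hy
  obtain ⟨K, ⟨hiso, hne⟩, hy⟩ := hy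
  simp only [Set.mem_iUnion]
  by_cases hgy : g y = y
  · obtain ⟨f, hf⟩ := hiso.exists_signedAffine
    obtain ⟨i, hi, -, hray⟩ := IsometricOn.exists_moved_ray hf hne hy hgy
    let M : Orthant N := ⟨y + K.unit i, fun j => if j = i then K.dir i else 0⟩
    have hM : M.carrier ⊆ ⋃ L ∈ Λ, L.carrier := by
      intro x hx
      apply h2
      have hx' : ∃ n : ℕ, 1 ≤ n ∧ x = y + n • K.unit i := by
        obtain ⟨n, hn⟩ := hx i
        refine ⟨n + 1, by omega, ?_⟩
        funext j
        by_cases hj : j = i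
        · subst hj
          simp [M, Orthant.unit] at hn ⊢
          rw [hn]; ring
        · have := (Orthant.mem_carrier_iff.1 hx j).1
          simpa [M, hj, Orthant.unit] using this
      obtain ⟨n, hn, rfl⟩ := hx'
      exact hray n hn
    obtain ⟨L, hL, t, ht⟩ := Orthant.exists_push_subset_of_cover hM
    refine ⟨L, hL, fun j hj => ?_⟩
    have hji : j ≠ i := by
      rintro rfl
      have := Orthant.dir_of_subset ht j (by simpa [M] using hi)
      rw [hj] at this
      simp [M] at this
      exact hi this.symm
    have := (Orthant.mem_carrier_iff.1 (ht (Orthant.base_mem _)) j).1 hj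
    simpa [M, Orthant.push, hji, Orthant.unit] using this
  · have := h2 hgy
    simp only [Set.mem_iUnion] at this
    obtain ⟨L, hL, hy⟩ := this
    exact ⟨L, hL, L.carrier_subset_span hy⟩

/-- Replaces the rank of the support by thinness of the set of moved points, which is visibly
preserved by products and inverses. -/
theorem mem_rankGroup_iff {S : Set (ZLat N)} (hS : IsOrthohedral S) {k : ℤ}
    {g : Equiv.Perm (ZLat N)} : g ∈ rankGroup k S ↔
      (∀ x, x ∉ S → g x = x) ∧ PiecewiseIsometric g ∧ Thin k {x | g x ≠ x} := by
  rw [← and_assoc, ← mem_pei_iff hS]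
  constructor
  · rintro ⟨hpei, hr⟩
    refine ⟨hpei, ?_⟩
    classical
    obtain ⟨hfix, Λ, hΛ, -, hiso⟩ := hpei
    refine ⟨Λ.filter fun L => ∃ x ∈ L.carrier, g x ≠ x, fun L hL => ?_, fun x hx => ?_⟩
    · rw [Finset.mem_filter] at hL
      refine hr L fun x hx => ?_
      simp only [peiSupp, Set.mem_iUnion]
      exact ⟨L, ⟨hiso L hL.1, hL.2⟩, hx⟩
    · have hxS : x ∈ S := by
        by_contra hc
        exact hx (hfix x hc)
      rw [hΛ] at hxS
      simp only [Set.mem_iUnion] at hxS ⊢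
      obtain ⟨L, hL, hxL⟩ := hxS
      exact ⟨L, Finset.mem_filter.2 ⟨hL, x, hxL, hx⟩, hxL⟩
  · rintro ⟨hpei, ht⟩
    exact ⟨hpei, fun L hL => ht.peiSupp.rank_le hL⟩

end

/-! ### Behaviour of a permutation far out on an orthant. -/

section

variable {N : ℕ}

theorem Orthant.carrier_injective : Function.Injective (Orthant.carrier (N := N)) := by
  intro L M h
  have hd : L.dir = M.dir := (Orthant.parallel_of_subset (M := L) (L := M) h.le
    (le_antisymm (Orthant.rank_le_of_subset h.le) (Orthant.rank_le_of_subset h.ge))).1.symm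
  refine Orthant.ext (funext fun i => ?_) hd
  have h1 := Orthant.mem_carrier_iff.1 (h ▸ L.base_mem) i
  have h2 := Orthant.mem_carrier_iff.1 (h.symm ▸ M.base_mem) i
  rw [hd] at h2
  rcases SignType.cases_int (M.dir i) with ⟨k, k'⟩ | ⟨k, k'⟩ | ⟨k, k'⟩ <;> rw [k'] at h1 h2 <;>
    simp [k] at h1 h2 <;> omega

theorem Orthant.unit_push (L : Orthant N) (t : ℕ) (i : Fin N) : (L.push t).unit i = L.unit i := rfl

/-- Far out on `L`, the permutation `g` agrees with `f`. -/
def TailEq (g : Equiv.Perm (ZLat N)) (L : Orthant N) (f : SignedAffine N) : Prop :=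
  ∃ t, Set.EqOn g f.app (L.push t).carrier

theorem TailEq.of_eqOn {g : Equiv.Perm (ZLat N)} {L : Orthant N} {f : SignedAffine N}
    (h : Set.EqOn g f.app L.carrier) : TailEq g L f := ⟨0, by rwa [L.push_zero]⟩

theorem PiecewiseIsometric.exists_tailEq {g : Equiv.Perm (ZLat N)} (hg : PiecewiseIsometric g)
    (L : Orthant N) : ∃ f, TailEq g L f := by
  obtain ⟨R, hR⟩ := hg
  obtain ⟨t, ht⟩ := L.exists_push_clampBox R
  obtain ⟨f, hf⟩ := hR (L.push t).base
  exact ⟨f, t, fun x hx => hf x (ht t le_rfl _ hx _ (Orthant.base_mem _))⟩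

theorem TailEq.of_parallel {g : Equiv.Perm (ZLat N)} {L L' : Orthant N} {f : SignedAffine N}
    (h : TailEq g L f) (hL : L.Parallel L') : TailEq g L' f := by
  obtain ⟨t, ht⟩ := h
  obtain ⟨s, hs⟩ := (hL.symm.trans (L.parallel_push t)).exists_push_subset
  exact ⟨s, ht.mono hs⟩

/-- A common tail contains a point together with all its unit neighbours along `L`, which is enough
for rigidity. -/
theorem TailEq.eqOn {g : Equiv.Perm (ZLat N)} {L : Orthant N} {f f' : SignedAffine N}
    (h : TailEq g L f) (h' : TailEq g L f') : Set.EqOn f.app f'.app L.carrier := by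
  obtain ⟨t, ht⟩ := h
  obtain ⟨t', ht'⟩ := h'
  have key : ∀ x ∈ (L.push (max t t')).carrier, f.app x = f'.app x := fun x hx => by
    rw [← ht (L.push_anti (le_max_left _ _) hx), ← ht' (L.push_anti (le_max_right _ _) hx)]
  refine SignedAffine.eqOn_of_add_unit (L.push_subset (max t t') (Orthant.base_mem _))
    (key _ (Orthant.base_mem _)) fun i _ => key _ ?_
  rw [← L.unit_push (max t t')]
  exact Orthant.add_unit_mem (Orthant.base_mem _) i

theorem SignedAffine.map_congr {L : Orthant N} {f f' : SignedAffine N}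
    (h : Set.EqOn f.app f'.app L.carrier) : f.map L = f'.map L := by
  apply Orthant.carrier_injective
  rw [← f.image_carrier, ← f'.image_carrier, h.image_eq]

theorem SignedAffine.lin_unit_congr {L : Orthant N} {f f' : SignedAffine N}
    (h : Set.EqOn f.app f'.app L.carrier) (i : Fin N) : f.lin (L.unit i) = f'.lin (L.unit i) := by
  have := h (Orthant.add_unit_mem L.base_mem i)
  rwa [f.app_add, f'.app_add, h L.base_mem, add_right_inj] at this

theorem TailEq.mul {g h : Equiv.Perm (ZLat N)} {L : Orthant N} {f f' : SignedAffine N}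
    (hf : TailEq h L f) (hf' : TailEq g (f.map L) f') : TailEq (g * h) L (f'.comp f) := by
  obtain ⟨t, ht⟩ := hf
  obtain ⟨t', ht'⟩ := hf'
  refine ⟨max t t', fun x hx => ?_⟩
  rw [Equiv.Perm.mul_apply, ht (L.push_anti (le_max_left _ _) hx), f'.comp_app]
  apply ht'
  rw [← f.map_push]
  exact SignedAffine.app_mem_map.2 (L.push_anti (le_max_right _ _) hx)

theorem TailEq.inv {g : Equiv.Perm (ZLat N)} {L : Orthant N} {f : SignedAffine N}
    (hf : TailEq g L f) : TailEq g⁻¹ (f.map L) f.inv := by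
  obtain ⟨t, ht⟩ := hf
  refine ⟨t, fun x hx => ?_⟩
  rw [← f.map_push, ← f.image_carrier] at hx
  obtain ⟨y, hy, rfl⟩ := hx
  rw [f.inv_app_app, Equiv.Perm.inv_eq_iff_eq, ht hy]

theorem TailEq.one (L : Orthant N) : TailEq 1 L (SignedAffine.translation 0) :=
  ⟨0, fun x _ => by simp⟩

/-- By rigidity the affine map of any witness of `SendsGerm` agrees with `f` on `L`, so the image
germ is that of `f.map L`. -/
theorem TailEq.sendsGerm_iff {g : Equiv.Perm (ZLat N)} {L M : Orthant N} {f : SignedAffine N}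
    (h : TailEq g L f) : SendsGerm g L.germ M.germ ↔ (f.map L).Parallel M := by
  constructor
  · rintro ⟨L₁, hL₁, M₁, hM₁, hiso, him⟩
    obtain ⟨f₁, hf₁⟩ := hiso.exists_signedAffine
    rw [Orthant.mem_germ] at hL₁ hM₁
    have e1 : f₁.map L₁ = M₁ := Orthant.carrier_injective (by
      rw [← f₁.image_carrier, ← him, hf₁.image_eq])
    have e2 : f.map L = f₁.map L := SignedAffine.map_congr
      (h.eqOn ((TailEq.of_eqOn hf₁).of_parallel hL₁.symm))
    rw [e2]
    exact (f₁.map_parallel hL₁).trans (e1 ▸ hM₁.symm)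
  · intro hp
    obtain ⟨t, ht⟩ := h
    refine ⟨L.push t, Orthant.mem_germ.2 (L.parallel_push t), f.map (L.push t),
      Orthant.mem_germ.2 ?_, isometricOn_of_eqOn ht, ?_⟩
    · rw [f.map_push]
      exact hp.symm.trans (Orthant.parallel_push _ t)
    · rw [ht.image_eq, f.image_carrier]

theorem mem_germDirections_germ {L : Orthant N} {y : ZLat N} :
    y ∈ germDirections L.germ ↔ ∃ i, L.dir i ≠ 0 ∧ y = L.unit i := by
  constructor
  · rintro ⟨M, hM, i, hi, rfl⟩
    rw [Orthant.mem_germ] at hM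
    exact ⟨i, hM.1 ▸ hi, by simp [Orthant.unit, hM.1]⟩
  · intro hy
    exact ⟨L, L.self_mem_germ, hy⟩

/-- Rigidity identifies the linear part of any witness with that of `f` on the unit vectors of `L`;
existence and uniqueness of the induced permutation are read off from `f`. -/
theorem TailEq.permutesDirections_iff {g : Equiv.Perm (ZLat N)} {L : Orthant N}
    {f : SignedAffine N} (h : TailEq g L f) {σ : Equiv.Perm (germDirections L.germ)} :
    PermutesDirections g L.germ σ ↔
      (f.map L).Parallel L ∧ ∀ y : germDirections L.germ, f.lin y = σ y := by
  constructor
  · rintro ⟨L₁, hL₁, M₁, hM₁, hiso, him, hσ⟩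
    refine ⟨h.sendsGerm_iff.1 ⟨L₁, hL₁, M₁, hM₁, hiso, him⟩, fun y => ?_⟩
    obtain ⟨f₁, hf₁⟩ := hiso.exists_signedAffine
    rw [Orthant.mem_germ] at hL₁ hM₁
    have e2 := (h.eqOn ((TailEq.of_eqOn hf₁).of_parallel hL₁.symm))
    obtain ⟨i, hi, hy⟩ := mem_germDirections_germ.1 y.2
    have hu : L.unit i = L₁.unit i := by simp [Orthant.unit, hL₁.1]
    have h1 := hσ _ L₁.base_mem y
    rw [hy, hu, hf₁ (Orthant.add_unit_mem L₁.base_mem i), hf₁ L₁.base_mem, f₁.app_add,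
      add_right_inj, ← hu, ← SignedAffine.lin_unit_congr e2, ← hy] at h1
    exact h1
  · rintro ⟨hp, hσ⟩
    obtain ⟨t, ht⟩ := h
    refine ⟨L.push t, Orthant.mem_germ.2 (L.parallel_push t), f.map (L.push t),
      Orthant.mem_germ.2 ?_, isometricOn_of_eqOn ht, ?_, fun x hx y => ?_⟩
    · rw [f.map_push]
      exact hp.symm.trans (Orthant.parallel_push _ t)
    · rw [ht.image_eq, f.image_carrier]
    · obtain ⟨i, hi, hy⟩ := mem_germDirections_germ.1 y.2
      rw [← hσ y, hy, ht hx, ← L.unit_push t, ht (Orthant.add_unit_mem hx i), f.app_add]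

theorem translatesGerm_iff {g : Equiv.Perm (ZLat N)} {L : Orthant N} {v : ZLat N} :
    TranslatesGerm g L.germ v ↔ TailEq g L (SignedAffine.translation v) := by
  constructor
  · rintro ⟨L₁, hL₁, h⟩
    exact (TailEq.of_eqOn (L := L₁) fun x hx => by simpa using h x hx).of_parallel
      (Orthant.mem_germ.1 hL₁).symm
  · rintro ⟨t, ht⟩
    exact ⟨L.push t, Orthant.mem_germ.2 (L.parallel_push t), fun x hx => by simpa using ht hx⟩

theorem tangentCoset_germ (L : Orthant N) : tangentCoset L.germ = L.span := by
  ext x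
  simp only [tangentCoset, Set.mem_iUnion, Orthant.mem_germ]
  constructor
  · rintro ⟨M, hM, hx⟩ i hi
    rw [(Orthant.mem_carrier_iff.1 hx i).1 (hM.1 ▸ hi), hM.2 i hi]
  · intro hx
    exact ⟨⟨x, L.dir⟩, ⟨rfl, fun i hi => (hx i hi).symm⟩, Orthant.base_mem _⟩

open Pointwise in
theorem mem_transGroup_germ {L : Orthant N} {v : ZLat N} :
    v ∈ TransGroup L.germ ↔ ∀ i, L.dir i = 0 → v i = 0 := by
  rw [TransGroup, tangentCoset_germ, AddAction.mem_stabilizer_iff, Set.ext_iff]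
  simp only [Set.mem_vadd_set_iff_neg_vadd_mem]
  constructor
  · intro h i hi
    have := (h L.base).2 (fun _ _ => rfl) i hi
    simp at this
    exact this
  · intro h x
    refine forall_congr' fun i => imp_congr_right fun hi => ?_
    simp [h i hi]

/-- A tail of `L` is contained in the union of the covering orthants or disjoint from it, and its
rank excludes the former. -/
theorem Thin.tailEq_id {k : ℤ} {g : Equiv.Perm (ZLat N)} (h : Thin k {x | g x ≠ x})
    {L : Orthant N} (hL : k < L.rank) : TailEq g L (SignedAffine.translation 0) := by
  obtain ⟨Λ, h1, h2⟩ := h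
  have hU : IsOrthohedral (⋃ L ∈ Λ, L.carrier) := ⟨Λ, rfl⟩
  obtain ⟨t, ht | ht⟩ := hU.push_dichotomy L
  · have := Thin.rank_le ⟨Λ, h1, subset_rfl⟩ (ht t le_rfl)
    rw [Orthant.push_rank] at this
    omega
  · refine ⟨t, fun x hx => ?_⟩
    by_contra hc
    exact Set.disjoint_left.1 (ht t le_rfl) hx (h2 (by simpa using hc))

/-- The source of all finitary statements: a rank-`k` germ on which `g` is not eventually the
identity is a germ of the thin set covering the moved points, and that set has finitely many. -/
theorem Thin.finite_not_tailEq_id {k : ℕ} {g : Equiv.Perm (ZLat N)} (h : Thin k {x | g x ≠ x}) :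
    ∃ F : Set (Set (Orthant N)), F.Finite ∧ ∀ L : Orthant N, L.rank = k → L.germ ∉ F →
      TailEq g L (SignedAffine.translation 0) := by
  obtain ⟨Λ, h1, h2⟩ := h
  have hU : IsOrthohedral (⋃ L ∈ Λ, L.carrier) := ⟨Λ, rfl⟩
  have hthin : Thin k (⋃ L ∈ Λ, L.carrier) := ⟨Λ, h1, subset_rfl⟩
  refine ⟨germs k (⋃ L ∈ Λ, L.carrier), hthin.finite_germs, fun L hL hF => ?_⟩
  obtain ⟨t, ht | ht⟩ := hU.push_dichotomy L
  · exact absurd ⟨L.push t, hL, ht t le_rfl, Orthant.germ_eq_iff.2 (L.parallel_push t)⟩ hF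
  · refine ⟨t, fun x hx => ?_⟩
    by_contra hc
    exact Set.disjoint_left.1 (ht t le_rfl) hx (h2 (by simpa using hc))

end

/-! ### Gluing permutations from pieces; germs of unions; orthant-transpositions. -/

section

variable {N : ℕ}

/-- The common construction behind all explicit permutations. The disjoint pieces and their disjoint
images have the same union, so the identity outside completes the pieces to a bijection. -/
theorem exists_piecewise_perm {ι : Type*} [Finite ι] {A : ι → Set (ZLat N)}
    {f : ι → SignedAffine N} (hA : ∀ i, IsOrthohedral (A i))
    (hd : ∀ i j, i ≠ j → Disjoint (A i) (A j))
    (hd' : ∀ i j, i ≠ j → Disjoint ((f i).app '' A i) ((f j).app '' A j))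
    (hU : ⋃ i, A i = ⋃ i, (f i).app '' A i) :
    ∃ g : Equiv.Perm (ZLat N), PiecewiseIsometric g ∧ (∀ i, ∀ x ∈ A i, g x = (f i).app x) ∧
      ∀ x, (∀ i, x ∉ A i) → g x = x := by
  classical
  let F : ZLat N → ZLat N := fun x => if h : ∃ i, x ∈ A i then (f h.choose).app x else x
  have hF : ∀ i, ∀ x ∈ A i, F x = (f i).app x := by
    intro i x hx
    have h : ∃ i, x ∈ A i := ⟨i, hx⟩
    have : h.choose = i := by
      by_contra hc
      exact Set.disjoint_left.1 (hd _ _ hc) h.choose_spec hx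
    simp only [F, dif_pos h, this]
  have hF' : ∀ x, (∀ i, x ∉ A i) → F x = x := by
    intro x hx
    exact dif_neg (by simpa using hx)
  have himg : ∀ x, (∃ i, x ∈ A i) → ∃ i, F x ∈ A i := by
    rintro x ⟨i, hx⟩
    rw [hF i x hx]
    have : (f i).app x ∈ ⋃ i, A i := by
      rw [hU]
      exact Set.mem_iUnion.2 ⟨i, x, hx, rfl⟩
    simpa using this
  have hinj : Function.Injective F := by
    intro x y hxy
    by_cases hx : ∃ i, x ∈ A i <;> by_cases hy : ∃ i, y ∈ A i
    · obtain ⟨i, hx⟩ := hx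
      obtain ⟨j, hy⟩ := hy
      rw [hF i x hx, hF j y hy] at hxy
      by_cases hij : i = j
      · subst hij
        exact (f i).app_injective hxy
      · exact absurd ⟨y, hy, rfl⟩ (Set.disjoint_left.1 (hd' i j hij) ⟨x, hx, hxy⟩)
    · exact absurd (hF' y (by simpa using hy) ▸ hxy ▸ himg x hx) hy
    · exact absurd (hF' x (by simpa using hx) ▸ hxy.symm ▸ himg y hy) hx
    · rwa [hF' x (by simpa using hx), hF' y (by simpa using hy)] at hxy
  have hsurj : Function.Surjective F := by
    intro y
    by_cases hy : ∃ i, y ∈ A i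
    · have : y ∈ ⋃ i, A i := by simpa using hy
      rw [hU, Set.mem_iUnion] at this
      obtain ⟨i, x, hx, rfl⟩ := this
      exact ⟨x, hF i x hx⟩
    · exact ⟨y, hF' y (by simpa using hy)⟩
  have hcompl : IsOrthohedral (⋃ i, A i)ᶜ := by
    have := (IsOrthohedral.biUnion Set.finite_univ fun i _ => hA i).compl
    simpa using this
  refine ⟨Equiv.ofBijective F ⟨hinj, hsurj⟩, ?_, hF, hF'⟩
  refine PiecewiseIsometric.of_cover (s := (Set.univ : Set (Option ι)))
    (A := fun o => o.elim (⋃ i, A i)ᶜ A)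
    (f := fun o => o.elim (SignedAffine.translation 0) f) Set.finite_univ ?_ ?_ ?_
  · rintro (_ | i) -
    · exact hcompl
    · exact hA i
  · intro x
    by_cases hx : ∃ i, x ∈ A i
    · exact ⟨some hx.choose, trivial, hx.choose_spec⟩
    · exact ⟨none, trivial, by simpa using hx⟩
  · rintro (_ | i) - x hx
    · exact (hF' x (by simpa using hx)).trans (by simp)
    · exact hF i x hx

theorem SignedAffine.map_dir_mul_app (f : SignedAffine N) (L : Orthant N) (x : ZLat N)
    (j : Fin N) : ((f.map L).dir j : ℤ) * (f.app x j - (f.map L).base j) =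
      L.dir (f.perm j) * (x (f.perm j) - L.base (f.perm j)) := by
  rw [f.map_dir_cast]
  simp only [SignedAffine.map, SignedAffine.app]
  linear_combination (L.dir (f.perm j) * (x (f.perm j) - L.base (f.perm j)) : ℤ) *
    Int.units_val_mul_val (f.sgn j)

theorem SignedAffine.lin_unit (f : SignedAffine N) (L : Orthant N) (i : Fin N) :
    f.lin (L.unit i) = (f.map L).unit (f.perm.symm i) := by
  funext j
  simp only [SignedAffine.lin, Orthant.unit, f.map_dir_cast, Equiv.apply_symm_apply,
    Pi.single_apply, Equiv.eq_symm_apply]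
  split_ifs with h
  · subst h; simp
  · simp

theorem SignedAffine.exists_map_eq {L L' : Orthant N} (π : Equiv.Perm (Fin N))
    (h : ∀ j, L'.dir j = 0 ↔ L.dir (π j) = 0) :
    ∃ f : SignedAffine N, f.perm = π ∧ f.map L = L' := by
  let u : Fin N → ℤˣ := fun j => if L'.dir j = L.dir (π j) then 1 else -1
  have hu : ∀ j, (u j : ℤ) * L.dir (π j) = L'.dir j := by
    intro j
    have := h j
    simp only [u]
    rcases SignType.cases_int (L'.dir j) with ⟨k, k'⟩ | ⟨k, k'⟩ | ⟨k, k'⟩ <;>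
    rcases SignType.cases_int (L.dir (π j)) with ⟨l, l'⟩ | ⟨l, l'⟩ | ⟨l, l'⟩ <;>
    simp_all
  let f : SignedAffine N := ⟨π, u, fun j => L'.base j - u j * L.base (π j)⟩
  refine ⟨f, rfl, ?_⟩
  ext j
  · simp [SignedAffine.map, SignedAffine.app, f]
  · apply SignType.intCast_injective
    simp only [f.map_dir_cast]
    exact hu j

/-- Any bijection between the two sets of axes extends to all coordinates; signs and shift are then
adjusted. -/
theorem Orthant.exists_signedAffine_map_eq {L L' : Orthant N} (h : L.rank = L'.rank) :
    ∃ f : SignedAffine N, f.map L = L' := by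
  classical
  have hcard : Fintype.card {i // L'.dir i ≠ 0} = Fintype.card {i // L.dir i ≠ 0} := by
    rw [Fintype.card_subtype, Fintype.card_subtype]
    exact h.symm
  let e := Fintype.equivOfCardEq hcard
  obtain ⟨f, -, hf⟩ := SignedAffine.exists_map_eq (L := L) (L' := L') e.extendSubtype fun j => by
    by_cases hj : L'.dir j = 0
    · simp only [hj, true_iff]
      by_contra hc
      exact e.extendSubtype_not_mem j (by simpa using hj) hc
    · simp only [hj, false_iff]
      exact e.extendSubtype_mem j hj
  exact ⟨f, hf⟩

theorem tailEq_id_of_not_parallel {g : Equiv.Perm (ZLat N)} {U : Set (ZLat N)}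
    (hU : IsOrthohedral U) (hg : ∀ x, x ∉ U → g x = x) {M : Orthant N}
    (hM : M.germ ∉ germs M.rank U) : TailEq g M (SignedAffine.translation 0) := by
  obtain ⟨t, ht | ht⟩ := hU.push_dichotomy M
  · exact absurd ⟨M.push t, rfl, ht t le_rfl, Orthant.germ_eq_iff.2 (M.parallel_push t)⟩ hM
  · refine ⟨t, fun x hx => ?_⟩
    simpa using hg x fun hc => Set.disjoint_left.1 (ht t le_rfl) hx hc

theorem germs_carrier (L : Orthant N) : germs L.rank L.carrier = {L.germ} := by
  ext γ
  constructor
  · rintro ⟨M, hr, hM, rfl⟩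
    exact Orthant.germ_eq_iff.2 (Orthant.parallel_of_subset hM hr).symm
  · rintro rfl
    exact ⟨L, rfl, subset_rfl, rfl⟩

/-- A tail of an orthant in the union lies in `T` or misses `T`, and then lies in `T'`. Together
with `disjoint_germs` this makes heights additive. -/
theorem germs_union {T T' : Set (ZLat N)} (hT : IsOrthohedral T) (k : ℕ) :
    germs k (T ∪ T') = germs k T ∪ germs k T' := by
  ext γ
  constructor
  · rintro ⟨L, hr, hL, rfl⟩
    obtain ⟨t, ht | ht⟩ := hT.push_dichotomy L
    · exact Or.inl ⟨L.push t, hr, ht t le_rfl, Orthant.germ_eq_iff.2 (L.parallel_push t)⟩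
    · refine Or.inr ⟨L.push t, hr, fun x hx => ?_, Orthant.germ_eq_iff.2 (L.parallel_push t)⟩
      exact (hL (L.push_subset t hx)).resolve_left (Set.disjoint_left.1 (ht t le_rfl) hx)
  · rintro (⟨L, hr, hL, rfl⟩ | ⟨L, hr, hL, rfl⟩)
    · exact ⟨L, hr, hL.trans Set.subset_union_left, rfl⟩
    · exact ⟨L, hr, hL.trans Set.subset_union_right, rfl⟩

theorem disjoint_germs {T T' : Set (ZLat N)} (h : Disjoint T T') (k : ℕ) :
    Disjoint (germs k T) (germs k T') := by
  rw [Set.disjoint_left]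
  rintro _ ⟨L, hr, hL, rfl⟩ ⟨L', hr', hL', hγ⟩
  obtain ⟨t, ht⟩ := (Orthant.germ_eq_iff.1 hγ).exists_push_subset
  exact Set.disjoint_left.1 h (hL (L.push_subset t (Orthant.base_mem _)))
    (hL' (ht (Orthant.base_mem _)))

theorem Orthant.exists_disjoint_push {L L' : Orthant N} (hr : L.rank = L'.rank)
    (h : L.germ ≠ L'.germ) : ∃ t, Disjoint (L.push t).carrier (L'.push t).carrier := by
  obtain ⟨t, ht | ht⟩ := L'.isOrthohedral.push_dichotomy L
  · exact absurd (Orthant.germ_eq_iff.2 ((L.parallel_push t).trans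
      (Orthant.parallel_of_subset (ht t le_rfl) hr).symm)) h
  · exact ⟨t, (ht t le_rfl).mono_right (L'.push_subset t)⟩

/-- The transposition of two disjoint orthants. -/
theorem exists_orthantTransposition {L L' : Orthant N} (hr : L.rank = L'.rank)
    (hd : Disjoint L.carrier L'.carrier) : ∃ g : Equiv.Perm (ZLat N), PiecewiseIsometric g ∧
      IsOrthantTransposition g L L' ∧ ∃ f : SignedAffine N, f.map L = L' ∧
        Set.EqOn g f.app L.carrier ∧ Set.EqOn g f.inv.app L'.carrier := by
  obtain ⟨f, hf⟩ := Orthant.exists_signedAffine_map_eq hr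
  have h1 : f.app '' L.carrier = L'.carrier := by rw [f.image_carrier, hf]
  have h2 : f.inv.app '' L'.carrier = L.carrier := by
    rw [← h1, Set.image_image]; simp
  obtain ⟨g, hpw, hg, hg'⟩ := exists_piecewise_perm (ι := Bool)
    (A := fun b => cond b L.carrier L'.carrier) (f := fun b => cond b f f.inv)
    (by rintro (_ | _); exacts [L'.isOrthohedral, L.isOrthohedral])
    (by rintro (_ | _) (_ | _) h <;> first | exact absurd rfl h | exact hd | exact hd.symm)
    (by
      rintro (_ | _) (_ | _) h <;> simp only [cond_true, cond_false, h1, h2] <;>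
        first | exact absurd rfl h | exact hd | exact hd.symm)
    (by
      ext x
      simp only [Set.mem_iUnion, Bool.exists_bool, cond_true, cond_false, h1, h2]
      tauto)
  have hgL : Set.EqOn g f.app L.carrier := fun x hx => hg true x hx
  have hgL' : Set.EqOn g f.inv.app L'.carrier := fun x hx => hg false x hx
  refine ⟨g, hpw, ⟨hd, isometricOn_of_eqOn hgL, ?_, fun x hx => ?_, fun x hx => ?_⟩, f, hf, hgL,
    hgL'⟩
  · rw [hgL.image_eq, h1]
  · rw [hgL hx, hgL' (h1 ▸ Set.mem_image_of_mem _ hx), f.inv_app_app]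
  · refine hg' x ?_
    rintro (_ | _) h
    · exact hx (Or.inr h)
    · exact hx (Or.inl h)

end

/-! ### The group `G_k` and its action on the germs of rank `k`. -/

section

variable {N : ℕ}

/-- The piecewise isometric permutations supported in `S` that move a set of rank at most `k`. -/
def rankSubgroup (k : ℤ) (S : Set (ZLat N)) : Subgroup (Equiv.Perm (ZLat N)) where
  carrier := {g | (∀ x, x ∉ S → g x = x) ∧ PiecewiseIsometric g ∧ Thin k {x | g x ≠ x}}
  one_mem' := ⟨fun _ _ => rfl, .one, by simpa using thin_empty k⟩
  mul_mem' := by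
    rintro g h ⟨h1, h2, h3⟩ ⟨h1', h2', h3'⟩
    refine ⟨fun x hx => by rw [Equiv.Perm.mul_apply, h1' x hx, h1 x hx], h2.mul h2',
      (h3.union h3').mono fun x hx => ?_⟩
    by_contra hc
    simp only [Set.mem_union, Set.mem_ofPred_eq, not_or, not_not] at hc
    exact hx (by rw [Equiv.Perm.mul_apply, hc.2, hc.1])
  inv_mem' := by
    rintro g ⟨h1, h2, h3⟩
    refine ⟨fun x hx => ?_, h2.inv, h3.mono fun x hx hc => hx ?_⟩
    · rw [Equiv.Perm.inv_eq_iff_eq, h1 x hx]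
    · rw [Equiv.Perm.inv_eq_iff_eq, hc]

theorem coe_rankSubgroup {S : Set (ZLat N)} (hS : IsOrthohedral S) (k : ℤ) :
    (rankSubgroup k S : Set (Equiv.Perm (ZLat N))) = rankGroup k S := by
  ext g
  rw [mem_rankGroup_iff hS]
  exact Iff.rfl

theorem Equiv.Perm.apply_mem_of_fixes_compl {α : Type*} {g : Equiv.Perm α} {S : Set α}
    (h : ∀ x, x ∉ S → g x = x) {x : α} (hx : x ∈ S) : g x ∈ S := by
  by_contra hc
  have := g.injective (h _ hc)
  exact hc (this.symm ▸ hx)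

theorem SendsGerm.unique {g : Equiv.Perm (ZLat N)} {k : ℕ} {S : Set (ZLat N)}
    (hg : PiecewiseIsometric g) {γ γ₁ γ₂ : Set (Orthant N)} (hγ : γ ∈ germs k S)
    (hγ₁ : γ₁ ∈ germs k S) (hγ₂ : γ₂ ∈ germs k S) (h₁ : SendsGerm g γ γ₁)
    (h₂ : SendsGerm g γ γ₂) : γ₁ = γ₂ := by
  obtain ⟨L, -, -, rfl⟩ := hγ
  obtain ⟨L₁, -, -, rfl⟩ := hγ₁
  obtain ⟨L₂, -, -, rfl⟩ := hγ₂
  obtain ⟨f, hf⟩ := hg.exists_tailEq L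
  exact Orthant.germ_eq_iff.2 ((hf.sendsGerm_iff.1 h₁).symm.trans (hf.sendsGerm_iff.1 h₂))

theorem exists_sendsGerm {g : Equiv.Perm (ZLat N)} {k : ℕ} {S : Set (ZLat N)}
    (hg : PiecewiseIsometric g) (hgS : ∀ x ∈ S, g x ∈ S) {γ : Set (Orthant N)}
    (hγ : γ ∈ germs k S) : ∃ γ' ∈ germs k S, SendsGerm g γ γ' := by
  obtain ⟨L, hr, hL, rfl⟩ := hγ
  obtain ⟨f, hf⟩ := hg.exists_tailEq L
  refine ⟨(f.map L).germ, ?_, hf.sendsGerm_iff.2 (Orthant.Parallel.refl _)⟩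
  obtain ⟨t, ht⟩ := hf
  refine ⟨f.map (L.push t), by rw [f.map_rank]; exact hr, ?_, ?_⟩
  · rw [← f.image_carrier, ← ht.image_eq]
    rintro _ ⟨x, hx, rfl⟩
    exact hgS x (hL (L.push_subset t hx))
  · exact Orthant.germ_eq_iff.2 (f.map_parallel (L.parallel_push t))

theorem SendsGerm.mul {g h : Equiv.Perm (ZLat N)} {k : ℕ} {S : Set (ZLat N)}
    (hg : PiecewiseIsometric g) (hh : PiecewiseIsometric h) {γ γ₁ γ₂ : Set (Orthant N)}
    (hγ : γ ∈ germs k S) (hγ₁ : γ₁ ∈ germs k S) (hγ₂ : γ₂ ∈ germs k S)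
    (h₁ : SendsGerm h γ γ₁) (h₂ : SendsGerm g γ₁ γ₂) : SendsGerm (g * h) γ γ₂ := by
  obtain ⟨L, -, -, rfl⟩ := hγ
  obtain ⟨L₁, -, -, rfl⟩ := hγ₁
  obtain ⟨L₂, -, -, rfl⟩ := hγ₂
  obtain ⟨f, hf⟩ := hh.exists_tailEq L
  obtain ⟨f', hf'⟩ := hg.exists_tailEq L₁
  have e1 := hf.sendsGerm_iff.1 h₁
  rw [(hf.mul (hf'.of_parallel e1.symm)).sendsGerm_iff, SignedAffine.map_comp]
  exact (f'.map_parallel e1).trans (hf'.sendsGerm_iff.1 h₂)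

theorem SendsGerm.one {k : ℕ} {S : Set (ZLat N)} {γ : Set (Orthant N)} (hγ : γ ∈ germs k S) :
    SendsGerm 1 γ γ := by
  obtain ⟨L, -, -, rfl⟩ := hγ
  exact ⟨L, L.self_mem_germ, L, L.self_mem_germ, fun _ _ _ _ => rfl, by simp⟩

variable {m : ℤ} {S : Set (ZLat N)}

theorem exists_sendsGerm_of_mem (k : ℕ) (g : rankSubgroup m S) (γ : germs k S) :
    ∃ γ' : germs k S, SendsGerm (g : Equiv.Perm (ZLat N)) γ γ' := by
  obtain ⟨γ', h, h'⟩ := exists_sendsGerm g.2.2.1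
    (fun _ => Equiv.Perm.apply_mem_of_fixes_compl g.2.1) γ.2
  exact ⟨⟨γ', h⟩, h'⟩

theorem sendsGerm_choose_iff (k : ℕ) (g : rankSubgroup m S) (γ γ' : germs k S) :
    (exists_sendsGerm_of_mem k g γ).choose = γ' ↔ SendsGerm (g : Equiv.Perm (ZLat N)) γ γ' := by
  constructor
  · rintro rfl
    exact (exists_sendsGerm_of_mem k g γ).choose_spec
  · intro h
    exact Subtype.ext (SendsGerm.unique g.2.2.1 γ.2 (Subtype.coe_prop _) γ'.2
      (exists_sendsGerm_of_mem k g γ).choose_spec h)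

/-- The action on the germs of rank `k`. -/
noncomputable def germAction (m : ℤ) (k : ℕ) (S : Set (ZLat N)) :
    rankSubgroup m S →* Equiv.Perm (germs k S) :=
  -- A monoid homomorphism from a group into self-maps has invertible values, so bijectivity on the
  -- germs needs no separate argument.
  MonoidHom.toHomPerm
    { toFun := fun g γ => (exists_sendsGerm_of_mem k g γ).choose
      map_one' := funext fun γ => (sendsGerm_choose_iff k _ γ γ).2 (SendsGerm.one γ.2)
      map_mul' := fun g h => funext fun γ => (sendsGerm_choose_iff k _ γ _).2
        (SendsGerm.mul g.2.2.1 h.2.2.1 γ.2 (Subtype.coe_prop _) (Subtype.coe_prop _)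
          (exists_sendsGerm_of_mem k h γ).choose_spec
          (exists_sendsGerm_of_mem k g _).choose_spec) }

theorem germAction_eq_iff (k : ℕ) (g : rankSubgroup m S) (γ γ' : germs k S) :
    germAction m k S g γ = γ' ↔ SendsGerm (g : Equiv.Perm (ZLat N)) γ γ' :=
  sendsGerm_choose_iff k g γ γ'

theorem TailEq.sendsGerm_self {g : Equiv.Perm (ZLat N)} {L : Orthant N}
    (h : TailEq g L (SignedAffine.translation 0)) : SendsGerm g L.germ L.germ := by
  rw [h.sendsGerm_iff]
  have : (SignedAffine.translation 0).map L = L := by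
    apply Orthant.carrier_injective
    rw [← SignedAffine.image_carrier]; simp
  rw [this]
  exact Orthant.Parallel.refl _

theorem finite_germs_not_tailEq_id {k : ℕ} (g : rankSubgroup (k : ℤ) S) :
    {γ : germs k S | ¬ ∀ L : Orthant N, L.germ = γ →
      TailEq g.1 L (SignedAffine.translation 0)}.Finite := by
  obtain ⟨F, hF, h⟩ := Thin.finite_not_tailEq_id g.2.2.2
  refine (hF.preimage (f := ((↑) : germs k S → Set (Orthant N)))
    Subtype.val_injective.injOn).subset fun γ hγ => ?_
  by_contra hc
  refine hγ fun L hL => h L ?_ (hL ▸ hc)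
  obtain ⟨L', hr, -, hL'⟩ := γ.2
  rw [← hr]
  exact (Orthant.germ_eq_iff.1 (hL.trans hL')).rank_eq

theorem germAction_mem_finitarySym {k : ℕ} (g : rankSubgroup (k : ℤ) S) :
    germAction k k S g ∈ finitarySym (germs k S) := by
  refine (finite_germs_not_tailEq_id g).subset fun γ hγ hc => hγ ?_
  rw [germAction_eq_iff]
  obtain ⟨γ, L, hr, hL, rfl⟩ := γ
  exact (hc L rfl).sendsGerm_self

theorem IsOrthantTransposition.sendsGerm {g : Equiv.Perm (ZLat N)} {L L' : Orthant N}
    (h : IsOrthantTransposition g L L') : SendsGerm g L.germ L'.germ ∧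
      SendsGerm g L'.germ L.germ := by
  obtain ⟨-, hiso, him, hinv, -⟩ := h
  refine ⟨⟨L, L.self_mem_germ, L', L'.self_mem_germ, hiso, him⟩,
    ⟨L', L'.self_mem_germ, L, L.self_mem_germ, ?_, ?_⟩⟩
  · intro x hx y hy
    rw [← him] at hx hy
    obtain ⟨x, hx, rfl⟩ := hx
    obtain ⟨y, hy, rfl⟩ := hy
    rw [hinv x hx, hinv y hy, hiso x hx y hy]
  · rw [← him, Set.image_image]
    ext x
    constructor
    · rintro ⟨y, hy, rfl⟩
      change g (g y) ∈ L.carrier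
      rwa [hinv y hy]
    · intro hx
      exact ⟨x, hx, hinv x hx⟩

/-- Representatives of different germs are disjoint far out and can be exchanged there; a third germ
of the same rank has a tail that misses both. -/
theorem exists_germ_transposition {k : ℕ} {γ γ' : Set (Orthant N)} (hγ : γ ∈ germs k S)
    (hγ' : γ' ∈ germs k S) (hne : γ ≠ γ') :
    ∃ L ∈ γ, ∃ L' ∈ γ', L.carrier ⊆ S ∧ L'.carrier ⊆ S ∧
      ∃ g ∈ rankSubgroup (k : ℤ) S, IsOrthantTransposition g L L' ∧ SendsGerm g γ γ' ∧
        SendsGerm g γ' γ ∧ ∀ δ ∈ germs k S, δ ≠ γ → δ ≠ γ' → SendsGerm g δ δ := by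
  obtain ⟨L, hr, hL, rfl⟩ := hγ
  obtain ⟨L', hr', hL', rfl⟩ := hγ'
  obtain ⟨t, ht⟩ := Orthant.exists_disjoint_push (hr.trans hr'.symm) hne
  obtain ⟨g, hpw, hg, -⟩ := exists_orthantTransposition
    (L := L.push t) (L' := L'.push t) (hr.trans hr'.symm) ht
  have e : (L.push t).germ = L.germ := Orthant.germ_eq_iff.2 (L.parallel_push t).symm
  have e' : (L'.push t).germ = L'.germ := Orthant.germ_eq_iff.2 (L'.parallel_push t).symm
  have hs := hg.sendsGerm
  rw [e, e'] at hs
  have hLS := (L.push_subset t).trans hL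
  have hLS' := (L'.push_subset t).trans hL'
  refine ⟨L.push t, e ▸ Orthant.self_mem_germ _, L'.push t, e' ▸ Orthant.self_mem_germ _,
    hLS, hLS', g, ⟨fun x hx => ?_, hpw, ?_⟩, hg, hs.1, hs.2, ?_⟩
  · exact hg.2.2.2.2 x fun h => hx (h.elim (@hLS x) (@hLS' x))
  · refine ((thin_carrier (L.push t) (k := k) (by simp [hr])).union
      (thin_carrier (L'.push t) (k := k) (by simp [hr']))).mono fun x hx => ?_
    by_contra hc
    exact hx (hg.2.2.2.2 x hc)
  · rintro _ ⟨M, hMr, -, rfl⟩ h1 h2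
    refine TailEq.sendsGerm_self (tailEq_id_of_not_parallel
      ((L.push t).isOrthohedral.union (L'.push t).isOrthohedral) hg.2.2.2.2 ?_)
    rw [germs_union (L.push t).isOrthohedral]
    have a1 := germs_carrier (L.push t)
    have a2 := germs_carrier (L'.push t)
    rw [Orthant.push_rank, hr, ← hMr, e] at a1
    rw [Orthant.push_rank, hr', ← hMr, e'] at a2
    rw [a1, a2]
    simp [h1, h2]

/-- Transpositions generate the finitary symmetric group, and each is induced by an
orthant-transposition. -/
theorem exists_germAction_eq {k : ℕ} (σ : finitarySym (germs k S)) :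
    ∃ g : rankSubgroup (k : ℤ) S, germAction k k S g = σ := by
  classical
  have h1 : (σ : Equiv.Perm (germs k S)) ∈
      Subgroup.closure {σ : Equiv.Perm (germs k S) | σ.IsSwap} := by
    rw [mem_closure_isSwap']
    exact σ.2
  have h2 : Subgroup.closure {σ : Equiv.Perm (germs k S) | σ.IsSwap} ≤
      (germAction (k : ℤ) k S).range := by
    rw [Subgroup.closure_le]
    rintro _ ⟨γ, γ', hne, rfl⟩
    obtain ⟨L, -, L', -, -, -, g, hg, -, h1, h2, h3⟩ := exists_germ_transposition γ.2 γ'.2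
      (fun h => hne (Subtype.ext h))
    refine ⟨⟨g, hg⟩, ?_⟩
    ext1 δ
    rw [germAction_eq_iff]
    by_cases hδ : δ = γ
    · subst hδ
      rwa [Equiv.swap_apply_left]
    by_cases hδ' : δ = γ'
    · subst hδ'
      rwa [Equiv.swap_apply_right]
    rw [Equiv.swap_apply_of_ne_of_ne hδ hδ']
    exact h3 δ δ.2 (fun h => hδ (Subtype.ext h)) (fun h => hδ' (Subtype.ext h))
  exact h2 h1

/-- The action on the germs of rank `k`, with values in the finitary symmetric group. -/
noncomputable def finitaryGermAction (k : ℕ) (S : Set (ZLat N)) :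
    rankSubgroup (k : ℤ) S →* finitarySym (germs k S) :=
  (germAction k k S).codRestrict _ germAction_mem_finitarySym

theorem finitaryGermAction_surjective (k : ℕ) (S : Set (ZLat N)) :
    Function.Surjective (finitaryGermAction k S) := fun σ => by
  obtain ⟨g, hg⟩ := exists_germAction_eq σ
  exact ⟨g, Subtype.ext hg⟩

/-- The pointwise stabilizer of the germs of rank `k`. -/
noncomputable def germFixerSubgroup (k : ℕ) (S : Set (ZLat N)) : Subgroup (Equiv.Perm (ZLat N)) :=
  (finitaryGermAction k S).ker.map (rankSubgroup (k : ℤ) S).subtype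

theorem mem_germFixerSubgroup {k : ℕ} {g : Equiv.Perm (ZLat N)} : g ∈ germFixerSubgroup k S ↔
    g ∈ rankSubgroup (k : ℤ) S ∧ ∀ γ ∈ germs k S, SendsGerm g γ γ := by
  constructor
  · rintro ⟨g, hg, rfl⟩
    refine ⟨g.2, fun γ hγ => ?_⟩
    have : finitaryGermAction k S g = 1 := hg
    have h2 := congrArg Subtype.val this
    exact (germAction_eq_iff k g ⟨γ, hγ⟩ ⟨γ, hγ⟩).1 (by
      rw [show germAction k k S g = 1 from h2]; rfl)
  · rintro ⟨hg, h⟩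
    refine ⟨⟨g, hg⟩, ?_, rfl⟩
    change finitaryGermAction k S ⟨g, hg⟩ = 1
    refine Subtype.ext (Equiv.ext fun γ => ?_)
    exact (germAction_eq_iff k ⟨g, hg⟩ γ γ).2 (h γ γ.2)

end

/-! ### The action on the directions of the germs. -/

section

variable {N : ℕ}

theorem SignedAffine.lin_injective (f : SignedAffine N) : Function.Injective f.lin := by
  intro x y h
  apply f.app_injective
  funext j
  simp only [SignedAffine.app]
  have := congrFun h j
  simp only [SignedAffine.lin] at this
  rw [this]

/-- The directions of the germ of `L` correspond to the axes along which `L` extends. -/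
noncomputable def germDirectionsEquiv (L : Orthant N) :
    {i // L.dir i ≠ 0} ≃ germDirections L.germ :=
  Equiv.ofBijective (fun i => ⟨L.unit i, mem_germDirections_germ.2 ⟨i, i.2, rfl⟩⟩) <| by
    constructor
    · intro i j h
      have h1 : L.unit i = L.unit j := congrArg Subtype.val h
      by_contra hc
      have h2 := congrFun h1 i
      rw [L.unit_apply_self, L.unit_apply_of_ne (fun h => hc (Subtype.ext h)),
        SignType.intCast_eq_zero] at h2
      exact i.2 h2
    · rintro ⟨y, hy⟩
      obtain ⟨i, hi, rfl⟩ := mem_germDirections_germ.1 hy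
      exact ⟨⟨i, hi⟩, rfl⟩

theorem germDirectionsEquiv_apply (L : Orthant N) (i : {i // L.dir i ≠ 0}) :
    (germDirectionsEquiv L i : ZLat N) = L.unit i := rfl

theorem finite_germDirections {k : ℕ} {S : Set (ZLat N)} {γ : Set (Orthant N)}
    (hγ : γ ∈ germs k S) : Finite (germDirections γ) := by
  obtain ⟨L, -, -, rfl⟩ := hγ
  exact Finite.of_equiv _ (germDirectionsEquiv L)

theorem card_germDirections {k : ℕ} {S : Set (ZLat N)} {γ : Set (Orthant N)}
    (hγ : γ ∈ germs k S) : Nat.card (germDirections γ) = k := by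
  obtain ⟨L, hr, -, rfl⟩ := hγ
  rw [← Nat.card_congr (germDirectionsEquiv L), Nat.card_eq_fintype_card, Fintype.card_subtype,
    ← hr]
  rfl

theorem PermutesDirections.unique {g : Equiv.Perm (ZLat N)} {k : ℕ} {S : Set (ZLat N)}
    (hg : PiecewiseIsometric g) {γ : Set (Orthant N)} (hγ : γ ∈ germs k S)
    {σ τ : Equiv.Perm (germDirections γ)} (hσ : PermutesDirections g γ σ)
    (hτ : PermutesDirections g γ τ) : σ = τ := by
  obtain ⟨L, -, -, rfl⟩ := hγ
  obtain ⟨f, hf⟩ := hg.exists_tailEq L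
  ext1 y
  exact Subtype.ext (((hf.permutesDirections_iff.1 hσ).2 y).symm.trans
    ((hf.permutesDirections_iff.1 hτ).2 y))

/-- The linear part carries the unit vectors of `L` injectively to those of `f.map L`, which is
parallel to `L` and so has the same ones; finiteness gives a permutation. -/
theorem exists_permutesDirections {g : Equiv.Perm (ZLat N)} {k : ℕ} {S : Set (ZLat N)}
    (hg : PiecewiseIsometric g) {γ : Set (Orthant N)} (hγ : γ ∈ germs k S)
    (h : SendsGerm g γ γ) : ∃ σ, PermutesDirections g γ σ := by
  have hfin := finite_germDirections hγ
  obtain ⟨L, -, -, rfl⟩ := hγ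
  obtain ⟨f, hf⟩ := hg.exists_tailEq L
  have hp := hf.sendsGerm_iff.1 h
  have hmem : ∀ y : germDirections L.germ, f.lin y ∈ germDirections L.germ := by
    intro y
    obtain ⟨i, hi, hy⟩ := mem_germDirections_germ.1 y.2
    rw [hy, f.lin_unit]
    refine mem_germDirections_germ.2 ⟨f.perm.symm i, ?_, ?_⟩
    · rw [← hp.1, Ne, f.map_dir_eq_zero]
      simpa using hi
    · simp only [Orthant.unit, hp.1]
  have hinj : Function.Injective (fun y : germDirections L.germ =>
      (⟨f.lin y, hmem y⟩ : germDirections L.germ)) := by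
    intro x y hxy
    exact Subtype.ext (f.lin_injective (congrArg Subtype.val hxy))
  exact ⟨Equiv.ofBijective _ (Finite.injective_iff_bijective.1 hinj),
    hf.permutesDirections_iff.2 ⟨hp, fun y => rfl⟩⟩

theorem PermutesDirections.mul {g h : Equiv.Perm (ZLat N)} {k : ℕ} {S : Set (ZLat N)}
    (hg : PiecewiseIsometric g) (hh : PiecewiseIsometric h) {γ : Set (Orthant N)}
    (hγ : γ ∈ germs k S) {σ τ : Equiv.Perm (germDirections γ)} (hσ : PermutesDirections g γ σ)
    (hτ : PermutesDirections h γ τ) : PermutesDirections (g * h) γ (σ * τ) := by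
  obtain ⟨L, -, -, rfl⟩ := hγ
  obtain ⟨f, hf⟩ := hg.exists_tailEq L
  obtain ⟨f', hf'⟩ := hh.exists_tailEq L
  rw [hf.permutesDirections_iff] at hσ
  rw [hf'.permutesDirections_iff] at hτ
  rw [(hf'.mul (hf.of_parallel hτ.1.symm)).permutesDirections_iff, SignedAffine.map_comp]
  refine ⟨(f.map_parallel hτ.1).trans hσ.1, fun y => ?_⟩
  rw [SignedAffine.comp_lin, hτ.2, hσ.2]; rfl

theorem TailEq.permutesDirections_one {g : Equiv.Perm (ZLat N)} {L : Orthant N} {v : ZLat N}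
    (hv : v ∈ TransGroup L.germ) (h : TailEq g L (SignedAffine.translation v)) :
    PermutesDirections g L.germ 1 := by
  rw [h.permutesDirections_iff]
  rw [mem_transGroup_germ] at hv
  refine ⟨⟨?_, fun i hi => ?_⟩, fun y => ?_⟩
  · funext j
    apply SignType.intCast_injective
    simp only [SignedAffine.map_dir_cast]
    simp [SignedAffine.translation]
  · rw [SignedAffine.map_dir_eq_zero] at hi
    simp [SignedAffine.map, hv i hi]
  · funext j
    simp [SignedAffine.lin, SignedAffine.translation]

variable {k : ℕ} {S : Set (ZLat N)}

theorem exists_permutesDirections_of_mem (g : germFixerSubgroup k S) (γ : germs k S) :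
    ∃ σ, PermutesDirections (g : Equiv.Perm (ZLat N)) γ σ :=
  have hg := mem_germFixerSubgroup.1 g.2
  exists_permutesDirections hg.1.2.1 γ.2 (hg.2 γ γ.2)

theorem permutesDirections_choose_iff (g : germFixerSubgroup k S) (γ : germs k S)
    (σ : Equiv.Perm (germDirections (γ : Set (Orthant N)))) :
    (exists_permutesDirections_of_mem g γ).choose = σ ↔
      PermutesDirections (g : Equiv.Perm (ZLat N)) γ σ := by
  constructor
  · rintro rfl
    exact (exists_permutesDirections_of_mem g γ).choose_spec
  · intro h
    exact PermutesDirections.unique (mem_germFixerSubgroup.1 g.2).1.2.1 γ.2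
      (exists_permutesDirections_of_mem g γ).choose_spec h

theorem PermutesDirections.one {γ : Set (Orthant N)} (hγ : γ ∈ germs k S) :
    PermutesDirections 1 γ 1 := by
  obtain ⟨L, -, -, rfl⟩ := hγ
  exact (TailEq.one L).permutesDirections_one (zero_mem _)

/-- The action on the directions of the germs of rank `k`. -/
noncomputable def directionAction (k : ℕ) (S : Set (ZLat N)) : germFixerSubgroup k S →*
    finitaryProd (fun γ : germs k S => Equiv.Perm (germDirections (γ : Set (Orthant N)))) where
  toFun g := ⟨fun γ => (exists_permutesDirections_of_mem g γ).choose, by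
    have hg := (mem_germFixerSubgroup.1 g.2).1
    refine (finite_germs_not_tailEq_id ⟨g.1, hg⟩).subset fun γ hγ hc => hγ ?_
    rw [permutesDirections_choose_iff]
    obtain ⟨γ, L, hr, hL, rfl⟩ := γ
    exact (hc L rfl).permutesDirections_one (zero_mem _)⟩
  map_one' := Subtype.ext (funext fun γ =>
    (permutesDirections_choose_iff _ γ _).2 (PermutesDirections.one γ.2))
  map_mul' g h := Subtype.ext (funext fun γ => (permutesDirections_choose_iff _ γ _).2
    (PermutesDirections.mul (mem_germFixerSubgroup.1 g.2).1.2.1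
      (mem_germFixerSubgroup.1 h.2).1.2.1 γ.2
      (exists_permutesDirections_of_mem g γ).choose_spec
      (exists_permutesDirections_of_mem h γ).choose_spec))

theorem directionAction_eq_iff (g : germFixerSubgroup k S) (γ : germs k S)
    (σ : Equiv.Perm (germDirections (γ : Set (Orthant N)))) :
    (directionAction k S g).1 γ = σ ↔ PermutesDirections (g : Equiv.Perm (ZLat N)) γ σ :=
  permutesDirections_choose_iff g γ σ

theorem exists_signedAffine_permuting (L : Orthant N) (σ : Equiv.Perm (germDirections L.germ)) :
    ∃ f : SignedAffine N, f.map L = L ∧ ∀ y : germDirections L.germ, f.lin y = σ y := by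
  classical
  let e := germDirectionsEquiv L
  let ρ : Equiv.Perm {i // L.dir i ≠ 0} := (e.trans σ).trans e.symm
  -- The inverse appears because `lin` sends the unit vector of axis `i` to axis `f.perm.symm i`.
  obtain ⟨f, hf, hf'⟩ := SignedAffine.exists_map_eq (L := L) (L' := L)
    (Equiv.Perm.ofSubtype ρ).symm fun j => by
      rw [not_iff_not.symm]
      have := Equiv.Perm.ofSubtype_apply_mem_iff_mem ρ⁻¹ j
      rw [map_inv] at this
      exact this.symm
  refine ⟨f, hf', fun y => ?_⟩
  obtain ⟨i, rfl⟩ := e.surjective y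
  rw [germDirectionsEquiv_apply, f.lin_unit, hf', hf, Equiv.symm_symm,
    Equiv.Perm.ofSubtype_apply_coe]
  have : e (ρ i) = σ (e i) := by simp [ρ]
  rw [← this]
  rfl

/-- An isometry of one representative `L` that permutes its axes, extended by the identity, is the
identity far out on every other rank-`k` germ. -/
theorem exists_directionAction_eq_mulSingle [DecidableEq (germs k S)] (γ : germs k S)
    (σ : Equiv.Perm (germDirections (γ : Set (Orthant N)))) :
    ∃ g : germFixerSubgroup k S, (directionAction k S g).1 = Pi.mulSingle γ σ := by
  obtain ⟨_, L, hr, hL, rfl⟩ := γ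
  obtain ⟨f, hf, hfσ⟩ := exists_signedAffine_permuting L σ
  obtain ⟨g, hpw, hg, hg'⟩ := exists_piecewise_perm (ι := Unit)
    (A := fun _ => L.carrier) (f := fun _ => f) (fun _ => L.isOrthohedral)
    (fun i j h => absurd rfl h) (fun i j h => absurd rfl h) (by rw [f.image_carrier, hf])
  have hg'' : ∀ x, x ∉ L.carrier → g x = x := fun x hx => hg' x fun _ => hx
  have htail : TailEq g L f := TailEq.of_eqOn fun x hx => hg () x hx
  have hother : ∀ M : Orthant N, M.rank = k → M.germ ≠ L.germ →
      TailEq g M (SignedAffine.translation 0) := by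
    intro M hM hne
    refine tailEq_id_of_not_parallel L.isOrthohedral hg'' ?_
    rw [hM, ← hr, germs_carrier]
    exact hne
  have hmem : g ∈ germFixerSubgroup k S := by
    refine mem_germFixerSubgroup.2 ⟨⟨fun x hx => hg'' x fun h => hx (hL h), hpw, ?_⟩, ?_⟩
    · refine (thin_carrier L (by rw [hr])).mono fun x hx => ?_
      by_contra hc
      exact hx (hg'' x hc)
    · rintro _ ⟨M, hM, -, rfl⟩
      by_cases hML : M.germ = L.germ
      · rw [hML, htail.sendsGerm_iff, hf]
        exact Orthant.Parallel.refl L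
      · exact (hother M hM hML).sendsGerm_self
  refine ⟨⟨g, hmem⟩, funext fun δ => ?_⟩
  rw [directionAction_eq_iff]
  by_cases hδ : δ = ⟨L.germ, L, hr, hL, rfl⟩
  · subst hδ
    rw [Pi.mulSingle_eq_same, htail.permutesDirections_iff, hf]
    exact ⟨Orthant.Parallel.refl L, hfσ⟩
  · rw [Pi.mulSingle_eq_of_ne hδ]
    obtain ⟨_, M, hM, hMS, rfl⟩ := δ
    exact (hother M hM fun h => hδ (Subtype.ext h)).permutesDirections_one (zero_mem _)

theorem directionAction_surjective (k : ℕ) (S : Set (ZLat N)) :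
    Function.Surjective (directionAction k S) := by
  classical
  rintro ⟨z, hz⟩
  have key : ∀ s : Finset (germs k S), ∃ g : germFixerSubgroup k S,
      (directionAction k S g).1 = fun γ => if γ ∈ s then z γ else 1 := by
    intro s
    induction s using Finset.induction_on with
    | empty => exact ⟨1, by rw [map_one]; rfl⟩
    | insert a s ha ih =>
      obtain ⟨g, hg⟩ := ih
      obtain ⟨h, hh⟩ := exists_directionAction_eq_mulSingle a (z a)
      refine ⟨g * h, ?_⟩
      rw [map_mul, Subgroup.coe_mul, hg, hh]
      funext γ
      rw [Pi.mul_apply]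
      by_cases hγ : γ = a
      · subst hγ; simp [ha]
      · simp [hγ]
  obtain ⟨g, hg⟩ := key hz.toFinset
  refine ⟨g, Subtype.ext (hg.trans (funext fun γ => ?_))⟩
  change (if γ ∈ hz.toFinset then z γ else 1) = z γ
  split_ifs with h
  · rfl
  · by_contra hc
    exact h (hz.mem_toFinset.2 fun h => hc h.symm)

/-- The elements that fix the germs of rank `k` and all their directions. -/
noncomputable def germFixerOrdSubgroup (k : ℕ) (S : Set (ZLat N)) :
    Subgroup (Equiv.Perm (ZLat N)) :=
  (directionAction k S).ker.map (germFixerSubgroup k S).subtype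

theorem PermutesDirections.sendsGerm {g : Equiv.Perm (ZLat N)} {γ : Set (Orthant N)}
    {σ : Equiv.Perm (germDirections γ)} (h : PermutesDirections g γ σ) : SendsGerm g γ γ := by
  obtain ⟨L, hL, L', hL', hiso, him, -⟩ := h
  exact ⟨L, hL, L', hL', hiso, him⟩

theorem mem_germFixerOrdSubgroup {g : Equiv.Perm (ZLat N)} : g ∈ germFixerOrdSubgroup k S ↔
    g ∈ rankSubgroup (k : ℤ) S ∧ ∀ γ ∈ germs k S, PermutesDirections g γ 1 := by
  constructor
  · rintro ⟨g, hg, rfl⟩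
    refine ⟨(mem_germFixerSubgroup.1 g.2).1, fun γ hγ => ?_⟩
    have : directionAction k S g = 1 := hg
    exact (directionAction_eq_iff g ⟨γ, hγ⟩ 1).1 (by rw [this]; rfl)
  · rintro ⟨hg, h⟩
    refine ⟨⟨g, mem_germFixerSubgroup.2 ⟨hg, fun γ hγ => (h γ hγ).sendsGerm⟩⟩, ?_, rfl⟩
    change directionAction k S _ = 1
    exact Subtype.ext (funext fun γ => (directionAction_eq_iff _ γ 1).2 (h γ γ.2))

end

/-! ### The translations of the tangent cosets and the kernel of `φ`. -/

section

variable {N : ℕ}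

/-- The linear part fixes the unit vectors of `L`, so on `L` the tail map is the translation by the
displacement of the base point. Fixing the germ kills its components orthogonal to `L`. -/
theorem PermutesDirections.exists_translation {g : Equiv.Perm (ZLat N)} {L : Orthant N}
    (hg : PiecewiseIsometric g) (h : PermutesDirections g L.germ 1) :
    ∃ v ∈ TransGroup L.germ, TailEq g L (SignedAffine.translation v) := by
  obtain ⟨f, hf⟩ := hg.exists_tailEq L
  obtain ⟨hp, hlin⟩ := hf.permutesDirections_iff.1 h
  have heq : Set.EqOn f.app (SignedAffine.translation (f.app L.base - L.base)).app L.carrier := by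
    refine SignedAffine.eqOn_of_add_unit L.base_mem (by simp) fun i hi => ?_
    have := hlin ⟨L.unit i, mem_germDirections_germ.2 ⟨i, hi, rfl⟩⟩
    simp only [Equiv.Perm.coe_one, id_eq] at this
    rw [f.app_add, this, SignedAffine.translation_app]
    abel
  refine ⟨f.app L.base - L.base, ?_, ?_⟩
  · rw [mem_transGroup_germ]
    intro i hi
    have := hp.2 i (by rw [hp.1, hi])
    simp only [SignedAffine.map] at this
    simp [this]
  · obtain ⟨t, ht⟩ := hf
    exact ⟨t, fun x hx => (ht hx).trans (heq (L.push_subset t hx))⟩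

theorem TranslatesGerm.unique {g : Equiv.Perm (ZLat N)} {k : ℕ} {S : Set (ZLat N)}
    {γ : Set (Orthant N)} (hγ : γ ∈ germs k S) {v w : ZLat N} (hv : TranslatesGerm g γ v)
    (hw : TranslatesGerm g γ w) : v = w := by
  obtain ⟨L, -, -, rfl⟩ := hγ
  rw [translatesGerm_iff] at hv hw
  have := hv.eqOn hw L.base_mem
  simpa using this

theorem TranslatesGerm.mul {g h : Equiv.Perm (ZLat N)} {k : ℕ} {S : Set (ZLat N)}
    {γ : Set (Orthant N)} (hγ : γ ∈ germs k S) {v w : ZLat N} (hw' : w ∈ TransGroup γ)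
    (hv : TranslatesGerm g γ v) (hw : TranslatesGerm h γ w) :
    TranslatesGerm (g * h) γ (v + w) := by
  obtain ⟨L, -, -, rfl⟩ := hγ
  rw [translatesGerm_iff] at hv hw ⊢
  have hp : ((SignedAffine.translation w).map L).Parallel L :=
    (hw.permutesDirections_iff.1 (hw.permutesDirections_one hw')).1
  obtain ⟨t, ht⟩ := hw.mul (hv.of_parallel hp.symm)
  refine ⟨t, fun x hx => ?_⟩
  rw [ht hx]
  simp [add_assoc]

theorem TailEq.translatesGerm_zero {g : Equiv.Perm (ZLat N)} {L : Orthant N}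
    (h : TailEq g L (SignedAffine.translation 0)) : TranslatesGerm g L.germ 0 :=
  translatesGerm_iff.2 h

variable {k : ℕ} {S : Set (ZLat N)}

theorem exists_translatesGerm (g : germFixerOrdSubgroup k S) (γ : germs k S) :
    ∃ v : TransGroup (γ : Set (Orthant N)), TranslatesGerm (g : Equiv.Perm (ZLat N)) γ v := by
  have hg := mem_germFixerOrdSubgroup.1 g.2
  obtain ⟨_, L, hr, hL, rfl⟩ := γ
  obtain ⟨v, hv, hv'⟩ := (hg.2 _ ⟨L, hr, hL, rfl⟩).exists_translation hg.1.2.1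
  exact ⟨⟨v, hv⟩, translatesGerm_iff.2 hv'⟩

/-- The translation by which `g` acts on the tangent coset of `γ`. -/
noncomputable def germTranslation (g : germFixerOrdSubgroup k S) (γ : germs k S) :
    TransGroup (γ : Set (Orthant N)) := (exists_translatesGerm g γ).choose

theorem germTranslation_eq_iff (g : germFixerOrdSubgroup k S) (γ : germs k S)
    (v : TransGroup (γ : Set (Orthant N))) :
    germTranslation g γ = v ↔ TranslatesGerm (g : Equiv.Perm (ZLat N)) γ v := by
  constructor
  · rintro rfl
    exact (exists_translatesGerm g γ).choose_spec
  · intro h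
    exact Subtype.ext (TranslatesGerm.unique γ.2 (exists_translatesGerm g γ).choose_spec h)

theorem finite_germTranslation_ne_zero (g : germFixerOrdSubgroup k S) :
    {γ : germs k S | germTranslation g γ ≠ 0}.Finite := by
  have hg := mem_germFixerOrdSubgroup.1 g.2
  refine (finite_germs_not_tailEq_id ⟨g.1, hg.1⟩).subset fun γ hγ hc => hγ ?_
  rw [germTranslation_eq_iff]
  obtain ⟨_, L, hr, hL, rfl⟩ := γ
  exact (hc L rfl).translatesGerm_zero

open Classical in
/-- The family of all translations induced on tangent cosets. -/
noncomputable def translationVector (g : germFixerOrdSubgroup k S) :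
    DirectSum (germs k S) fun γ => TransGroup (γ : Set (Orthant N)) :=
  DirectSum.mk _ (finite_germTranslation_ne_zero g).toFinset fun γ => germTranslation g γ

theorem translationVector_apply (g : germFixerOrdSubgroup k S) (γ : germs k S) :
    translationVector g γ = germTranslation g γ := by
  classical
  by_cases h : γ ∈ (finite_germTranslation_ne_zero g).toFinset
  · exact DirectSum.mk_apply_of_mem h
  · rw [translationVector, DirectSum.mk_apply_of_notMem h]
    by_contra hc
    exact h ((finite_germTranslation_ne_zero g).mem_toFinset.2 fun h => hc h.symm)

/-- The homomorphism given by the translations of the tangent cosets. -/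
noncomputable def translationHom (k : ℕ) (S : Set (ZLat N)) : germFixerOrdSubgroup k S →*
    Multiplicative (DirectSum (germs k S) fun γ => TransGroup (γ : Set (Orthant N))) where
  toFun g := Multiplicative.ofAdd (translationVector g)
  map_one' := by
    rw [← ofAdd_zero]
    congr 1
    refine DFinsupp.ext fun γ => ?_
    rw [translationVector_apply, germTranslation_eq_iff]
    obtain ⟨_, L, -, -, rfl⟩ := γ
    exact (TailEq.one L).translatesGerm_zero
  map_mul' g h := by
    rw [← ofAdd_add]
    congr 1
    refine DFinsupp.ext fun γ => ?_
    rw [DirectSum.add_apply, translationVector_apply, translationVector_apply,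
      translationVector_apply, germTranslation_eq_iff]
    exact TranslatesGerm.mul γ.2 (germTranslation h γ).2
      ((germTranslation_eq_iff g γ _).1 rfl) ((germTranslation_eq_iff h γ _).1 rfl)

theorem translationHom_eq_iff (g : germFixerOrdSubgroup k S) (γ : germs k S)
    (v : TransGroup (γ : Set (Orthant N))) :
    (translationHom k S g).toAdd γ = v ↔ TranslatesGerm (g : Equiv.Perm (ZLat N)) γ v := by
  rw [← germTranslation_eq_iff, ← translationVector_apply]
  rfl

/-- On a piece of rank above `m` of a partition of `S` into orthants on which `g` is isometric, the
identity far out is by rigidity the identity throughout. So all moved points lie in pieces of rank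
at most `m`. -/
theorem thin_of_tailEq_id {g : Equiv.Perm (ZLat N)} (hS : IsOrthohedral S)
    (hgS : ∀ x, x ∉ S → g x = x) (hg : PiecewiseIsometric g) {m : ℤ}
    (h : ∀ L : Orthant N, L.carrier ⊆ S → m < L.rank →
      TailEq g L (SignedAffine.translation 0)) : Thin m {x | g x ≠ x} := by
  classical
  obtain ⟨hfix, Λ, hΛ, -, hiso⟩ := (mem_pei_iff hS).2 ⟨hgS, hg⟩
  refine ⟨Λ.filter fun L => ∃ x ∈ L.carrier, g x ≠ x, fun L hL => ?_, fun x hx => ?_⟩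
  · rw [Finset.mem_filter] at hL
    by_contra hc
    obtain ⟨x, hx, hne⟩ := hL.2
    obtain ⟨f, hf⟩ := (hiso L hL.1).exists_signedAffine
    have hLS : L.carrier ⊆ S := by
      rw [hΛ]
      exact Set.subset_biUnion_of_mem (u := Orthant.carrier) hL.1
    apply hne
    rw [hf hx, (TailEq.of_eqOn hf).eqOn (h L hLS (by omega)) hx]
    simp
  · have hxS : x ∈ S := by
      by_contra hc
      exact hx (hfix x hc)
    rw [hΛ] at hxS
    simp only [Set.mem_iUnion] at hxS ⊢
    obtain ⟨L, hL, hxL⟩ := hxS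
    exact ⟨L, Finset.mem_filter.2 ⟨hL, x, hxL, hx⟩, hxL⟩

theorem rankSubgroup_le_germFixerOrdSubgroup (k : ℕ) (S : Set (ZLat N)) :
    rankSubgroup ((k : ℤ) - 1) S ≤ germFixerOrdSubgroup k S := by
  rintro g ⟨h1, h2, h3⟩
  refine mem_germFixerOrdSubgroup.2 ⟨⟨h1, h2, h3.mono_rank (by omega)⟩, ?_⟩
  rintro _ ⟨L, hr, -, rfl⟩
  exact (h3.tailEq_id (L := L) (by omega)).permutesDirections_one (zero_mem _)

/-- Zero translation on a rank-`k` germ means identity far out, which holds anyway in ranks above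
`k`; `thin_of_tailEq_id` then lowers the rank by one. This gives the injectivity of `φ`. -/
theorem translationHom_eq_one_iff (hS : IsOrthohedral S) (g : germFixerOrdSubgroup k S) :
    translationHom k S g = 1 ↔ (g : Equiv.Perm (ZLat N)) ∈ rankSubgroup ((k : ℤ) - 1) S := by
  have hg := (mem_germFixerOrdSubgroup.1 g.2).1
  constructor
  · intro h
    refine ⟨hg.1, hg.2.1, thin_of_tailEq_id hS hg.1 hg.2.1 fun L hL hr => ?_⟩
    rcases (show (L.rank : ℤ) = k ∨ (k : ℤ) < L.rank by omega) with h' | h'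
    · rw [← translatesGerm_iff]
      refine (translationHom_eq_iff g ⟨L.germ, L, by exact_mod_cast h', hL, rfl⟩ 0).1 ?_
      rw [h]; rfl
    · exact hg.2.2.tailEq_id h'
  · rintro ⟨-, -, h3⟩
    apply Multiplicative.toAdd.injective
    refine DFinsupp.ext fun γ => ?_
    refine (translationHom_eq_iff g γ 0).2 ?_
    obtain ⟨_, L, hr, -, rfl⟩ := γ
    exact (h3.tailEq_id (L := L) (by omega)).translatesGerm_zero

end

/-! ### The germ flow of a translation in coordinates. -/

section

variable {N : ℕ}

/-- The slice of `L` orthogonal to the `i`-th axis at distance `c` from the face. -/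
def Orthant.slice (L : Orthant N) (i : Fin N) (c : ℕ) : Orthant N :=
  ⟨L.base + c • L.unit i, Function.update L.dir i 0⟩

theorem Orthant.slice_base_self (L : Orthant N) (i : Fin N) (c : ℕ) :
    (L.slice i c).base i = L.base i + c * (L.dir i : ℤ) := by
  rw [← nsmul_eq_mul, ← L.unit_apply_self]
  rfl

theorem Orthant.slice_rank_add_one {L : Orthant N} {i : Fin N} (hi : L.dir i ≠ 0) (c : ℕ) :
    (L.slice i c).rank + 1 = L.rank := by
  unfold Orthant.rank
  have : (Finset.univ.filter fun j => L.dir j ≠ 0) =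
      insert i (Finset.univ.filter fun j => (L.slice i c).dir j ≠ 0) := by
    ext j
    by_cases hj : j = i
    · subst hj; simp [hi]
    · simp [Orthant.slice, hj]
  rw [this, Finset.card_insert_of_notMem (by simp [Orthant.slice])]

theorem Orthant.mem_slice_iff {L : Orthant N} {i : Fin N} (hi : L.dir i ≠ 0) {c : ℕ} {x : ZLat N} :
    x ∈ (L.slice i c).carrier ↔ x ∈ L.carrier ∧ (L.dir i : ℤ) * (x i - L.base i) = c := by
  rw [Orthant.mem_carrier_iff, Orthant.mem_carrier_iff]
  constructor
  · intro h
    have h1 := (h i).1 (by simp [Orthant.slice])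
    have h2 : (L.dir i : ℤ) * (x i - L.base i) = c := by
      have := SignType.intCast_mul_self hi
      rw [h1, L.slice_base_self]
      linear_combination (c : ℤ) * this
    refine ⟨fun j => ?_, h2⟩
    by_cases hj : j = i
    · subst hj
      exact ⟨fun h => absurd h hi, by omega⟩
    · have := h j
      simpa [Orthant.slice, hj, L.unit_apply_of_ne hj] using this
  · rintro ⟨h, h2⟩ j
    by_cases hj : j = i
    · subst hj
      have := SignType.intCast_mul_self hi
      refine ⟨fun _ => ?_, by simp [Orthant.slice]⟩
      rw [L.slice_base_self]
      linear_combination (L.dir j : ℤ) * h2 - (x j - L.base j) * this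
    · have := h j
      simpa [Orthant.slice, hj, L.unit_apply_of_ne hj] using this

theorem Orthant.mem_translate_iff {L : Orthant N} {v : ZLat N} {x : ZLat N} :
    x ∈ (fun x => v + x) '' L.carrier ↔ x - v ∈ L.carrier := by
  constructor
  · rintro ⟨y, hy, rfl⟩
    simpa using hy
  · intro h
    exact ⟨_, h, by simp⟩

/-- An orthant of rank one less inside `L` lacks exactly one axis `i` of `L`, so it is parallel to a
slice at some distance `c` from the face. That slice avoids the translate exactly when `c` is below
the signed component of `v` along `i`; negative components contribute nothing, hence `toNat`. -/
theorem germs_diff_translate {k : ℕ} {L : Orthant N} (hL : L.rank = k + 1) {v : ZLat N}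
    (hv : v ∈ TransGroup L.germ) :
    germs k (L.carrier \ ((fun x => v + x) '' L.carrier)) =
      (fun p : (_ : Fin N) × ℕ => (L.slice p.1 p.2).germ) ''
        ((Finset.univ : Finset (Fin N)).sigma fun i => Finset.range (L.dir i * v i : ℤ).toNat :
          Finset ((_ : Fin N) × ℕ)) := by
  rw [mem_transGroup_germ] at hv
  ext γ
  constructor
  · rintro ⟨M, hr, hM, rfl⟩
    have hML : M.carrier ⊆ L.carrier := fun x hx => (hM hx).1
    have hb := Orthant.mem_carrier_iff.1 (hML M.base_mem)
    obtain ⟨i, hi, hMi, huniq⟩ : ∃ i, L.dir i ≠ 0 ∧ M.dir i = 0 ∧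
        ∀ j, j ≠ i → M.dir j = L.dir j := by
      have hsub : (Finset.univ.filter fun j => M.dir j ≠ 0) ⊆
          Finset.univ.filter fun j => L.dir j ≠ 0 := by
        intro j
        simp only [Finset.mem_filter, Finset.mem_univ, true_and]
        intro hj
        rwa [Orthant.dir_of_subset hML j hj]
      have hcard : ((Finset.univ.filter fun j => L.dir j ≠ 0) \
          (Finset.univ.filter fun j => M.dir j ≠ 0)).card = 1 := by
        rw [Finset.card_sdiff_of_subset hsub]
        unfold Orthant.rank at hr hL
        omega
      obtain ⟨i, hi⟩ := Finset.card_eq_one.1 hcard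
      have hmem : ∀ j, (L.dir j ≠ 0 ∧ M.dir j = 0) ↔ j = i := by
        intro j
        have := Finset.ext_iff.1 hi j
        simpa using this
      refine ⟨i, ((hmem i).2 rfl).1, ((hmem i).2 rfl).2, fun j hj => ?_⟩
      by_cases hMj : M.dir j = 0
      · by_contra hc
        exact hj ((hmem j).1 ⟨fun h => hc (hMj.trans h.symm), hMj⟩)
      · exact (Orthant.dir_of_subset hML j hMj).symm
    let c : ℤ := L.dir i * (M.base i - L.base i)
    have hc0 : 0 ≤ c := (hb i).2
    have hcv : c < L.dir i * v i := by
      by_contra hcv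
      -- Pushed by `t`, the base point of `M` satisfies the conditions of the translate in all
      -- coordinates other than `i`; in coordinate `i` the assumption on `c` suffices.
      let t : ℕ := ∑ j, (M.base j - v j - L.base j).natAbs
      refine (hM (M.push_subset t (Orthant.base_mem _))).2
        (Orthant.mem_translate_iff.2 (Orthant.mem_carrier_iff.2 fun j => ?_))
      have h1 : (M.base j - v j - L.base j).natAbs ≤ t :=
        Finset.single_le_sum (f := fun j => (M.base j - v j - L.base j).natAbs)
          (fun _ _ => Nat.zero_le _) (Finset.mem_univ j)
      rw [Pi.sub_apply, Orthant.push_base]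
      by_cases hj : j = i
      · subst hj
        refine ⟨fun h => absurd h hi, ?_⟩
        rw [hMi]
        have : (L.dir j : ℤ) * (M.base j + t * ((0 : SignType) : ℤ) - v j - L.base j) =
          c - L.dir j * v j := by simp only [c, SignType.coe_zero]; ring
        rw [this]
        omega
      · rw [huniq j hj]
        refine ⟨fun h => ?_, ?_⟩
        · simp [h, (hb j).1 h, hv j h]
        · rcases SignType.cases_int (L.dir j) with ⟨h, h'⟩ | ⟨h, h'⟩ | ⟨h, h'⟩ <;> rw [h'] <;> omega
    refine ⟨⟨i, c.toNat⟩, ?_, ?_⟩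
    · simp only [Finset.coe_sigma, Set.mem_sigma_iff, Finset.coe_univ, Set.mem_univ,
        Finset.coe_range, Set.mem_Iio, true_and]
      omega
    · simp only
      rw [Orthant.germ_eq_iff]
      refine ⟨funext fun j => ?_, fun j hj => ?_⟩
      · by_cases hj : j = i
        · subst hj; simp [Orthant.slice, hMi]
        · simp [Orthant.slice, hj, huniq j hj]
      · by_cases hji : j = i
        · subst hji
          have := SignType.intCast_mul_self hi
          rw [L.slice_base_self, Int.natCast_toNat_eq_self.2 hc0]
          simp only [c]
          linear_combination (M.base j - L.base j) * this
        · have hj' : L.dir j = 0 := by simpa [Orthant.slice, hji] using hj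
          simp [Orthant.slice, L.unit_apply_of_ne hji, (hb j).1 hj']
  · rintro ⟨⟨i, c⟩, hp, rfl⟩
    simp only [Finset.coe_sigma, Set.mem_sigma_iff, Finset.coe_univ, Set.mem_univ,
        Finset.coe_range, Set.mem_Iio, true_and] at hp
    have hi : L.dir i ≠ 0 := by
      intro h
      simp [h] at hp
    have := Orthant.slice_rank_add_one hi c
    refine ⟨L.slice i c, by omega, fun x hx => ?_, rfl⟩
    rw [Orthant.mem_slice_iff hi] at hx
    refine ⟨hx.1, fun hc => ?_⟩
    have h2 := (Orthant.mem_carrier_iff.1 (Orthant.mem_translate_iff.1 hc) i).2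
    rw [Pi.sub_apply] at h2
    have h3 : (L.dir i : ℤ) * (x i - v i - L.base i) =
      L.dir i * (x i - L.base i) - L.dir i * v i := by ring
    rw [h3, hx.2] at h2
    omega

theorem height_diff_translate {k : ℕ} {L : Orthant N} (hL : L.rank = k + 1) {v : ZLat N}
    (hv : v ∈ TransGroup L.germ) :
    height k (L.carrier \ ((fun x => v + x) '' L.carrier)) = ∑ i, (L.dir i * v i : ℤ).toNat := by
  rw [height, germs_diff_translate hL hv, Set.InjOn.ncard_image, Set.ncard_coe_finset,
    Finset.card_sigma]
  · simp
  · rintro ⟨i, c⟩ hp ⟨j, d⟩ hq h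
    simp only [Finset.coe_sigma, Set.mem_sigma_iff, Finset.coe_univ, Set.mem_univ,
        Finset.coe_range, Set.mem_Iio, true_and] at hp hq
    have hi : L.dir i ≠ 0 := by
      intro h
      simp [h] at hp
    obtain ⟨h1, h2⟩ := Orthant.germ_eq_iff.1 h
    have hij : i = j := by
      by_contra hc
      have := congrFun h1 i
      simp [Orthant.slice, hc] at this
      exact hi this.symm
    subst hij
    have := h2 i (by simp [Orthant.slice])
    simp [Orthant.slice, L.unit_apply_self, SignType.intCast_eq_zero, hi] at this
    simp [this]

/-- The second difference is the first one for the translate of `L` and the vector `-v`, and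
`z.toNat - (-z).toNat = z` in `ℤ`. So the flow is additive in `v` and depends on `L` only through
its directions. -/
theorem flowAt_eq {k : ℕ} (hk : 1 ≤ k) {L : Orthant N} (hL : L.rank = k) {v : ZLat N}
    (hv : v ∈ TransGroup L.germ) : flowAt k L v = ∑ i, (L.dir i * v i : ℤ) := by
  obtain ⟨k, rfl⟩ : ∃ l, k = l + 1 := ⟨k - 1, by omega⟩
  let L' := (SignedAffine.translation v).map L
  have hd : L'.dir = L.dir := by
    funext j
    apply SignType.intCast_injective
    simp only [L', SignedAffine.map_dir_cast]
    simp [SignedAffine.translation]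
  have hL' : L'.carrier = (fun x => v + x) '' L.carrier := by
    rw [← SignedAffine.image_carrier]
    exact Set.image_congr fun x _ => by simp
  have hv' : -v ∈ TransGroup L'.germ := by
    rw [mem_transGroup_germ] at hv ⊢
    intro i hi
    rw [hd] at hi
    simp [hv i hi]
  have e : L.carrier = (fun x => -v + x) '' L'.carrier := by
    rw [hL', Set.image_image]
    simp
  have h1 := height_diff_translate hL hv
  have h2 := height_diff_translate (by rw [SignedAffine.map_rank]; exact hL) hv'
  rw [← e, hL', hd] at h2
  rw [flowAt, Nat.add_sub_cancel, h1, h2]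
  push_cast
  rw [← Finset.sum_sub_distrib]
  refine Finset.sum_congr rfl fun i _ => ?_
  rw [Pi.neg_apply, mul_neg]
  generalize (L.dir i : ℤ) * v i = z
  omega

end

/-! ### Standard orthants, invariance of heights, and vanishing of the total flow. -/

section

variable {N : ℕ}

/-- The member of the germ of `L` whose base point has coordinates `± T` along all directions. -/
def Orthant.standard (L : Orthant N) (T : ℕ) : Orthant N :=
  ⟨fun i => if L.dir i = 0 then L.base i else T * (L.dir i : ℤ), L.dir⟩

/-- The coordinates of `L` orthogonal to its directions are bounded by `R`. -/
def Orthant.OffBound (L : Orthant N) (R : ℕ) : Prop := ∀ i, L.dir i = 0 → (L.base i).natAbs ≤ R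

theorem Orthant.mem_standard_iff {L : Orthant N} {T : ℕ} {x : ZLat N} :
    x ∈ (L.standard T).carrier ↔ ∀ i, (L.dir i = 0 → x i = L.base i) ∧
      (L.dir i ≠ 0 → (T : ℤ) ≤ L.dir i * x i) := by
  rw [Orthant.mem_carrier_iff]
  refine forall_congr' fun i => ?_
  simp only [Orthant.standard]
  rcases SignType.cases_int (L.dir i) with ⟨h, h'⟩ | ⟨h, h'⟩ | ⟨h, h'⟩ <;> rw [h', h] <;> simp <;>
    omega

theorem Orthant.parallel_standard (L : Orthant N) (T : ℕ) : L.Parallel (L.standard T) :=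
  ⟨rfl, fun i hi => by simp [Orthant.standard, hi]⟩

/-- A point of a standard orthant reveals the orthant: its coordinates of size at least `T` are
those along the axes, with the right signs, while the others are bounded by `R`. So finitely many
germs get disjoint representatives simultaneously. -/
theorem Orthant.parallel_of_mem_standard {L L' : Orthant N} {R T : ℕ} (hRT : R < T)
    (hL : L.OffBound R) (hL' : L'.OffBound R) {x : ZLat N} (hx : x ∈ (L.standard T).carrier)
    (hx' : x ∈ (L'.standard T).carrier) : L.Parallel L' := by
  rw [Orthant.mem_standard_iff] at hx hx'
  have hd : L.dir = L'.dir := by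
    funext i
    have h1 := hx i
    have h2 := hx' i
    have h3 := hL i
    have h4 := hL' i
    rcases SignType.cases_int (L.dir i) with ⟨h, h'⟩ | ⟨h, h'⟩ | ⟨h, h'⟩ <;> rw [h'] at h1 <;>
    rcases SignType.cases_int (L'.dir i) with ⟨l, l'⟩ | ⟨l, l'⟩ | ⟨l, l'⟩ <;> rw [l'] at h2 <;>
    simp [h, l] at h1 h2 h3 h4 ⊢ <;> omega
  refine ⟨hd, fun i hi => ?_⟩
  rw [← (hx i).1 hi, ← (hx' i).1 (hd ▸ hi)]

/-- `R` bounds all base coordinates and `T - R` exceeds every required push. The surplus 3 leaves a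
gap between `R` and `T` for `peiSupp_subset_of_standard`. -/
theorem exists_standard_subset {ι : Type*} (F : Finset ι) (L : ι → Orthant N) (t : ι → ℕ) :
    ∃ R T, R + 3 ≤ T ∧ ∀ a ∈ F, (L a).OffBound R ∧
      ((L a).standard T).carrier ⊆ ((L a).push (t a)).carrier := by
  let B : ι → ℕ := fun a => ∑ i, ((L a).base i).natAbs
  have hB : ∀ a ∈ F, ∀ i, ((L a).base i).natAbs ≤ F.sup B := fun a ha i =>
    (Finset.single_le_sum (f := fun i => ((L a).base i).natAbs) (fun _ _ => Nat.zero_le _)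
      (Finset.mem_univ i)).trans (Finset.le_sup (f := B) ha)
  refine ⟨F.sup B, F.sup B + 3 + F.sup t, by omega, fun a ha => ⟨fun i _ => hB a ha i, ?_⟩⟩
  intro x hx
  rw [Orthant.mem_standard_iff] at hx
  rw [Orthant.mem_push_iff]
  intro i
  have h1 := hx i
  have h2 := hB a ha i
  have h3 : t a ≤ F.sup t := Finset.le_sup ha
  generalize F.sup B = b at *
  rcases SignType.cases_int ((L a).dir i) with ⟨h, h'⟩ | ⟨h, h'⟩ | ⟨h, h'⟩ <;> rw [h'] at h1 ⊢ <;>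
    simp [h] at h1 ⊢ <;> omega

theorem germs_mono {k : ℕ} {T T' : Set (ZLat N)} (h : T ⊆ T') : germs k T ⊆ germs k T' := by
  rintro _ ⟨L, hr, hL, rfl⟩
  exact ⟨L, hr, hL.trans h, rfl⟩

theorem height_union {k : ℕ} {T T' : Set (ZLat N)} (hT : IsOrthohedral T) (hd : Disjoint T T')
    (hf : (germs k T).Finite) (hf' : (germs k T').Finite) :
    height k (T ∪ T') = height k T + height k T' := by
  rw [height, germs_union hT, Set.ncard_union_eq (disjoint_germs hd k) hf hf']
  rfl

theorem germs_empty (k : ℕ) : germs k (∅ : Set (ZLat N)) = ∅ := by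
  ext γ
  simp only [Set.mem_empty_iff_false, iff_false]
  rintro ⟨L, -, hL, -⟩
  exact hL L.base_mem

theorem height_biUnion {ι : Type*} {k : ℕ} (F : Finset ι) {T : ι → Set (ZLat N)}
    (hT : ∀ a ∈ F, IsOrthohedral (T a)) (hd : ∀ a ∈ F, ∀ b ∈ F, a ≠ b → Disjoint (T a) (T b))
    (hf : ∀ a ∈ F, (germs k (T a)).Finite) :
    (germs k (⋃ a ∈ F, T a)).Finite ∧ height k (⋃ a ∈ F, T a) = ∑ a ∈ F, height k (T a) := by
  classical
  induction F using Finset.induction_on with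
  | empty => simp [height, germs_empty]
  | insert a F ha ih =>
    obtain ⟨h1, h2⟩ := ih (fun b hb => hT b (Finset.mem_insert_of_mem hb))
      (fun b hb c hc => hd b (Finset.mem_insert_of_mem hb) c (Finset.mem_insert_of_mem hc))
      (fun b hb => hf b (Finset.mem_insert_of_mem hb))
    rw [Finset.set_biUnion_insert, Finset.sum_insert ha, ← h2,
      germs_union (hT a (Finset.mem_insert_self _ _))]
    have h3 := hf a (Finset.mem_insert_self _ _)
    refine ⟨h3.union h1, height_union (hT a (Finset.mem_insert_self _ _)) ?_ h3 h1⟩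
    simp only [Set.disjoint_iUnion_right]
    intro b hb
    exact hd a (Finset.mem_insert_self _ _) b (Finset.mem_insert_of_mem hb)
      fun h => ha (h ▸ hb)

/-- The germ to which `g` sends `γ`. -/
def imageGerm (g : Equiv.Perm (ZLat N)) (γ : Set (Orthant N)) : Set (Orthant N) :=
  {M | SendsGerm g γ M.germ}

theorem TailEq.imageGerm_eq {g : Equiv.Perm (ZLat N)} {L : Orthant N} {f : SignedAffine N}
    (h : TailEq g L f) : imageGerm g L.germ = (f.map L).germ := by
  ext M
  rw [Orthant.mem_germ]
  exact h.sendsGerm_iff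

theorem SignedAffine.inv_map_map (f : SignedAffine N) (L : Orthant N) :
    f.inv.map (f.map L) = L := by
  apply Orthant.carrier_injective
  rw [← SignedAffine.image_carrier, ← SignedAffine.image_carrier, Set.image_image]
  simp

theorem imageGerm_imageGerm_inv {g : Equiv.Perm (ZLat N)} (hg : PiecewiseIsometric g)
    (L : Orthant N) : imageGerm g⁻¹ (imageGerm g L.germ) = L.germ := by
  obtain ⟨f, hf⟩ := hg.exists_tailEq L
  rw [hf.imageGerm_eq, hf.inv.imageGerm_eq, f.inv_map_map]

theorem imageGerm_mem_germs {g : Equiv.Perm (ZLat N)} (hg : PiecewiseIsometric g) {k : ℕ}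
    {T : Set (ZLat N)} {γ : Set (Orthant N)} (hγ : γ ∈ germs k T) :
    imageGerm g γ ∈ germs k (g '' T) := by
  obtain ⟨L, hr, hL, rfl⟩ := hγ
  obtain ⟨f, hf⟩ := hg.exists_tailEq L
  rw [hf.imageGerm_eq]
  obtain ⟨t, ht⟩ := hf
  refine ⟨f.map (L.push t), by rw [f.map_rank]; exact hr, ?_,
    Orthant.germ_eq_iff.2 (f.map_parallel (L.parallel_push t))⟩
  rw [← f.image_carrier, ← ht.image_eq]
  exact Set.image_mono ((L.push_subset t).trans hL)

theorem germs_image {g : Equiv.Perm (ZLat N)} (hg : PiecewiseIsometric g) (k : ℕ)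
    (T : Set (ZLat N)) : germs k (g '' T) = imageGerm g '' germs k T := by
  ext γ
  constructor
  · intro hγ
    have h1 := imageGerm_mem_germs hg.inv hγ
    have e : (g⁻¹ : Equiv.Perm (ZLat N)) '' (g '' T) = T := by
      rw [Set.image_image]; simp
    rw [e] at h1
    refine ⟨_, h1, ?_⟩
    obtain ⟨L, -, -, rfl⟩ := hγ
    have := imageGerm_imageGerm_inv hg.inv L
    rwa [inv_inv] at this
  · rintro ⟨γ, hγ, rfl⟩
    exact imageGerm_mem_germs hg hγ

/-- `imageGerm g⁻¹` undoes `imageGerm g` on germs, so the germs of a set and of its image correspond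
bijectively. The flow count rests on this invariance. -/
theorem height_image {g : Equiv.Perm (ZLat N)} (hg : PiecewiseIsometric g) (k : ℕ)
    (T : Set (ZLat N)) : height k (g '' T) = height k T := by
  rw [height, germs_image hg, Set.InjOn.ncard_image]
  · rfl
  · rintro _ ⟨L, -, -, rfl⟩ _ ⟨L', -, -, rfl⟩ h
    rw [← imageGerm_imageGerm_inv hg L, ← imageGerm_imageGerm_inv hg L', h]

theorem IsOrthohedral.thin {T : Set (ZLat N)} (hT : IsOrthohedral T) {m : ℤ}
    (h : ∀ L : Orthant N, L.carrier ⊆ T → (L.rank : ℤ) ≤ m) : Thin m T := by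
  obtain ⟨Λ, rfl⟩ := hT
  exact ⟨Λ, fun L hL => h L (Set.subset_biUnion_of_mem (u := Orthant.carrier) hL), subset_rfl⟩

variable {k : ℕ} {S : Set (ZLat N)}

/-- A member of the germ `γ` that is contained in `S`. -/
noncomputable def germRep (γ : germs k S) : Orthant N := γ.2.choose

theorem germRep_rank (γ : germs k S) : (germRep γ).rank = k := γ.2.choose_spec.1

theorem germRep_subset (γ : germs k S) : (germRep γ).carrier ⊆ S := γ.2.choose_spec.2.1

theorem germRep_germ (γ : germs k S) : (germRep γ).germ = γ := γ.2.choose_spec.2.2.symm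

/-- The flow of a permutation that fixes the germs of rank `k` vanishes. -/
theorem exists_sum_flow_eq_zero (hk : 1 ≤ k) (hS : IsOrthohedral S)
    (g : germFixerOrdSubgroup k S) : ∃ F : Finset (germs k S),
      (∀ γ, γ ∉ F → germTranslation g γ = 0) ∧
      ∑ γ ∈ F, ∑ i, ((germRep γ).dir i * (germTranslation g γ : ZLat N) i : ℤ) = 0 := by
  classical
  obtain ⟨k, rfl⟩ : ∃ l, k = l + 1 := ⟨k - 1, by omega⟩
  obtain ⟨hgS, hpw, Λ, hΛ, hmov⟩ := (mem_germFixerOrdSubgroup.1 g.2).1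
  set g' : Equiv.Perm (ZLat N) := g.1 with hg'
  -- A `g`-invariant orthohedral set of rank at most `k + 1` that contains all moved points; only
  -- its finitely many germs of top rank matter.
  let U : Set (ZLat N) := (⋃ L ∈ Λ, L.carrier) ∩ S
  have hU : IsOrthohedral U := IsOrthohedral.inter ⟨Λ, rfl⟩ hS
  have hUthin : Thin ((k + 1 : ℕ) : ℤ) U := ⟨Λ, hΛ, Set.inter_subset_left⟩
  have hgU : ∀ x, x ∉ U → g' x = x := by
    intro x hx
    by_contra hc
    exact hx ⟨hmov hc, by_contra fun h => hc (hgS x h)⟩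
  have hfin : {γ : germs (k + 1) S | (γ : Set (Orthant N)) ∈ germs (k + 1) U}.Finite :=
    hUthin.finite_germs.preimage Subtype.val_injective.injOn
  let F := hfin.toFinset
  have hF : ∀ γ ∈ F, ∃ L : Orthant N, L.rank = k + 1 ∧ L.carrier ⊆ U ∧
      L.germ = (γ : Set (Orthant N)) := by
    intro γ hγ
    obtain ⟨L, h1, h2, h3⟩ := hfin.mem_toFinset.1 hγ
    exact ⟨L, h1, h2, h3.symm⟩
  have : Nonempty (Orthant N) := ⟨⟨0, 0⟩⟩
  choose! L hLr hLU hLγ using hF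
  let v : germs (k + 1) S → ZLat N := fun γ => germTranslation g γ
  have hv : ∀ γ ∈ F, v γ ∈ TransGroup (L γ).germ := fun γ hγ => by
    rw [hLγ γ hγ]; exact (germTranslation g γ).2
  have htail : ∀ γ ∈ F, TailEq g' (L γ) (SignedAffine.translation (v γ)) := by
    intro γ hγ
    rw [← translatesGerm_iff, hLγ γ hγ]
    exact (germTranslation_eq_iff g γ _).1 rfl
  have htail' := htail
  choose! t ht using htail'
  obtain ⟨R, T, hRT, hstd⟩ := exists_standard_subset F L t
  -- These representatives are pairwise disjoint, and so far out that `g` is the translation by `v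
  -- γ` on each of them.
  let d : germs (k + 1) S → Orthant N := fun γ => (L γ).standard T
  have hdr : ∀ γ ∈ F, (d γ).rank = k + 1 := fun γ hγ => by
    rw [← ((L γ).parallel_standard T).rank_eq, hLr γ hγ]
  have hdU : ∀ γ ∈ F, (d γ).carrier ⊆ U := fun γ hγ =>
    ((hstd γ hγ).2.trans ((L γ).push_subset _)).trans (hLU γ hγ)
  have hdd : ∀ γ ∈ F, ∀ δ ∈ F, γ ≠ δ → Disjoint (d γ).carrier (d δ).carrier := by
    intro γ hγ δ hδ hne
    rw [Set.disjoint_left]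
    intro x hx hx'
    apply hne
    apply Subtype.ext
    rw [← hLγ γ hγ, ← hLγ δ hδ, Orthant.germ_eq_iff]
    exact Orthant.parallel_of_mem_standard (by omega) (hstd γ hγ).1 (hstd δ hδ).1 hx hx'
  -- A further push keeps the translated orthant inside `d γ`, so that sources and images belonging
  -- to different germs never overlap.
  have hs : ∀ γ ∈ F, ∃ s, ((SignedAffine.translation (v γ)).map ((d γ).push s)).carrier ⊆
      (d γ).carrier := by
    intro γ hγ
    have hdg : (d γ).germ = (L γ).germ :=
      Orthant.germ_eq_iff.2 ((L γ).parallel_standard T).symm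
    have h1 : TailEq g' (d γ) (SignedAffine.translation (v γ)) :=
      (htail γ hγ).of_parallel ((L γ).parallel_standard T)
    have h2 := (h1.permutesDirections_iff.1 (h1.permutesDirections_one (hdg ▸ hv γ hγ))).1
    obtain ⟨s, hs⟩ := h2.exists_push_subset
    exact ⟨s, by rwa [SignedAffine.map_push]⟩
  choose! s hs using hs
  let c : germs (k + 1) S → Orthant N := fun γ => (d γ).push (s γ)
  let A : germs (k + 1) S → Set (ZLat N) := fun γ => (c γ).carrier
  let B : germs (k + 1) S → Set (ZLat N) := fun γ => (fun x => v γ + x) '' (c γ).carrier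
  have hcr : ∀ γ ∈ F, (c γ).rank = k + 1 := hdr
  have hcg : ∀ γ ∈ F, (c γ).germ = (γ : Set (Orthant N)) := fun γ hγ => by
    rw [← hLγ γ hγ]
    exact Orthant.germ_eq_iff.2 (((L γ).parallel_standard T).trans
      (Orthant.parallel_push _ _)).symm
  have hAd : ∀ γ, A γ ⊆ (d γ).carrier := fun γ => (d γ).push_subset _
  have hBmap : ∀ γ, B γ = ((SignedAffine.translation (v γ)).map (c γ)).carrier := fun γ => by
    rw [← SignedAffine.image_carrier]
    exact Set.image_congr fun x _ => by simp
  have hBd : ∀ γ ∈ F, B γ ⊆ (d γ).carrier := fun γ hγ => by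
    rw [hBmap]; exact hs γ hγ
  have hBg : ∀ γ ∈ F, g' '' A γ = B γ := by
    intro γ hγ
    refine Set.image_congr fun x hx => ?_
    rw [ht γ hγ ((hstd γ hγ).2 (hAd γ hx))]
    simp
  have hAo : ∀ γ, IsOrthohedral (A γ) := fun γ => (c γ).isOrthohedral
  have hBo : ∀ γ, IsOrthohedral (B γ) := fun γ => by
    rw [hBmap]; exact Orthant.isOrthohedral _
  let AA : Set (ZLat N) := ⋃ γ ∈ F, A γ
  let BB : Set (ZLat N) := ⋃ γ ∈ F, B γ
  have hAAo : IsOrthohedral AA := IsOrthohedral.biUnion F.finite_toSet fun γ _ => hAo γ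
  have hBBo : IsOrthohedral BB := IsOrthohedral.biUnion F.finite_toSet fun γ _ => hBo γ
  have hAAU : AA ⊆ U := Set.iUnion₂_subset fun γ hγ => (hAd γ).trans (hdU γ hγ)
  have hBBU : BB ⊆ U := Set.iUnion₂_subset fun γ hγ => (hBd γ hγ).trans (hdU γ hγ)
  have hgAA : g' '' AA = BB := by
    simp only [AA, BB, Set.image_iUnion]
    exact Set.iUnion₂_congr hBg
  have hgUU : g' '' U = U := by
    apply Set.Subset.antisymm
    · rintro _ ⟨x, hx, rfl⟩
      exact Equiv.Perm.apply_mem_of_fixes_compl hgU hx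
    · intro x hx
      refine ⟨g'⁻¹ x, Equiv.Perm.apply_mem_of_fixes_compl (g := g'⁻¹) (fun y hy => ?_) hx, by simp⟩
      rw [Equiv.Perm.inv_eq_iff_eq, hgU y hy]
  -- Every rank-`(k + 1)` germ of `U` is represented in `AA`. Removing `AA` therefore lowers the
  -- rank and leaves only finitely many rank-`k` germs to count.
  have hthin : Thin (k : ℤ) (U \ AA) := by
    refine (hU.diff hAAo).thin fun M hM => ?_
    by_contra hc
    have h1 : (M.rank : ℤ) ≤ (k + 1 : ℕ) := hUthin.rank_le (hM.trans Set.sdiff_subset)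
    have h2 : M.rank = k + 1 := by omega
    have h3 : M.germ ∈ germs (k + 1) U := ⟨M, h2, hM.trans Set.sdiff_subset, rfl⟩
    have h4 : M.germ ∈ germs (k + 1) S := germs_mono Set.inter_subset_right h3
    have h5 : (⟨M.germ, h4⟩ : germs (k + 1) S) ∈ F := hfin.mem_toFinset.2 h3
    have h6 : M.germ ∈ germs (k + 1) AA := ⟨c ⟨M.germ, h4⟩, hcr _ h5,
      Set.subset_biUnion_of_mem (u := A) h5, (hcg _ h5).symm⟩
    exact Set.disjoint_left.1 (disjoint_germs (T := U \ AA) (T' := AA) Set.disjoint_sdiff_left _)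
      ⟨M, h2, hM, rfl⟩ h6
  have hfinA : (germs k (U \ AA)).Finite := hthin.finite_germs
  have hUB : g' '' (U \ AA) = U \ BB := by
    rw [Set.image_sdiff g'.injective, hgAA, hgUU]
  have hfinB : (germs k (U \ BB)).Finite := by
    rw [← hUB, germs_image hpw]
    exact hfinA.image _
  have hheight : height k (U \ AA) = height k (U \ BB) := by
    rw [← hUB, height_image hpw]
  -- The part outside `AA ∪ BB` is common to `U \ AA` and `U \ BB`; cancelling its height compares
  -- `BB \ AA` with `AA \ BB`.
  have e1 : U \ AA = (U \ (AA ∪ BB)) ∪ (BB \ AA) := by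
    ext x
    have := @hBBU x
    simp only [Set.mem_sdiff, Set.mem_union]
    tauto
  have e2 : U \ BB = (U \ (AA ∪ BB)) ∪ (AA \ BB) := by
    ext x
    have := @hAAU x
    simp only [Set.mem_sdiff, Set.mem_union]
    tauto
  have hfinBA : (germs k (BB \ AA)).Finite :=
    hfinA.subset (germs_mono (Set.sdiff_subset_sdiff_left hBBU))
  have hfinAB : (germs k (AA \ BB)).Finite :=
    hfinB.subset (germs_mono (Set.sdiff_subset_sdiff_left hAAU))
  have hfinU : (germs k (U \ (AA ∪ BB))).Finite :=
    hfinA.subset (germs_mono (Set.sdiff_subset_sdiff_right Set.subset_union_left))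
  have hUo : IsOrthohedral (U \ (AA ∪ BB)) := hU.diff (hAAo.union hBBo)
  rw [e1, e2, height_union hUo _ hfinU hfinBA, height_union hUo _ hfinU hfinAB,
    Nat.add_left_cancel_iff] at hheight
  rotate_left
  · rw [Set.disjoint_left]
    rintro x ⟨-, hx⟩ ⟨hx', -⟩
    exact hx (Or.inl hx')
  · rw [Set.disjoint_left]
    rintro x ⟨-, hx⟩ ⟨hx', -⟩
    exact hx (Or.inr hx')
  have diffUnion : ∀ P Q : germs (k + 1) S → Set (ZLat N),
      (∀ γ ∈ F, P γ ⊆ (d γ).carrier) → (∀ γ ∈ F, Q γ ⊆ (d γ).carrier) →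
      (⋃ γ ∈ F, P γ) \ (⋃ γ ∈ F, Q γ) = ⋃ γ ∈ F, (P γ \ Q γ) := by
    intro P Q hP hQ
    ext x
    simp only [Set.mem_sdiff, Set.mem_iUnion]
    constructor
    · rintro ⟨⟨γ, hγ, hx⟩, h⟩
      exact ⟨γ, hγ, hx, fun h' => h ⟨γ, hγ, h'⟩⟩
    · rintro ⟨γ, hγ, hx, h⟩
      refine ⟨⟨γ, hγ, hx⟩, ?_⟩
      rintro ⟨δ, hδ, hx'⟩
      by_cases hγδ : γ = δ
      · exact h (hγδ ▸ hx')
      · exact Set.disjoint_left.1 (hdd γ hγ δ hδ hγδ) (hP γ hγ hx) (hQ δ hδ hx')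
  have sumHeight : ∀ P Q : germs (k + 1) S → Set (ZLat N),
      (∀ γ, IsOrthohedral (P γ)) → (∀ γ, IsOrthohedral (Q γ)) →
      (∀ γ ∈ F, P γ ⊆ (d γ).carrier) → (∀ γ ∈ F, Q γ ⊆ (d γ).carrier) →
      (germs k ((⋃ γ ∈ F, P γ) \ (⋃ γ ∈ F, Q γ))).Finite →
      height k ((⋃ γ ∈ F, P γ) \ (⋃ γ ∈ F, Q γ)) = ∑ γ ∈ F, height k (P γ \ Q γ) := by
    intro P Q hPo hQo hP hQ hfin
    rw [diffUnion P Q hP hQ] at hfin ⊢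
    refine (height_biUnion F (fun γ _ => (hPo γ).diff (hQo γ)) ?_ ?_).2
    · intro γ hγ δ hδ hne
      exact (hdd γ hγ δ hδ hne).mono (Set.sdiff_subset.trans (hP γ hγ))
        (Set.sdiff_subset.trans (hP δ hδ))
    · intro γ hγ
      exact hfin.subset (germs_mono (Set.subset_biUnion_of_mem (u := fun γ => P γ \ Q γ) hγ))
  rw [sumHeight B A hBo hAo hBd (fun γ _ => hAd γ) hfinBA,
    sumHeight A B hAo hBo (fun γ _ => hAd γ) hBd hfinAB] at hheight
  refine ⟨F, fun γ hγ => ?_, ?_⟩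
  · rw [germTranslation_eq_iff]
    have hγ' : (γ : Set (Orthant N)) ∉ germs (k + 1) U := fun h => hγ (hfin.mem_toFinset.2 h)
    rw [← germRep_germ γ] at hγ' ⊢
    refine TailEq.translatesGerm_zero (tailEq_id_of_not_parallel hU hgU ?_)
    rwa [germRep_rank]
  · have h1 : ∀ γ ∈ F, ∑ i, ((germRep γ).dir i * (germTranslation g γ : ZLat N) i : ℤ) =
        (height k (A γ \ B γ) : ℤ) - height k (B γ \ A γ) := by
      intro γ hγ
      have := flowAt_eq (Nat.le_add_left 1 k) (hcr γ hγ) (v := v γ)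
        (by rw [hcg γ hγ]; exact (germTranslation g γ).2)
      rw [flowAt, Nat.add_sub_cancel] at this
      have hd : (germRep γ).dir = (c γ).dir :=
        (Orthant.germ_eq_iff.1 ((germRep_germ γ).trans (hcg γ hγ).symm)).1
      rw [hd]
      exact this.symm
    rw [Finset.sum_congr rfl h1, Finset.sum_sub_distrib]
    have : ((∑ γ ∈ F, height k (B γ \ A γ) : ℕ) : ℤ) = (∑ γ ∈ F, height k (A γ \ B γ) : ℕ) := by
      rw [hheight]
    push_cast at this
    omega

end

/-! ### Control of supports, and the unit generators far out. -/

section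

variable {N : ℕ}

/-- A unit vector goes to a signed unit vector; unless it is fixed, the image lies on another axis
or points backwards. -/
theorem IsometricOn.lin_unit_cases (f : SignedAffine N) (K : Orthant N) {i : Fin N}
    (hi : K.dir i ≠ 0) (hne : f.lin (K.unit i) ≠ K.unit i) :
    f.lin (K.unit i) i = 0 ∨ f.lin (K.unit i) i = -(K.dir i : ℤ) := by
  rw [f.lin_unit] at hne ⊢
  by_cases h : f.perm.symm i = i
  · rw [h] at hne ⊢
    rw [Orthant.unit_apply_self]
    have h1 : (f.map K).dir i ≠ 0 := by
      rw [Ne, f.map_dir_eq_zero]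
      rwa [← Equiv.symm_apply_eq f.perm |>.1 h]
    have h2 : (f.map K).dir i ≠ K.dir i := fun h => hne (by simp [Orthant.unit, h])
    rcases SignType.cases_int (K.dir i) with ⟨l, l'⟩ | ⟨l, l'⟩ | ⟨l, l'⟩ <;>
    rcases SignType.cases_int ((f.map K).dir i) with ⟨m, m'⟩ | ⟨m, m'⟩ | ⟨m, m'⟩ <;>
    simp_all
  · left
    exact Orthant.unit_apply_of_ne _ (Ne.symm h)

/-- If the moved points lie in standard orthants, then so does the support. -/
theorem peiSupp_subset_of_standard {ι : Type*} {F : Finset ι} {L : ι → Orthant N} {R T : ℕ}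
    (hRT : R + 3 ≤ T) (hoff : ∀ a ∈ F, (L a).OffBound R) {g : Equiv.Perm (ZLat N)}
    (hmov : ∀ x, x ∉ ⋃ a ∈ F, ((L a).standard T).carrier → g x = x) :
    peiSupp g ⊆ ⋃ a ∈ F, ((L a).standard T).carrier := by
  set U : Set (ZLat N) := ⋃ a ∈ F, ((L a).standard T).carrier with hU
  have hmemU : ∀ {x : ZLat N}, x ∈ U ↔ ∃ a ∈ F, x ∈ ((L a).standard T).carrier := by
    intro x
    simp [hU]
  intro y hy
  simp only [peiSupp, Set.mem_iUnion] at hy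
  obtain ⟨K, ⟨hiso, hne⟩, hyK⟩ := hy
  by_contra hyU
  have hgy := hmov y hyU
  obtain ⟨f, hf⟩ := hiso.exists_signedAffine
  obtain ⟨i, hi, hfi, hray⟩ := IsometricOn.exists_moved_ray hf hne hyK hgy
  have h1 : ∀ n : ℕ, 1 ≤ n → y + n • K.unit i ∈ U := fun n hn =>
    by_contra fun hc => hray n hn (hmov _ hc)
  -- The image of the first ray point is again in `U`. By `lin_unit_cases` its `i`-th coordinate is
  -- that of `y` or one step back from it.
  have h2 : y + f.lin (K.unit i) ∈ U := by
    have := h1 1 le_rfl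
    have h3 := (IsometricOn.add_nsmul hf hyK i 1).2
    rw [hgy, one_nsmul (f.lin (K.unit i))] at h3
    rw [← h3]
    exact Equiv.Perm.apply_mem_of_fixes_compl hmov this
  have hgap : ∀ x ∈ U, x i ≤ -T ∨ (-R ≤ x i ∧ x i ≤ R) ∨ T ≤ x i := by
    intro x hx
    obtain ⟨a, ha, hx⟩ := hmemU.1 hx
    have h4 := Orthant.mem_standard_iff.1 hx i
    have h5 := hoff a ha i
    rcases SignType.cases_int ((L a).dir i) with ⟨l, l'⟩ | ⟨l, l'⟩ | ⟨l, l'⟩ <;> rw [l'] at h4 <;>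
      simp [l] at h4 h5 <;> omega
  have hn : ∀ n : ℕ, (y + n • K.unit i) i = y i + n * (K.dir i : ℤ) := by
    intro n
    rw [← nsmul_eq_mul, ← K.unit_apply_self]
    rfl
  have hcase := IsometricOn.lin_unit_cases f K hi hfi
  have hg2 := hgap _ h2
  rw [Pi.add_apply] at hg2
  have hstep := hgap _ (h1 1 le_rfl)
  -- This index places a ray point at `R + 1` in the direction of the ray, inside the gap. That is
  -- impossible, so `y` itself is already beyond `R` in this direction.
  have hstep2 := fun h => hgap _ (h1 (R + 1 - K.dir i * y i : ℤ).toNat h)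
  simp only [hn] at hstep hstep2
  -- Otherwise the standard orthant containing the next ray point extends along the ray, and it
  -- already contains `y`.
  have hnotT : ¬ (T : ℤ) ≤ K.dir i * y i := by
    intro hT
    obtain ⟨a, ha, hx⟩ := hmemU.1 (h1 1 le_rfl)
    refine hyU (hmemU.2 ⟨a, ha, ?_⟩)
    rw [Orthant.mem_standard_iff] at hx ⊢
    intro j
    have h4 := hx j
    by_cases hj : j = i
    · subst hj
      rw [hn] at h4
      have h5 := hoff a ha j
      rcases SignType.cases_int ((L a).dir j) with ⟨l, l'⟩ | ⟨l, l'⟩ | ⟨l, l'⟩ <;> rw [l'] at h4 ⊢ <;>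
      rcases SignType.cases_int (K.dir j) with ⟨m, m'⟩ | ⟨m, m'⟩ | ⟨m, m'⟩ <;>
        rw [m'] at h4 hT <;> simp [l] at h4 h5 ⊢ <;> first | exact absurd m hi | omega
    · rw [Pi.add_apply, one_nsmul, K.unit_apply_of_ne hj, add_zero] at h4
      exact h4
  -- Now `y` lies in the gap and its successor on the ray does not, so `y` is at `T - 1`. The image
  -- of the first ray point is then at `T - 1` or `T - 2`, both in the gap since `R + 3 ≤ T`.
  rcases SignType.cases_int (K.dir i) with ⟨m, m'⟩ | ⟨m, m'⟩ | ⟨m, m'⟩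
  · exact hi m
  · simp only [m'] at hstep hstep2 hnotT hcase
    rcases hcase with hc | hc <;> rw [hc] at hg2 <;> omega
  · simp only [m'] at hstep hstep2 hnotT hcase
    rcases hcase with hc | hc <;> rw [hc] at hg2 <;> omega

theorem Orthant.face_eq_slice (L : Orthant N) (i : Fin N) : L.face i = L.slice i 0 := by
  simp [Orthant.face, Orthant.slice]

theorem Orthant.dir_ne_zero_of_face {L : Orthant N} {i l : Fin N} (h : (L.face i).dir l ≠ 0) :
    L.dir l ≠ 0 := by
  intro h0
  by_cases hl : l = i
  · subst hl; simp [Orthant.face] at h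
  · simp [Orthant.face, hl, h0] at h

theorem Orthant.mem_face_iff {L : Orthant N} {i : Fin N} (hi : L.dir i ≠ 0) {x : ZLat N} :
    x ∈ (L.face i).carrier ↔ x ∈ L.carrier ∧ (L.dir i : ℤ) * (x i - L.base i) = 0 := by
  rw [L.face_eq_slice, Orthant.mem_slice_iff hi]
  simp

theorem Orthant.face_subset (L : Orthant N) {i : Fin N} (hi : L.dir i ≠ 0) :
    (L.face i).carrier ⊆ L.carrier := fun _ hx => ((Orthant.mem_face_iff hi).1 hx).1

theorem Orthant.sub_unit_mem_iff {L : Orthant N} {i : Fin N} (hi : L.dir i ≠ 0) {x : ZLat N} :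
    x - L.unit i ∈ L.carrier ↔ x ∈ L.carrier \ (L.face i).carrier := by
  constructor
  · intro h
    have hx : x ∈ L.carrier := by simpa using Orthant.add_unit_mem h i
    refine ⟨hx, fun hc => ?_⟩
    have h1 := (Orthant.mem_carrier_iff.1 h i).2
    have h2 := ((Orthant.mem_face_iff hi).1 hc).2
    rw [Pi.sub_apply, L.unit_apply_self] at h1
    have h3 := SignType.intCast_mul_self hi
    have h4 : (L.dir i : ℤ) * (x i - L.dir i - L.base i) =
      L.dir i * (x i - L.base i) - L.dir i * L.dir i := by ring
    omega
  · rintro ⟨hx, hF⟩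
    rw [Orthant.mem_face_iff hi] at hF
    have hF : (L.dir i : ℤ) * (x i - L.base i) ≠ 0 := fun h => hF ⟨hx, h⟩
    rw [Orthant.mem_carrier_iff] at hx ⊢
    intro j
    by_cases hj : j = i
    · subst hj
      refine ⟨fun h => absurd h hi, ?_⟩
      rw [Pi.sub_apply, L.unit_apply_self]
      have h3 := SignType.intCast_mul_self hi
      have h4 : (L.dir j : ℤ) * (x j - L.dir j - L.base j) =
        L.dir j * (x j - L.base j) - L.dir j * L.dir j := by ring
      have := (hx j).2
      omega
    · rw [Pi.sub_apply, L.unit_apply_of_ne hj, sub_zero]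
      exact hx j

theorem Orthant.push_one_subset {L : Orthant N} {i : Fin N} (hi : L.dir i ≠ 0) :
    (L.push 1).carrier ⊆ L.carrier \ (L.face i).carrier := by
  intro x hx
  refine ⟨L.push_subset 1 hx, fun hc => ?_⟩
  have h1 := ((Orthant.mem_face_iff hi).1 hc).2
  have h2 := (Orthant.mem_push_iff.1 hx i).2 hi
  push_cast at h2
  omega

theorem Orthant.unit_mem_transGroup {L : Orthant N} {i : Fin N} (hi : L.dir i ≠ 0) :
    L.unit i ∈ TransGroup L.germ := by
  rw [mem_transGroup_germ]
  intro j hj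
  exact L.unit_apply_of_ne fun h => hi (h ▸ hj)

theorem Orthant.sqDist_eq_sum {M : Orthant N} {x y : ZLat N} (hx : x ∈ M.carrier)
    (hy : y ∈ M.carrier) : sqDist x y = ∑ l : {l // M.dir l ≠ 0}, (x l - y l) ^ 2 := by
  rw [← Finset.sum_subtype (Finset.univ.filter fun i => M.dir i ≠ 0) (p := fun i => M.dir i ≠ 0)
    (by simp) (fun l => (x l - y l) ^ 2)]
  refine (Finset.sum_subset (Finset.subset_univ _) fun i _ hi => ?_).symm
  have : M.dir i = 0 := by simpa using hi
  rw [(Orthant.mem_carrier_iff.1 hx i).1 this, (Orthant.mem_carrier_iff.1 hy i).1 this]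
  simp

/-- The map on the face preserves the coordinates counted from the base point along the matched
axes; on an orthant only these contribute to the distance. -/
theorem IsUnitTranslation.isometricOn_face {g : Equiv.Perm (ZLat N)} {L L' : Orthant N}
    {i j : Fin N} (h : IsUnitTranslation g L L' i j) : IsometricOn g (L.face i) := by
  obtain ⟨-, -, hi, hj, -, -, -, σ, hσ⟩ := h
  intro x hx y hy
  obtain ⟨hx1, hx2⟩ := hσ x hx
  obtain ⟨hy1, hy2⟩ := hσ y hy
  rw [Orthant.sqDist_eq_sum hx1 hy1, Orthant.sqDist_eq_sum hx hy, ← Equiv.sum_comp σ.toEquiv]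
  refine Finset.sum_congr rfl fun l _ => ?_
  have ex := hx2 l
  have ey := hy2 l
  have hl := Orthant.dir_ne_zero_of_face l.2
  have hl' := Orthant.dir_ne_zero_of_face (σ l).2
  have h1 := SignType.intCast_mul_self hl
  have h2 := SignType.intCast_mul_self hl'
  have h3 : (L'.dir (σ l) : ℤ) * (g x (σ l) - g y (σ l)) = L.dir l * (x l - y l) := by
    linear_combination ex - ey
  change (g x (σ l) - g y (σ l)) ^ 2 = _
  linear_combination ((L'.dir (σ l) : ℤ) * (g x (σ l) - g y (σ l)) + L.dir l * (x l - y l)) * h3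
    - (g x (σ l) - g y (σ l)) ^ 2 * h2 + (x l - y l) ^ 2 * h1

theorem moved_mem_of_peiSupp {g : Equiv.Perm (ZLat N)} {U : Set (ZLat N)} (h : peiSupp g ⊆ U) :
    ∀ x, x ∉ U → g x = x := fun _ hx =>
  by_contra fun hc => hx (h (moved_subset_peiSupp g hc))

theorem thin_moved {g : Equiv.Perm (ZLat N)} {U : Set (ZLat N)} {k : ℤ} (hU : Thin k U)
    (h : ∀ x, x ∉ U → g x = x) : Thin k {x | g x ≠ x} :=
  hU.mono fun x hx => by_contra fun hc => hx (h x hc)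

theorem IsUnitTranslation.piecewiseIsometric {g : Equiv.Perm (ZLat N)} {L L' : Orthant N}
    {i j : Fin N} (h : IsUnitTranslation g L L' i j) : PiecewiseIsometric g := by
  obtain ⟨f, hf⟩ := h.isometricOn_face.exists_signedAffine
  obtain ⟨-, -, hi, hj, hsupp, hL, hL', -⟩ := h
  refine PiecewiseIsometric.of_cover (s := Set.univ)
    (A := ![L.carrier \ (L.face i).carrier, L'.carrier, (L.face i).carrier,
      (L.carrier ∪ L'.carrier)ᶜ])
    (f := ![SignedAffine.translation (-L.unit i), SignedAffine.translation (L'.unit j), f,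
      SignedAffine.translation 0]) Set.finite_univ ?_ ?_ ?_
  · intro a _
    fin_cases a
    exacts [L.isOrthohedral.diff (L.face i).isOrthohedral, L'.isOrthohedral,
      (L.face i).isOrthohedral, (L.isOrthohedral.union L'.isOrthohedral).compl]
  · intro x
    by_cases h1 : x ∈ L'.carrier
    · exact ⟨1, trivial, h1⟩
    by_cases h2 : x ∈ (L.face i).carrier
    · exact ⟨2, trivial, h2⟩
    by_cases h3 : x ∈ L.carrier
    · exact ⟨0, trivial, h3, h2⟩
    · exact ⟨3, trivial, fun h => h.elim h3 h1⟩
  · intro a _ x hx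
    fin_cases a
    · exact (hL x hx).trans (by simp; abel)
    · exact (hL' x hx).trans (by simp; abel)
    · exact hf hx
    · exact (moved_mem_of_peiSupp hsupp.le x hx).trans (by simp)

theorem IsUnitTranslation.tailEq {g : Equiv.Perm (ZLat N)} {L L' : Orthant N} {i j : Fin N}
    (h : IsUnitTranslation g L L' i j) :
    TailEq g L (SignedAffine.translation (-L.unit i)) ∧
      TailEq g L' (SignedAffine.translation (L'.unit j)) ∧
      ∀ M : Orthant N, M.rank = L.rank → M.germ ≠ L.germ → M.germ ≠ L'.germ →
        TailEq g M (SignedAffine.translation 0) := by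
  obtain ⟨-, hr, hi, hj, hsupp, hL, hL', -⟩ := h
  refine ⟨⟨1, fun x hx => ?_⟩, ⟨0, fun x hx => ?_⟩, fun M hM h1 h2 => ?_⟩
  · exact (hL x (Orthant.push_one_subset hi hx)).trans (by simp; abel)
  · exact (hL' x (L'.push_subset 0 hx)).trans (by simp; abel)
  · refine tailEq_id_of_not_parallel (L.isOrthohedral.union L'.isOrthohedral)
      (moved_mem_of_peiSupp hsupp.le) ?_
    have a2 := germs_carrier L'
    rw [← hr] at a2
    rw [germs_union L.isOrthohedral, hM, germs_carrier L, a2]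
    simp [h1, h2]

theorem Orthant.exists_reflect (L : Orthant N) {i j : Fin N} (hij : i ≠ j) (hi : L.dir i ≠ 0)
    (hj : L.dir j ≠ 0) : ∃ f : SignedAffine N, f.map L = L ∧ f.map (L.face i) = L.face j ∧
      ∀ x ∈ L.carrier, L.reflect i j x = f.app x := by
  obtain ⟨f, hf, hfL⟩ := SignedAffine.exists_map_eq (L := L) (L' := L) (Equiv.swap i j)
    fun l => by
      by_cases h1 : l = i
      · subst h1; simp [hi, hj]
      by_cases h2 : l = j
      · subst h2; simp [hi, hj]
      rw [Equiv.swap_apply_of_ne_of_ne h1 h2]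
  refine ⟨f, hfL, ?_, fun x hx => ?_⟩
  · ext l
    · have : (f.map L).base l = L.base l := by rw [hfL]
      exact this
    · apply SignType.intCast_injective
      simp only [f.map_dir_cast]
      have h0 : ((f.map L).dir l : ℤ) = L.dir l := by rw [hfL]
      rw [f.map_dir_cast] at h0
      by_cases hl : l = j
      · subst hl
        simp [Orthant.face, hf]
      · have : f.perm l ≠ i := by
          rw [hf]
          intro h
          rw [Equiv.swap_apply_eq_iff, Equiv.swap_apply_left] at h
          exact hl h
        simp only [Orthant.face, Function.update_of_ne this, Function.update_of_ne hl]
        exact h0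
  · funext l
    have h1 := f.map_dir_mul_app L x l
    rw [hfL, hf] at h1
    simp only [Orthant.reflect]
    split_ifs with hl hl'
    · subst hl
      rw [Equiv.swap_apply_left] at h1
      rw [← h1]
      linear_combination (f.app x l - L.base l) * SignType.intCast_mul_self hi
    · subst hl'
      rw [Equiv.swap_apply_right] at h1
      rw [← h1]
      linear_combination (f.app x l - L.base l) * SignType.intCast_mul_self hj
    · rw [Equiv.swap_apply_of_ne_of_ne hl hl'] at h1
      by_cases h0 : L.dir l = 0
      · have hfx : f.app x ∈ L.carrier := by
          have := SignedAffine.app_mem_map (f := f).2 hx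
          rwa [hfL] at this
        rw [(Orthant.mem_carrier_iff.1 hx l).1 h0, (Orthant.mem_carrier_iff.1 hfx l).1 h0]
      · have := mul_left_cancel₀ (fun h => h0 (SignType.intCast_eq_zero.1 h)) h1
        omega

theorem IsUnitEndotranslation.piecewiseIsometric {g : Equiv.Perm (ZLat N)} {L : Orthant N}
    {i j : Fin N} (h : IsUnitEndotranslation g L i j) : PiecewiseIsometric g := by
  obtain ⟨hij, hi, hj, hsupp, hL, hF⟩ := h
  obtain ⟨f, -, -, hf⟩ := L.exists_reflect hij hi hj
  refine PiecewiseIsometric.of_cover (s := Set.univ)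
    (A := ![L.carrier \ (L.face i).carrier, (L.face i).carrier, L.carrierᶜ])
    (f := ![SignedAffine.translation (-L.unit i + L.unit j), f,
      SignedAffine.translation 0]) Set.finite_univ ?_ ?_ ?_
  · intro a _
    fin_cases a
    exacts [L.isOrthohedral.diff (L.face i).isOrthohedral, (L.face i).isOrthohedral,
      L.isOrthohedral.compl]
  · intro x
    by_cases h2 : x ∈ (L.face i).carrier
    · exact ⟨1, trivial, h2⟩
    by_cases h3 : x ∈ L.carrier
    · exact ⟨0, trivial, h3, h2⟩
    · exact ⟨2, trivial, h3⟩
  · intro a _ x hx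
    fin_cases a
    · exact (hL x hx).trans (by simp; abel)
    · exact (hF x hx).trans (hf x (L.face_subset hi hx))
    · exact (moved_mem_of_peiSupp hsupp x hx).trans (by simp)

theorem IsUnitEndotranslation.tailEq {g : Equiv.Perm (ZLat N)} {L : Orthant N} {i j : Fin N}
    (h : IsUnitEndotranslation g L i j) :
    TailEq g L (SignedAffine.translation (-L.unit i + L.unit j)) ∧
      ∀ M : Orthant N, M.rank = L.rank → M.germ ≠ L.germ →
        TailEq g M (SignedAffine.translation 0) := by
  obtain ⟨-, hi, hj, hsupp, hL, -⟩ := h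
  refine ⟨⟨1, fun x hx => ?_⟩, fun M hM h1 => ?_⟩
  · exact (hL x (Orthant.push_one_subset hi hx)).trans (by simp; abel)
  · refine tailEq_id_of_not_parallel L.isOrthohedral (moved_mem_of_peiSupp hsupp) ?_
    rw [hM, germs_carrier L]
    exact h1

theorem mem_germFixerOrdSubgroup_of_tailEq {k : ℕ} {S : Set (ZLat N)} {g : Equiv.Perm (ZLat N)}
    (h : g ∈ rankSubgroup (k : ℤ) S) (ht : ∀ M : Orthant N, M.rank = k →
      ∃ v ∈ TransGroup M.germ, TailEq g M (SignedAffine.translation v)) :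
    g ∈ germFixerOrdSubgroup k S := by
  refine mem_germFixerOrdSubgroup.2 ⟨h, ?_⟩
  rintro _ ⟨M, hM, -, rfl⟩
  obtain ⟨v, hv, hv'⟩ := ht M hM
  exact hv'.permutesDirections_one hv

/-- Far out on each rank-`k` germ both kinds of generators are translations: by plus or minus a unit
vector, by a difference of two, or by zero. -/
theorem unitGenerators_subset (k : ℕ) (S : Set (ZLat N)) :
    unitGenerators k S ⊆ germFixerOrdSubgroup k S := by
  rintro g (⟨L, L', hr, hL, hL', i, j, h⟩ | ⟨L, hr, hL, i, j, h⟩)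
  · have hfix := moved_mem_of_peiSupp h.2.2.2.2.1.le
    refine mem_germFixerOrdSubgroup_of_tailEq ⟨fun x hx => hfix x fun hc =>
      hx (hc.elim (@hL x) (@hL' x)), h.piecewiseIsometric, thin_moved
        ((thin_carrier L (by rw [hr])).union (thin_carrier L' (by rw [← h.2.1, hr]))) hfix⟩ ?_
    intro M hM
    obtain ⟨h1, h2, h3⟩ := h.tailEq
    by_cases e1 : M.germ = L.germ
    · exact ⟨_, e1 ▸ neg_mem (Orthant.unit_mem_transGroup h.2.2.1),
        h1.of_parallel (Orthant.germ_eq_iff.1 e1.symm)⟩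
    by_cases e2 : M.germ = L'.germ
    · exact ⟨_, e2 ▸ Orthant.unit_mem_transGroup h.2.2.2.1,
        h2.of_parallel (Orthant.germ_eq_iff.1 e2.symm)⟩
    exact ⟨0, zero_mem _, h3 M (hM.trans hr.symm) e1 e2⟩
  · have hfix := moved_mem_of_peiSupp h.2.2.2.1
    refine mem_germFixerOrdSubgroup_of_tailEq ⟨fun x hx => hfix x fun hc => hx (hL hc),
      h.piecewiseIsometric, thin_moved (thin_carrier L (by rw [hr])) hfix⟩ ?_
    intro M hM
    obtain ⟨h1, h3⟩ := h.tailEq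
    by_cases e1 : M.germ = L.germ
    · exact ⟨_, e1 ▸ add_mem (neg_mem (Orthant.unit_mem_transGroup h.2.1))
        (Orthant.unit_mem_transGroup h.2.2.1), h1.of_parallel (Orthant.germ_eq_iff.1 e1.symm)⟩
    exact ⟨0, zero_mem _, h3 M (hM.trans hr.symm) e1⟩

end

/-! ### Construction of unit-translations and unit-endotranslations on standard orthants. -/

section

variable {N : ℕ}

theorem image_translation (v : ZLat N) (A : Set (ZLat N)) :
    (SignedAffine.translation v).app '' A = {y | y - v ∈ A} := by
  ext y
  constructor
  · rintro ⟨x, hx, rfl⟩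
    simpa using hx
  · intro h
    exact ⟨y - v, h, by simp⟩

theorem Orthant.image_sub_unit {L : Orthant N} {i : Fin N} (hi : L.dir i ≠ 0) :
    (SignedAffine.translation (-L.unit i)).app '' (L.carrier \ (L.face i).carrier) =
      L.carrier := by
  rw [image_translation]
  ext y
  rw [Set.mem_ofPred_eq, ← Orthant.sub_unit_mem_iff hi]
  simp

theorem Orthant.image_add_unit {L : Orthant N} {i : Fin N} (hi : L.dir i ≠ 0) :
    (SignedAffine.translation (L.unit i)).app '' L.carrier =
      L.carrier \ (L.face i).carrier := by
  rw [image_translation]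
  ext y
  rw [Set.mem_ofPred_eq, ← Orthant.sub_unit_mem_iff hi]

theorem Orthant.image_sub_unit_add_unit {L : Orthant N} {i j : Fin N} (hi : L.dir i ≠ 0)
    (hj : L.dir j ≠ 0) :
    (SignedAffine.translation (-L.unit i + L.unit j)).app '' (L.carrier \ (L.face i).carrier) =
      L.carrier \ (L.face j).carrier := by
  rw [image_translation]
  ext y
  rw [Set.mem_ofPred_eq, ← Orthant.sub_unit_mem_iff hi, ← Orthant.sub_unit_mem_iff hj]
  have : y - (-L.unit i + L.unit j) - L.unit i = y - L.unit j := by abel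
  rw [this]

/-- The isometry between two faces that preserves the order of the axes. -/
theorem exists_orderIso_signedAffine {M M' : Orthant N} (h : M.rank = M'.rank) :
    ∃ (f : SignedAffine N) (σ : {l // M.dir l ≠ 0} ≃o {l // M'.dir l ≠ 0}), f.map M = M' ∧
      ∀ l, f.perm (σ l) = l := by
  classical
  have h1 : Fintype.card {l // M.dir l ≠ 0} = M.rank := by
    rw [Fintype.card_subtype]; rfl
  have h2 : Fintype.card {l // M'.dir l ≠ 0} = M.rank := by
    rw [Fintype.card_subtype, h]; rfl
  let σ : {l // M.dir l ≠ 0} ≃o {l // M'.dir l ≠ 0} :=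
    (monoEquivOfFin _ h1).symm.trans (monoEquivOfFin _ h2)
  let e : {l // M'.dir l ≠ 0} ≃ {l // M.dir l ≠ 0} := σ.symm.toEquiv
  obtain ⟨f, hf, hfM⟩ := SignedAffine.exists_map_eq (L := M) (L' := M') e.extendSubtype fun j => by
    by_cases hj : M'.dir j = 0
    · simp only [hj, true_iff]
      by_contra hc
      exact e.extendSubtype_not_mem j (by simpa using hj) hc
    · simp only [hj, false_iff]
      exact e.extendSubtype_mem j hj
  refine ⟨f, σ, hfM, fun l => ?_⟩
  rw [hf, e.extendSubtype_apply_of_mem _ (σ l).2]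
  simp [e]

theorem Orthant.face_rank_add_one {L : Orthant N} {i : Fin N} (hi : L.dir i ≠ 0) :
    (L.face i).rank + 1 = L.rank := by
  rw [L.face_eq_slice, Orthant.slice_rank_add_one hi]

/-- The pieces `L \ F`, `L'`, `F` go to `L`, `L' \ F'`, `F'`. All points of `L ∪ L'` are moved, and
standard position keeps fixed points outside from entering the support, which is required to equal
`L ∪ L'`. -/
theorem exists_isUnitTranslation {M M' : Orthant N} {R T : ℕ} (hRT : R + 3 ≤ T)
    (hM : M.OffBound R) (hM' : M'.OffBound R) (hr : M.rank = M'.rank) (hne : M.germ ≠ M'.germ)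
    {i j : Fin N} (hi : M.dir i ≠ 0) (hj : M'.dir j ≠ 0) :
    ∃ g, IsUnitTranslation g (M.standard T) (M'.standard T) i j := by
  set L := M.standard T with hLdef
  set L' := M'.standard T with hLdef'
  have hr' : L.rank = L'.rank := hr
  have hi' : L.dir i ≠ 0 := hi
  have hj' : L'.dir j ≠ 0 := hj
  have hd : Disjoint L.carrier L'.carrier := by
    rw [Set.disjoint_left]
    intro x hx hx'
    exact hne (Orthant.germ_eq_iff.2 (Orthant.parallel_of_mem_standard (by omega) hM hM' hx hx'))
  have hfr : (L.face i).rank = (L'.face j).rank := by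
    have h1 := Orthant.face_rank_add_one hi'
    have h2 := Orthant.face_rank_add_one hj'
    omega
  obtain ⟨f, σ, hf, hσ⟩ := exists_orderIso_signedAffine hfr
  have him0 := Orthant.image_sub_unit hi'
  have him1 := Orthant.image_add_unit hj'
  have him2 : f.app '' (L.face i).carrier = (L'.face j).carrier := by rw [f.image_carrier, hf]
  have hFL := L.face_subset hi'
  have hFL' := L'.face_subset hj'
  obtain ⟨g, -, hg, hg'⟩ := exists_piecewise_perm
    (A := ![L.carrier \ (L.face i).carrier, L'.carrier, (L.face i).carrier])
    (f := ![SignedAffine.translation (-L.unit i), SignedAffine.translation (L'.unit j), f])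
    (by
      intro a
      fin_cases a
      exacts [L.isOrthohedral.diff (L.face i).isOrthohedral, L'.isOrthohedral,
        (L.face i).isOrthohedral])
    (by
      have d1 : Disjoint (L.carrier \ (L.face i).carrier) L'.carrier :=
        hd.mono_left Set.sdiff_subset
      have d2 : Disjoint (L.carrier \ (L.face i).carrier) (L.face i).carrier :=
        Set.disjoint_sdiff_left
      have d3 : Disjoint L'.carrier (L.face i).carrier := hd.symm.mono_right hFL
      intro a b hab
      fin_cases a <;> fin_cases b
      exacts [absurd rfl hab, d1, d2, d1.symm, absurd rfl hab, d3, d2.symm, d3.symm,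
        absurd rfl hab])
    (by
      have d1 : Disjoint L.carrier (L'.carrier \ (L'.face j).carrier) :=
        hd.mono_right Set.sdiff_subset
      have d2 : Disjoint L.carrier (L'.face j).carrier := hd.mono_right hFL'
      have d3 : Disjoint (L'.carrier \ (L'.face j).carrier) (L'.face j).carrier :=
        Set.disjoint_sdiff_left
      rw [← him0] at d1 d2
      rw [← him1] at d1 d3
      rw [← him2] at d2 d3
      intro a b hab
      fin_cases a <;> fin_cases b
      exacts [absurd rfl hab, d1, d2, d1.symm, absurd rfl hab, d3, d2.symm, d3.symm,
        absurd rfl hab])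
    (by
      ext x
      simp only [Set.mem_iUnion, Fin.exists_fin_succ, Matrix.cons_val_zero, Matrix.cons_val_succ,
        IsEmpty.exists_iff, or_false, him0, him1, him2, Set.mem_sdiff]
      have := @hFL x
      have := @hFL' x
      tauto)
  have hg0 : ∀ x ∈ L.carrier \ (L.face i).carrier, g x = x - L.unit i := fun x hx =>
    (hg 0 x hx).trans (by simp; abel)
  have hg1 : ∀ x ∈ L'.carrier, g x = x + L'.unit j := fun x hx =>
    (hg 1 x hx).trans (by simp; abel)
  have hg2 : ∀ x ∈ (L.face i).carrier, g x = f.app x := fun x hx => hg 2 x hx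
  have hfix : ∀ x, x ∉ L.carrier ∪ L'.carrier → g x = x := by
    intro x hx
    refine hg' x fun a hc => hx ?_
    fin_cases a
    exacts [Or.inl hc.1, Or.inr hc, Or.inl (hFL hc)]
  have hu : ∀ (K : Orthant N) (l : Fin N), K.dir l ≠ 0 → K.unit l ≠ 0 := by
    intro K l hl h
    have := congrFun h l
    rw [K.unit_apply_self] at this
    exact hl (SignType.intCast_eq_zero.1 this)
  refine ⟨g, hd, hr', hi', hj', ?_, hg0, hg1, σ, fun x hx => ⟨?_, fun l => ?_⟩⟩
  · apply Set.Subset.antisymm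
    · have := peiSupp_subset_of_standard (F := Finset.univ) (L := fun b : Bool => cond b M M')
        (g := g) hRT (by rintro (_ | _) -; exacts [hM', hM]) (by
          intro x hx
          refine hfix x fun hc => hx ?_
          simp only [Finset.mem_univ, Set.iUnion_true, Set.mem_iUnion, Bool.exists_bool,
            cond_true, cond_false]
          exact hc.symm)
      intro x hx
      have := this hx
      simp only [Finset.mem_univ, Set.iUnion_true, Set.mem_iUnion, Bool.exists_bool,
            cond_true, cond_false] at this
      exact this.symm
    · refine Set.Subset.trans ?_ (moved_subset_peiSupp g)
      rintro x (hx | hx)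
      · by_cases hxF : x ∈ (L.face i).carrier
        · intro hc
          rw [hg2 x hxF] at hc
          have : f.app x ∈ L'.carrier := hFL' (him2 ▸ Set.mem_image_of_mem _ hxF)
          rw [hc] at this
          exact Set.disjoint_left.1 hd hx this
        · intro hc
          rw [hg0 x ⟨hx, hxF⟩] at hc
          exact hu L i hi' (by simpa using hc)
      · intro hc
        rw [hg1 x hx] at hc
        exact hu L' j hj' (by simpa using hc)
  · rw [hg2 x hx, ← him2]
    exact Set.mem_image_of_mem _ hx
  · have h1 := f.map_dir_mul_app (L.face i) x (σ l)
    rw [hf, hσ l, ← hg2 x hx] at h1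
    have e1 : ∀ (K : Orthant N) (a b : Fin N), (K.face a).dir b ≠ 0 →
        (K.face a).dir b = K.dir b := by
      intro K a b hb
      by_cases hab : b = a
      · subst hab; simp [Orthant.face] at hb
      · simp [Orthant.face, hab]
    rw [e1 _ _ _ l.2, e1 _ _ _ (σ l).2] at h1
    exact h1

/-- Standard position serves here only to keep the support inside the orthant. -/
theorem exists_isUnitEndotranslation {M : Orthant N} {R T : ℕ} (hRT : R + 3 ≤ T)
    (hM : M.OffBound R) {i j : Fin N} (hij : i ≠ j) (hi : M.dir i ≠ 0) (hj : M.dir j ≠ 0) :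
    ∃ g, IsUnitEndotranslation g (M.standard T) i j := by
  set L := M.standard T with hLdef
  have hi' : L.dir i ≠ 0 := hi
  have hj' : L.dir j ≠ 0 := hj
  obtain ⟨f, -, hf, hfr⟩ := L.exists_reflect hij hi' hj'
  have him0 := Orthant.image_sub_unit_add_unit hi' hj'
  have him1 : f.app '' (L.face i).carrier = (L.face j).carrier := by rw [f.image_carrier, hf]
  have hFi := L.face_subset hi'
  have hFj := L.face_subset hj'
  obtain ⟨g, -, hg, hg'⟩ := exists_piecewise_perm
    (A := ![L.carrier \ (L.face i).carrier, (L.face i).carrier])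
    (f := ![SignedAffine.translation (-L.unit i + L.unit j), f])
    (by
      intro a
      fin_cases a
      exacts [L.isOrthohedral.diff (L.face i).isOrthohedral, (L.face i).isOrthohedral])
    (by
      have d1 : Disjoint (L.carrier \ (L.face i).carrier) (L.face i).carrier :=
        Set.disjoint_sdiff_left
      intro a b hab
      fin_cases a <;> fin_cases b
      exacts [absurd rfl hab, d1, d1.symm, absurd rfl hab])
    (by
      have d1 : Disjoint (L.carrier \ (L.face j).carrier) (L.face j).carrier :=
        Set.disjoint_sdiff_left
      rw [← him0, ← him1] at d1
      intro a b hab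
      fin_cases a <;> fin_cases b
      exacts [absurd rfl hab, d1, d1.symm, absurd rfl hab])
    (by
      ext x
      simp only [Set.mem_iUnion, Fin.exists_fin_succ, Matrix.cons_val_zero, Matrix.cons_val_succ,
        IsEmpty.exists_iff, or_false, him0, him1, Set.mem_sdiff]
      have := @hFi x
      have := @hFj x
      tauto)
  have hfix : ∀ x, x ∉ L.carrier → g x = x := by
    intro x hx
    refine hg' x fun a hc => hx ?_
    fin_cases a
    exacts [hc.1, hFi hc]
  refine ⟨g, hij, hi', hj', ?_, fun x hx => ?_, fun x hx => ?_⟩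
  · have := peiSupp_subset_of_standard (F := Finset.univ) (L := fun _ : Unit => M)
        (g := g) hRT (fun _ _ => hM) (by
          intro x hx
          refine hfix x fun hc => hx ?_
          simpa using hc)
    intro x hx
    simpa using this hx
  · exact (hg 0 x hx).trans (by simp; abel)
  · exact (hg 1 x hx).trans (hfr x (hFi hx)).symm

end

/-! ### A basis of the sum of the translation groups, the total flow, and its kernel. -/

section

variable {N k : ℕ} {S : Set (ZLat N)}

theorem mem_transGroup_iff (γ : germs k S) {v : ZLat N} :
    v ∈ TransGroup (γ : Set (Orthant N)) ↔ ∀ i, (germRep γ).dir i = 0 → v i = 0 := by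
  rw [← germRep_germ γ, mem_transGroup_germ]

/-- The axes along which the members of the germ `γ` extend. -/
abbrev GermAxis (γ : germs k S) : Type := {i : Fin N // (germRep γ).dir i ≠ 0}

/-- Coordinates on the translation group of a tangent coset with respect to the directions. -/
noncomputable def transEquiv (γ : germs k S) :
    TransGroup (γ : Set (Orthant N)) ≃ₗ[ℤ] (GermAxis γ → ℤ) where
  toFun v i := (germRep γ).dir i * (v : ZLat N) i
  map_add' v w := by
    funext i
    simp [mul_add]
  map_smul' n v := by
    funext i
    simp only [AddSubgroup.coe_zsmul, Pi.smul_apply, smul_eq_mul, RingHom.id_apply]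
    ring
  invFun w := ⟨fun j => if h : (germRep γ).dir j ≠ 0 then (germRep γ).dir j * w ⟨j, h⟩ else 0,
    (mem_transGroup_iff γ).2 fun i hi => by simp [hi]⟩
  left_inv v := by
    refine Subtype.ext (funext fun j => ?_)
    by_cases h : (germRep γ).dir j = 0
    · simp [h, (mem_transGroup_iff γ).1 v.2 j h]
    · simp only [dif_pos (show (germRep γ).dir j ≠ 0 from h)]
      linear_combination (v : ZLat N) j * SignType.intCast_mul_self h
  right_inv w := by
    funext i
    simp only [dif_pos i.2]
    linear_combination w i * SignType.intCast_mul_self i.2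

/-- The direct sum of the translation groups of the tangent cosets. -/
abbrev TransSum (k : ℕ) (S : Set (ZLat N)) : Type :=
  DirectSum (germs k S) fun γ => TransGroup (γ : Set (Orthant N))

/-- The basis of the direct sum of the translation groups given by the directions. -/
noncomputable def transBasis (k : ℕ) (S : Set (ZLat N)) :
    Module.Basis (Σ γ : germs k S, GermAxis γ) ℤ (TransSum k S) :=
  DFinsupp.basis fun γ => Module.Basis.ofEquivFun (transEquiv γ)

theorem transBasis_repr (z : TransSum k S) (p : Σ γ : germs k S, GermAxis γ) :
    (transBasis k S).repr z p = (germRep p.1).dir p.2 * (z p.1 : ZLat N) p.2 := rfl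

/-- The unit vector of a direction. -/
noncomputable def axisVector (γ : germs k S) (i : GermAxis γ) :
    TransGroup (γ : Set (Orthant N)) :=
  ⟨(germRep γ).unit i, by
    have := Orthant.unit_mem_transGroup i.2
    rwa [germRep_germ] at this⟩

open Classical in
theorem transBasis_apply (p : Σ γ : germs k S, GermAxis γ) :
    transBasis k S p = DirectSum.of (fun γ : germs k S => TransGroup (γ : Set (Orthant N))) p.1
      (axisVector p.1 p.2) := by
  apply (transBasis k S).repr.injective
  rw [Module.Basis.repr_self]
  ext q
  rw [transBasis_repr]
  obtain ⟨γ, i⟩ := p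
  obtain ⟨δ, j⟩ := q
  by_cases h : γ = δ
  · subst h
    simp only [DirectSum.of_eq_same, axisVector]
    by_cases hij : i = j
    · subst hij
      simp [Orthant.unit_apply_self, SignType.intCast_mul_self i.2]
    · rw [Finsupp.single_eq_of_ne (by simpa using fun h => hij h.symm),
        Orthant.unit_apply_of_ne _ (fun h => hij (Subtype.ext h.symm)), mul_zero]
  · rw [Finsupp.single_eq_of_ne (fun hc => h (congrArg Sigma.fst hc).symm),
      DirectSum.of_eq_of_ne _ _ _ (fun hc => h hc.symm)]
    simp

/-- The flow on one translation group. -/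
noncomputable def germFlow (γ : germs k S) : TransGroup (γ : Set (Orthant N)) →+ ℤ where
  toFun v := ∑ i, ((germRep γ).dir i * (v : ZLat N) i : ℤ)
  map_zero' := by simp
  map_add' v w := by simp [mul_add, Finset.sum_add_distrib]

theorem germFlow_apply (γ : germs k S) (v : TransGroup (γ : Set (Orthant N))) :
    germFlow γ v = ∑ i, ((germRep γ).dir i * (v : ZLat N) i : ℤ) := rfl

open Classical in
/-- The total flow. -/
noncomputable def totalFlow (k : ℕ) (S : Set (ZLat N)) : TransSum k S →+ ℤ :=
  DirectSum.toAddMonoid germFlow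

theorem totalFlow_eq_sum (z : TransSum k S) {F : Finset (germs k S)}
    (hF : ∀ γ, γ ∉ F → z γ = 0) : totalFlow k S z = ∑ γ ∈ F, germFlow γ (z γ) := by
  classical
  have h : z = ∑ γ ∈ F, DirectSum.of (fun γ : germs k S => TransGroup (γ : Set (Orthant N))) γ
      (z γ) := by
    refine DFinsupp.ext fun δ => ?_
    rw [DirectSum.sum_apply]
    by_cases hδ : δ ∈ F
    · rw [Finset.sum_eq_single_of_mem δ hδ
        (fun γ _ hne => DirectSum.of_eq_of_ne _ _ _ hne.symm), DirectSum.of_eq_same]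
    · rw [hF δ hδ, Finset.sum_eq_zero]
      intro γ hγ
      exact DirectSum.of_eq_of_ne _ _ _ fun hc => hδ (hc ▸ hγ)
  conv_lhs => rw [h]
  rw [map_sum]
  exact Finset.sum_congr rfl fun γ _ => by rw [totalFlow]; exact DirectSum.toAddMonoid_of _ _ _

theorem finite_support_transSum (z : TransSum k S) : {γ : germs k S | z γ ≠ 0}.Finite := by
  classical
  refine (DFinsupp.support z).finite_toSet.subset fun γ hγ => ?_
  simpa using hγ

theorem flowAt_eq_germFlow (hk : 1 ≤ k) (γ : germs k S) {L : Orthant N}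
    (hL : L ∈ (γ : Set (Orthant N))) (v : TransGroup (γ : Set (Orthant N))) :
    flowAt k L v = germFlow γ v := by
  rw [← germRep_germ γ, Orthant.mem_germ] at hL
  rw [flowAt_eq hk (hL.rank_eq.symm.trans (germRep_rank γ))
    (by rw [← Orthant.germ_eq_iff.2 hL, germRep_germ]; exact v.2), ← hL.1, germFlow_apply]

theorem totalFlow_eq_finsum (hk : 1 ≤ k) (z : TransSum k S) (L : germs k S → Orthant N)
    (hL : ∀ γ : germs k S, L γ ∈ (γ : Set (Orthant N))) :
    totalFlow k S z = ∑ᶠ γ, flowAt k (L γ) (z γ) := by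
  classical
  rw [finsum_congr fun γ => flowAt_eq_germFlow hk γ (hL γ) (z γ),
    totalFlow_eq_sum z (F := (finite_support_transSum z).toFinset)
      (fun γ hγ => by
        by_contra hc
        exact hγ ((finite_support_transSum z).mem_toFinset.2 hc))]
  refine (finsum_eq_sum_of_support_subset _ fun γ hγ => ?_).symm
  simp only [Set.Finite.coe_toFinset]
  intro hc
  exact hγ (by simp [hc])

theorem totalFlow_transBasis (p : Σ γ : germs k S, GermAxis γ) :
    totalFlow k S (transBasis k S p) = 1 := by
  classical
  rw [transBasis_apply, totalFlow, DirectSum.toAddMonoid_of, germFlow_apply]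
  simp only [axisVector]
  rw [Finset.sum_eq_single_of_mem (p.2 : Fin N) (Finset.mem_univ _)
    (fun i _ hi => by rw [Orthant.unit_apply_of_ne _ hi, mul_zero]), Orthant.unit_apply_self,
    SignType.intCast_mul_self p.2.2]

/-- Each basis vector has flow 1. So the kernel consists of the vectors with coordinate sum zero and
is spanned by differences of basis vectors. -/
theorem totalFlow_eq_repr_sum (z : TransSum k S) :
    totalFlow k S z = ((transBasis k S).repr z).sum fun _ c => c := by
  conv_lhs => rw [← (transBasis k S).linearCombination_repr z]
  rw [Finsupp.linearCombination_apply, Finsupp.sum, map_sum]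
  refine Finset.sum_congr rfl fun p _ => ?_
  rw [map_zsmul, totalFlow_transBasis]
  simp

theorem totalFlow_translationHom (hk : 1 ≤ k) (hS : IsOrthohedral S)
    (g : germFixerOrdSubgroup k S) : totalFlow k S (translationHom k S g).toAdd = 0 := by
  obtain ⟨F, hF, hsum⟩ := exists_sum_flow_eq_zero hk hS g
  rw [totalFlow_eq_sum (F := F), ← hsum]
  · refine Finset.sum_congr rfl fun γ _ => ?_
    rw [germFlow_apply]
    simp only [translationHom, MonoidHom.coe_mk, OneHom.coe_mk, toAdd_ofAdd,
      translationVector_apply]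
  · intro γ hγ
    rw [← hF γ hγ, ← translationVector_apply]
    rfl

/-- Any difference of two unit vectors is realized by a unit generator on standard orthants. -/
theorem exists_unitGenerator {R T : ℕ} (hRT : R + 3 ≤ T) {Z : Finset (germs k S)}
    (hZ : ∀ γ ∈ Z, (germRep γ).OffBound R ∧ ((germRep γ).standard T).carrier ⊆ S)
    {p q : Σ γ : germs k S, GermAxis γ} (hp : p.1 ∈ Z) (hq : q.1 ∈ Z) (hpq : p ≠ q) :
    ∃ g : germFixerOrdSubgroup k S, (g : Equiv.Perm (ZLat N)) ∈ unitGenerators k S ∧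
      (∀ x, x ∉ ⋃ γ ∈ Z, ((germRep γ).standard T).carrier → g.1 x = x) ∧
      translationHom k S g = Multiplicative.ofAdd (transBasis k S p - transBasis k S q) := by
  classical
  obtain ⟨γ, j⟩ := p
  obtain ⟨δ, i⟩ := q
  simp only at hp hq
  have hsub : ∀ γ ∈ Z, ((germRep γ).standard T).carrier ⊆
      ⋃ γ ∈ Z, ((germRep γ).standard T).carrier := fun γ hγ =>
    Set.subset_biUnion_of_mem (u := fun γ : germs k S => ((germRep γ).standard T).carrier) hγ
  have hgerm : ∀ γ : germs k S, ((germRep γ).standard T).germ = γ := fun γ => by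
    rw [← germRep_germ γ]
    exact Orthant.germ_eq_iff.2 ((germRep γ).parallel_standard T).symm
  have hunit : ∀ (γ : germs k S) (i : Fin N),
      ((germRep γ).standard T).unit i = (germRep γ).unit i := fun _ _ => rfl
  have hcoe : ∀ ε : germs k S, ((transBasis k S ⟨γ, j⟩ - transBasis k S ⟨δ, i⟩) ε : ZLat N) =
      (if ε = γ then (germRep γ).unit j else 0) - (if ε = δ then (germRep δ).unit i else 0) := by
    intro ε
    rw [DirectSum.sub_apply, AddSubgroup.coe_sub, transBasis_apply, transBasis_apply]
    congr 1
    · by_cases h : ε = γ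
      · subst h; simp [DirectSum.of_eq_same, axisVector]
      · rw [DirectSum.of_eq_of_ne _ _ _ h]; simp [h]
    · by_cases h : ε = δ
      · subst h; simp [DirectSum.of_eq_same, axisVector]
      · rw [DirectSum.of_eq_of_ne _ _ _ h]; simp [h]
  have hfinish : ∀ g : germFixerOrdSubgroup k S, (∀ ε : germs k S,
      TailEq g.1 ((germRep ε).standard T) (SignedAffine.translation
        ((if ε = γ then (germRep γ).unit j else 0) - (if ε = δ then (germRep δ).unit i else 0)))) →
      translationHom k S g =
        Multiplicative.ofAdd (transBasis k S ⟨γ, j⟩ - transBasis k S ⟨δ, i⟩) := by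
    intro g hg
    apply Multiplicative.toAdd.injective
    refine DFinsupp.ext fun ε => ?_
    refine (translationHom_eq_iff g ε _).2 ?_
    have := translatesGerm_iff.2 (hg ε)
    rw [hgerm, ← hcoe ε] at this
    exact this
  -- Two directions of the same germ call for an endotranslation, directions of different germs for
  -- a unit-translation.
  by_cases hγδ : γ = δ
  · subst hγδ
    have hij : (i : Fin N) ≠ j := fun h => hpq (by rw [Subtype.ext h])
    obtain ⟨g, hg⟩ := exists_isUnitEndotranslation hRT (hZ γ hp).1 hij i.2 j.2
    have hgen : g ∈ unitGenerators k S :=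
      Or.inr ⟨(germRep γ).standard T, germRep_rank γ, (hZ γ hp).2, i, j, hg⟩
    refine ⟨⟨g, unitGenerators_subset k S hgen⟩, hgen, fun x hx => ?_, hfinish _ fun ε => ?_⟩
    · exact moved_mem_of_peiSupp hg.2.2.2.1 x fun hc => hx (hsub γ hp hc)
    · obtain ⟨h1, h2⟩ := hg.tailEq
      by_cases hε : ε = γ
      · subst hε
        simp only [if_true]
        rw [hunit, hunit] at h1
        rwa [show (germRep ε).unit j - (germRep ε).unit i = -(germRep ε).unit i +
          (germRep ε).unit j by abel]
      · simp only [hε, if_false, sub_zero]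
        refine h2 _ ((germRep_rank ε).trans (germRep_rank γ).symm) fun hc => hε ?_
        rw [hgerm, hgerm] at hc
        exact Subtype.ext hc
  · have hne : (germRep δ).germ ≠ (germRep γ).germ := by
      rw [germRep_germ, germRep_germ]
      exact fun hc => hγδ (Subtype.ext hc).symm
    obtain ⟨g, hg⟩ := exists_isUnitTranslation hRT (hZ δ hq).1 (hZ γ hp).1
      ((germRep_rank δ).trans (germRep_rank γ).symm) hne i.2 j.2
    have hgen : g ∈ unitGenerators k S :=
      Or.inl ⟨(germRep δ).standard T, _, germRep_rank δ, (hZ δ hq).2, (hZ γ hp).2, i, j, hg⟩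
    refine ⟨⟨g, unitGenerators_subset k S hgen⟩, hgen, fun x hx => ?_, hfinish _ fun ε => ?_⟩
    · exact moved_mem_of_peiSupp hg.2.2.2.2.1.le x fun hc =>
        hx (hc.elim (fun h => hsub δ hq h) (fun h => hsub γ hp h))
    · obtain ⟨h1, h2, h3⟩ := hg.tailEq
      by_cases hε : ε = γ
      · subst hε
        simp only [if_true, hγδ, if_false, sub_zero]
        exact h2
      by_cases hε' : ε = δ
      · subst hε'
        simp only [if_true, hε, if_false, zero_sub]
        exact h1
      · simp only [hε, hε', if_false, sub_zero]
        refine h3 _ ((germRep_rank ε).trans (germRep_rank δ).symm)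
          (fun hc => hε' ?_) (fun hc => hε ?_)
        · rw [hgerm, hgerm] at hc
          exact Subtype.ext hc
        · rw [hgerm, hgerm] at hc
          exact Subtype.ext hc

/-- A family of translations of total flow zero is realized by a product of unit generators
supported on given standard orthants. -/
theorem exists_mem_closure_translationHom_eq {R T : ℕ} (hRT : R + 3 ≤ T) {Z : Finset (germs k S)}
    (hZ : ∀ γ ∈ Z, (germRep γ).OffBound R ∧ ((germRep γ).standard T).carrier ⊆ S)
    {z : TransSum k S} (hz : ∀ γ, γ ∉ Z → z γ = 0) (hflow : totalFlow k S z = 0) :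
    ∃ g ∈ Subgroup.closure {g : germFixerOrdSubgroup k S |
        (g : Equiv.Perm (ZLat N)) ∈ unitGenerators k S},
      (∀ x, x ∉ ⋃ γ ∈ Z, ((germRep γ).standard T).carrier → g.1 x = x) ∧
      translationHom k S g = Multiplicative.ofAdd z := by
  classical
  set U : Set (ZLat N) := ⋃ γ ∈ Z, ((germRep γ).standard T).carrier with hU
  -- Only generators that fix everything outside `U` are admitted, so that their products do so as
  -- well.
  let gens : Set (germFixerOrdSubgroup k S) :=
    {g | (g : Equiv.Perm (ZLat N)) ∈ unitGenerators k S ∧ ∀ x, x ∉ U → g.1 x = x}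
  suffices h : Multiplicative.ofAdd z ∈ (Subgroup.closure gens).map (translationHom k S) by
    obtain ⟨g, hg, hgz⟩ := h
    refine ⟨g, Subgroup.closure_mono (fun h hh => hh.1) hg, ?_, hgz⟩
    clear hgz
    induction hg using Subgroup.closure_induction with
    | mem g hg => exact hg.2
    | one => exact fun x _ => rfl
    | mul g h _ _ hg hh =>
      intro x hx
      rw [Subgroup.coe_mul, Equiv.Perm.mul_apply, hh x hx, hg x hx]
    | inv g _ hg =>
      intro x hx
      rw [Subgroup.coe_inv, Equiv.Perm.inv_eq_iff_eq, hg x hx]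
  let c := (transBasis k S).repr z
  have hcZ : ∀ p ∈ c.support, p.1 ∈ Z := by
    intro p hp
    by_contra hc
    rw [Finsupp.mem_support_iff] at hp
    apply hp
    change (transBasis k S).repr z p = 0
    rw [transBasis_repr, hz _ hc]
    simp
  by_cases hne : c.support.Nonempty
  · obtain ⟨q, hq⟩ := hne
    have hsum : ∑ p ∈ c.support, c p = 0 := by
      rw [totalFlow_eq_repr_sum] at hflow
      exact hflow
    -- Since the coordinates sum to zero, subtracting one fixed basis vector from all of them does
    -- not change the combination.
    have hzsum : z = ∑ p ∈ c.support, c p • (transBasis k S p - transBasis k S q) := by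
      simp only [smul_sub]
      rw [Finset.sum_sub_distrib, ← Finset.sum_smul, hsum, zero_smul, sub_zero]
      conv_lhs => rw [← (transBasis k S).linearCombination_repr z]
      rfl
    rw [hzsum, ofAdd_sum]
    refine Subgroup.prod_mem _ fun p hp => ?_
    rw [ofAdd_zsmul]
    refine Subgroup.zpow_mem _ ?_ _
    by_cases hpq : p = q
    · rw [hpq, sub_self]
      exact one_mem _
    · obtain ⟨g, h1, h2, h3⟩ := exists_unitGenerator hRT hZ (hcZ p hp) (hcZ q hq) hpq
      exact ⟨g, Subgroup.subset_closure ⟨h1, h2⟩, h3⟩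
  · have : c = 0 := by
      rw [← Finsupp.support_eq_empty]
      exact Finset.not_nonempty_iff_eq_empty.1 hne
    have hz0 : z = 0 := (transBasis k S).repr.map_eq_zero_iff.1 this
    rw [hz0, ofAdd_zero]
    exact one_mem _

end

/-! ### Representatives whose support is exactly a union of orthants; infinitely many germs. -/

section

variable {N : ℕ}

/-- An orthant of full rank in the difference would represent the germ of `L`, which the disjoint
set `L.push r` represents too. -/
theorem thin_diff_push (L : Orthant N) (r : ℕ) :
    Thin ((L.rank : ℤ) - 1) (L.carrier \ (L.push r).carrier) := by
  refine (L.isOrthohedral.diff (L.push r).isOrthohedral).thin fun M hM => ?_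
  by_contra hc
  have hML : M.carrier ⊆ L.carrier := hM.trans Set.sdiff_subset
  have hr : M.rank = L.rank := by
    have := Orthant.rank_le_of_subset hML
    omega
  refine Set.disjoint_left.1 (disjoint_germs (T := L.carrier \ (L.push r).carrier)
    (T' := (L.push r).carrier) Set.disjoint_sdiff_left L.rank) ⟨M, hr, hM, rfl⟩ ?_
  exact ⟨L.push r, rfl, subset_rfl, Orthant.germ_eq_iff.2
    ((Orthant.parallel_of_subset hML hr).symm.trans (L.parallel_push r))⟩

theorem Orthant.mem_push_add_iff {L : Orthant N} {m s : ℕ} {x : ZLat N} :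
    (x - fun i => m * (L.dir i : ℤ)) ∈ (L.push s).carrier ↔ x ∈ (L.push (m + s)).carrier := by
  rw [Orthant.mem_push_iff, Orthant.mem_push_iff]
  refine forall_congr' fun i => ?_
  rw [Pi.sub_apply]
  rcases SignType.cases_int (L.dir i) with ⟨h, h'⟩ | ⟨h, h'⟩ | ⟨h, h'⟩ <;> rw [h'] <;>
    simp [h] <;> omega

/-- Every point of `L` lies in a suborthant on which `g` is a nontrivial isometric embedding. -/
def MovesEverywhere (g : Equiv.Perm (ZLat N)) (L : Orthant N) : Prop :=
  ∀ x ∈ L.carrier, ∃ K : Orthant N, x ∈ K.carrier ∧ K.carrier ⊆ L.carrier ∧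
    IsometricOn g K ∧ ∃ y ∈ K.carrier, g y ≠ y

theorem MovesEverywhere.subset_peiSupp {g : Equiv.Perm (ZLat N)} {L : Orthant N}
    (h : MovesEverywhere g L) : L.carrier ⊆ peiSupp g := by
  intro x hx
  obtain ⟨K, hxK, -, hiso, hne⟩ := h x hx
  simp only [peiSupp, Set.mem_iUnion]
  exact ⟨K, ⟨hiso, hne⟩, hxK⟩

theorem MovesEverywhere.congr {g h : Equiv.Perm (ZLat N)} {L : Orthant N}
    (hg : MovesEverywhere g L) (hgh : ∀ x ∈ L.carrier, h x = g x) : MovesEverywhere h L := by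
  intro x hx
  obtain ⟨K, hxK, hKL, hiso, y, hy, hne⟩ := hg x hx
  refine ⟨K, hxK, hKL, fun a ha b hb => ?_, y, hy, by rwa [hgh y (hKL hy)]⟩
  rw [hgh a (hKL ha), hgh b (hKL hb)]
  exact hiso a ha b hb

theorem exists_point_orthant {g : Equiv.Perm (ZLat N)} {L : Orthant N} {x : ZLat N}
    (hx : x ∈ L.carrier) (hne : g x ≠ x) : ∃ K : Orthant N, x ∈ K.carrier ∧
      K.carrier ⊆ L.carrier ∧ IsometricOn g K ∧ ∃ y ∈ K.carrier, g y ≠ y := by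
  have hmem : ∀ y, y ∈ (⟨x, 0⟩ : Orthant N).carrier ↔ y = x := by
    intro y
    rw [Orthant.mem_carrier_iff]
    simp [funext_iff]
  refine ⟨⟨x, 0⟩, (hmem x).2 rfl, fun y hy => (hmem y).1 hy ▸ hx, fun y hy z hz => ?_, x,
    (hmem x).2 rfl, hne⟩
  rw [(hmem y).1 hy, (hmem z).1 hz]; simp [sqDist]

/-- A permutation that translates `L` nontrivially far out can be modified on a set of smaller
rank so that it moves `L` everywhere. -/
theorem exists_mul_movesEverywhere {g : Equiv.Perm (ZLat N)} (hg : PiecewiseIsometric g)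
    {L : Orthant N} (hL : 1 ≤ L.rank) {v : ZLat N} (hv : v ≠ 0)
    (htail : TailEq g L (SignedAffine.translation v)) :
    ∃ τ : Equiv.Perm (ZLat N), PiecewiseIsometric τ ∧ (∀ x, x ∉ L.carrier → τ x = x) ∧
      Thin ((L.rank : ℤ) - 1) {x | τ x ≠ x} ∧ MovesEverywhere (g * τ) L := by
  obtain ⟨r, hr⟩ := htail
  obtain ⟨i₀, hi₀⟩ : ∃ i, L.dir i ≠ 0 := by
    by_contra! hc
    simp [Orthant.rank, hc] at hL
  -- Within `L`, only on `D` may `g` differ from the translation. The correction `τ` exchanges `D`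
  -- with a copy `E = w + D` further out.
  set D : Set (ZLat N) := L.carrier \ (L.push r).carrier with hD
  have hDo : IsOrthohedral D := L.isOrthohedral.diff (L.push r).isOrthohedral
  obtain ⟨R₁, hR₁⟩ := hg
  obtain ⟨R₂, hR₂⟩ := isOrthohedral_iff.1 hDo
  obtain ⟨Λ, hΛ, -, hcell⟩ := (hR₂.mono (le_max_right R₁ R₂)).exists_cells
  let dev : Orthant N → ℕ := fun c => (g c.base i₀ - c.base i₀).natAbs
  -- At least `r`, so that `g` is the translation on `E`; larger than the component of `v`, so that
  -- `v + w` is nonzero; larger than each deviation, so that `g` does not bring the base point of a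
  -- cell to its copy in `E`.
  let m : ℕ := r + (v i₀).natAbs + Λ.sup dev + 1
  let w : ZLat N := fun i => m * (L.dir i : ℤ)
  set E : Set (ZLat N) := (L.push m).carrier \ (L.push (m + r)).carrier with hE
  have hEo : IsOrthohedral E := (L.push m).isOrthohedral.diff (L.push (m + r)).isOrthohedral
  have hmr : r ≤ m := by simp only [m]; omega
  have hEr : E ⊆ (L.push r).carrier := Set.sdiff_subset.trans (L.push_anti hmr)
  have hdis : Disjoint D E := by
    rw [Set.disjoint_left]
    exact fun x hx hx' => hx.2 (hEr hx')
  have hshift : ∀ x, x - w ∈ D ↔ x ∈ E := by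
    intro x
    have h1 := Orthant.mem_push_add_iff (L := L) (m := m) (s := r) (x := x)
    have h2 := Orthant.mem_push_add_iff (L := L) (m := m) (s := 0) (x := x)
    rw [L.push_zero, Nat.add_zero] at h2
    simp only [hD, hE, Set.mem_sdiff]
    exact and_congr h2 (not_congr h1)
  have him0 : (SignedAffine.translation w).app '' D = E := by
    rw [image_translation]
    ext x
    exact hshift x
  have him1 : (SignedAffine.translation (-w)).app '' E = D := by
    rw [image_translation]
    ext x
    rw [Set.mem_ofPred_eq, ← hshift]
    simp
  obtain ⟨τ, hτpw, hτ, hτ'⟩ := exists_piecewise_perm (A := ![D, E])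
    (f := ![SignedAffine.translation w, SignedAffine.translation (-w)])
    (by intro a; fin_cases a; exacts [hDo, hEo])
    (by
      intro a b hab
      fin_cases a <;> fin_cases b
      exacts [absurd rfl hab, hdis, hdis.symm, absurd rfl hab])
    (by
      have d : Disjoint ((SignedAffine.translation w).app '' D)
          ((SignedAffine.translation (-w)).app '' E) := by
        rw [him0, him1]
        exact hdis.symm
      intro a b hab
      fin_cases a <;> fin_cases b
      exacts [absurd rfl hab, d, d.symm, absurd rfl hab])
    (by
      ext x
      simp only [Set.mem_iUnion, Fin.exists_fin_succ, Matrix.cons_val_zero, Matrix.cons_val_succ,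
        IsEmpty.exists_iff, or_false, him0, him1]
      tauto)
  have hτD : ∀ x ∈ D, τ x = w + x := fun x hx => (hτ 0 x hx).trans (by simp)
  have hτE : ∀ x ∈ E, τ x = -w + x := fun x hx => (hτ 1 x hx).trans (by simp)
  have hτfix : ∀ x, x ∉ D → x ∉ E → τ x = x := by
    intro x h1 h2
    refine hτ' x fun a => ?_
    fin_cases a
    exacts [h1, h2]
  have hDL : D ⊆ L.carrier := Set.sdiff_subset
  have hEL : E ⊆ L.carrier := hEr.trans (L.push_subset r)
  have hw : ∀ z : ℤ, z.natAbs < m → w i₀ ≠ z := by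
    intro z hz
    simp only [w]
    rcases SignType.cases_int (L.dir i₀) with ⟨h, h'⟩ | ⟨h, h'⟩ | ⟨h, h'⟩
    · exact absurd h hi₀
    · rw [h']; omega
    · rw [h']; omega
  refine ⟨τ, hτpw, fun x hx => hτfix x (fun h => hx (hDL h)) (fun h => hx (hEL h)), ?_, ?_⟩
  · refine ((thin_diff_push L r).union (thin_diff_push L (m + r))).mono fun x hx => ?_
    by_contra hc
    simp only [Set.mem_union, not_or] at hc
    exact hx (hτfix x hc.1 fun h => hc.2 ⟨hEL h, h.2⟩)
  -- The product translates `D` by `v + w`; on the copy of each cell in `E` it is isometric and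
  -- moves the base point; elsewhere in `L` it translates by `v`.
  · intro x hx
    by_cases hxD : x ∈ D
    · refine exists_point_orthant hx fun hc => ?_
      have hxE : w + x ∈ E := him0 ▸ ⟨x, hxD, by simp⟩
      rw [Equiv.Perm.mul_apply, hτD x hxD, hr (hEr hxE)] at hc
      have h1 := congrFun hc i₀
      simp only [SignedAffine.translation_app, Pi.add_apply] at h1
      exact hw (-v i₀) (by simp only [m]; omega) (by omega)
    by_cases hxE : x ∈ E
    · have hd := (hshift x).2 hxE
      rw [hΛ] at hd
      simp only [Set.mem_iUnion] at hd
      obtain ⟨c, hc, hxc⟩ := hd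
      have hcD : c.carrier ⊆ D := by
        rw [hΛ]
        exact Set.subset_biUnion_of_mem (u := Orthant.carrier) hc
      obtain ⟨c₀, -, rfl⟩ := hcell c hc
      obtain ⟨f, hf⟩ := hR₁ c₀
      set c := cell (max R₁ R₂) c₀ with hcdef
      have hfc : ∀ y ∈ c.carrier, g y = f.app y := fun y hy =>
        hf y (clampBox_mono (le_max_left R₁ R₂) (mem_cell.1 hy))
      have hK : ((SignedAffine.translation w).map c).carrier ⊆ E := by
        rw [← SignedAffine.image_carrier, ← him0]
        exact Set.image_mono hcD
      have hKmem : ∀ y, y ∈ ((SignedAffine.translation w).map c).carrier → y - w ∈ c.carrier := by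
        intro y hy
        rw [← SignedAffine.image_carrier, image_translation] at hy
        exact hy
      refine ⟨(SignedAffine.translation w).map c, ?_, hK.trans hEL, ?_,
        w + c.base, ?_, fun hcon => ?_⟩
      · rw [← SignedAffine.image_carrier, image_translation]
        exact hxc
      · refine isometricOn_of_eqOn (f := f.comp (SignedAffine.translation (-w))) fun y hy => ?_
        rw [Equiv.Perm.mul_apply, hτE y (hK hy), SignedAffine.comp_app,
          SignedAffine.translation_app]
        exact hfc _ (by simpa [sub_eq_neg_add] using hKmem y hy)
      · rw [← SignedAffine.image_carrier]
        exact ⟨c.base, c.base_mem, by simp⟩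
      · have hmem : w + c.base ∈ E := by
          rw [← him0]
          exact ⟨c.base, hcD c.base_mem, by simp⟩
        rw [Equiv.Perm.mul_apply, hτE _ hmem, neg_add_cancel_left] at hcon
        have h1 := congrFun hcon i₀
        rw [Pi.add_apply] at h1
        have h2 : dev c ≤ Λ.sup dev := Finset.le_sup hc
        simp only [dev] at h2
        exact hw (g c.base i₀ - c.base i₀) (by simp only [m, dev]; omega) (by omega)
    · refine exists_point_orthant hx fun hc => ?_
      have hxr : x ∈ (L.push r).carrier := by
        by_contra h
        exact hxD ⟨hx, h⟩
      rw [Equiv.Perm.mul_apply, hτfix x hxD hxE, hr hxr] at hc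
      exact hv (by simpa using hc)

variable {k : ℕ} {S : Set (ZLat N)}

/-- A family of translations of total flow zero is realized by an element whose support is a
disjoint union of orthants representing the germs that are moved. -/
theorem exists_peiSupp_eq (hk : 1 ≤ k) (hS : IsOrthohedral S) {z : TransSum k S}
    (hflow : totalFlow k S z = 0) :
    ∃ (g : germFixerOrdSubgroup k S) (L : germs k S → Orthant N),
      translationHom k S g = Multiplicative.ofAdd z ∧
      (∀ γ : germs k S, L γ ∈ (γ : Set (Orthant N)) ∧ (L γ).carrier ⊆ S) ∧
      (∀ γ γ', z γ ≠ 0 → z γ' ≠ 0 → γ ≠ γ' → Disjoint (L γ).carrier (L γ').carrier) ∧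
      peiSupp (g : Equiv.Perm (ZLat N)) = ⋃ γ ∈ {γ : germs k S | z γ ≠ 0}, (L γ).carrier := by
  classical
  have hfin := finite_support_transSum z
  let Z : Finset (germs k S) := hfin.toFinset
  have hZmem : ∀ γ, γ ∈ Z ↔ z γ ≠ 0 := fun γ => hfin.mem_toFinset
  obtain ⟨R, T, hRT, hstd⟩ := exists_standard_subset Z germRep fun _ => 0
  have hZ : ∀ γ ∈ Z, (germRep γ).OffBound R ∧ ((germRep γ).standard T).carrier ⊆ S := by
    intro γ hγ
    refine ⟨(hstd γ hγ).1, (hstd γ hγ).2.trans ?_⟩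
    rw [Orthant.push_zero]
    exact germRep_subset γ
  let M : germs k S → Orthant N := fun γ => (germRep γ).standard T
  have hMgerm : ∀ γ, (M γ).germ = γ := fun γ => by
    rw [← germRep_germ γ]
    exact Orthant.germ_eq_iff.2 ((germRep γ).parallel_standard T).symm
  have hMd : ∀ γ ∈ Z, ∀ δ ∈ Z, γ ≠ δ → Disjoint (M γ).carrier (M δ).carrier := by
    intro γ hγ δ hδ hne
    rw [Set.disjoint_left]
    intro x hx hx'
    apply hne
    apply Subtype.ext
    rw [← germRep_germ γ, ← germRep_germ δ, Orthant.germ_eq_iff]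
    exact Orthant.parallel_of_mem_standard (by omega) (hZ γ hγ).1 (hZ δ hδ).1 hx hx'
  -- One orthant at a time: each correction has rank below `k`, hence does not affect `φ`, and is
  -- the identity outside one `M a`, hence does not disturb the others.
  have key : ∀ s : Finset (germs k S), s ⊆ Z → ∃ g : germFixerOrdSubgroup k S,
      (∀ x, x ∉ ⋃ γ ∈ Z, (M γ).carrier → g.1 x = x) ∧
      translationHom k S g = Multiplicative.ofAdd z ∧ ∀ γ ∈ s, MovesEverywhere g.1 (M γ) := by
    intro s
    induction s using Finset.induction_on with
    | empty =>
      intro _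
      obtain ⟨g, -, h1, h2⟩ := exists_mem_closure_translationHom_eq hRT hZ
        (fun γ hγ => by_contra fun hc => hγ ((hZmem γ).2 hc)) hflow
      exact ⟨g, h1, h2, by simp⟩
    | insert a s ha ih =>
      intro hs
      have haZ : a ∈ Z := hs (Finset.mem_insert_self _ _)
      obtain ⟨g, h1, h2, h3⟩ := ih fun b hb => hs (Finset.mem_insert_of_mem hb)
      have hg := (mem_germFixerOrdSubgroup.1 g.2).1
      have htail : TailEq g.1 (M a) (SignedAffine.translation (z a)) := by
        rw [← translatesGerm_iff, hMgerm]
        refine (translationHom_eq_iff g a (z a)).1 ?_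
        rw [h2]; rfl
      have hMr : (M a).rank = k := germRep_rank a
      obtain ⟨τ, t1, t2, t3, t4⟩ := exists_mul_movesEverywhere hg.2.1 (by omega)
        (fun h => (hZmem a).1 haZ (Subtype.ext h)) htail
      rw [hMr] at t3
      have hτmem : τ ∈ rankSubgroup ((k : ℤ) - 1) S :=
        ⟨fun x hx => t2 x fun hc => hx ((hZ a haZ).2 hc), t1, t3⟩
      let τ' : germFixerOrdSubgroup k S := ⟨τ, rankSubgroup_le_germFixerOrdSubgroup k S hτmem⟩
      refine ⟨g * τ', fun x hx => ?_, ?_, fun γ hγ => ?_⟩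
      · have hx' : x ∉ (M a).carrier := fun hc =>
          hx (Set.subset_biUnion_of_mem (u := fun γ => (M γ).carrier) haZ hc)
        rw [Subgroup.coe_mul, Equiv.Perm.mul_apply, t2 x hx', h1 x hx]
      · rw [map_mul, h2, (translationHom_eq_one_iff hS τ').2 hτmem, mul_one]
      · rcases Finset.mem_insert.1 hγ with rfl | hγ'
        · exact t4
        · have hne : γ ≠ a := fun h => ha (h ▸ hγ')
          refine (h3 γ hγ').congr fun x hx => ?_
          rw [Subgroup.coe_mul, Equiv.Perm.mul_apply]
          rw [t2 x (Set.disjoint_left.1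
            (hMd γ (hs (Finset.mem_insert_of_mem hγ')) a haZ hne) hx)]
  obtain ⟨g, h1, h2, h3⟩ := key Z subset_rfl
  have hsupp : peiSupp g.1 = ⋃ γ ∈ Z, (M γ).carrier := by
    apply Set.Subset.antisymm
    · exact peiSupp_subset_of_standard hRT (fun γ hγ => (hZ γ hγ).1) h1
    · exact Set.iUnion₂_subset fun γ hγ => (h3 γ hγ).subset_peiSupp
  -- The family is indexed by all germs; the unmoved ones receive an arbitrary representative in
  -- `S`.
  refine ⟨g, fun γ => if z γ ≠ 0 then M γ else germRep γ, h2, fun γ => ?_, ?_, ?_⟩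
  · dsimp only
    split_ifs with h
    · exact ⟨by simpa only [hMgerm] using (M γ).self_mem_germ, (hZ γ ((hZmem γ).2 h)).2⟩
    · exact ⟨by simpa only [germRep_germ] using (germRep γ).self_mem_germ, germRep_subset γ⟩
  · intro γ γ' h h' hne
    simp only [h, h', ne_eq, not_false_eq_true, if_true]
    exact hMd γ ((hZmem γ).2 h) γ' ((hZmem γ').2 h') hne
  · rw [hsupp]
    ext x
    simp only [Set.mem_iUnion, Set.mem_ofPred_eq]
    constructor
    · rintro ⟨γ, hγ, hx⟩
      refine ⟨γ, (hZmem γ).1 hγ, ?_⟩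
      rwa [if_pos ((hZmem γ).1 hγ)]
    · rintro ⟨γ, hγ, hx⟩
      rw [if_pos hγ] at hx
      exact ⟨γ, (hZmem γ).2 hγ, hx⟩

theorem Orthant.exists_subset_rank_eq (L : Orthant N) {m : ℕ} (h : m ≤ L.rank) :
    ∃ M : Orthant N, M.carrier ⊆ L.carrier ∧ M.rank = m := by
  classical
  obtain ⟨s, hs, hcard⟩ := Finset.exists_subset_card_eq h
  have hs' : ∀ i ∈ s, L.dir i ≠ 0 := fun i hi => by simpa using hs hi
  refine ⟨⟨L.base, fun i => if i ∈ s then L.dir i else 0⟩, fun x hx => ?_, ?_⟩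
  · rw [Orthant.mem_carrier_iff] at hx ⊢
    intro i
    have := hx i
    by_cases hi : i ∈ s
    · simpa [hi] using this
    · simp only [hi, if_false, true_imp_iff] at this
      rw [this.1]
      simp
  · rw [← hcard, Orthant.rank]
    congr 1
    ext i
    by_cases hi : i ∈ s
    · simp [hi, hs' i hi]
    · simp [hi]

/-- The slices of a rank-`(k + 1)` suborthant at different distances from a face represent different
germs. -/
theorem infinite_germs {L : Orthant N} (hL : L.carrier ⊆ S) (hk : k < L.rank) :
    Infinite (germs k S) := by
  obtain ⟨M, hM, hr⟩ := L.exists_subset_rank_eq (m := k + 1) hk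
  obtain ⟨i, hi⟩ : ∃ i, M.dir i ≠ 0 := by
    by_contra! hc
    simp [Orthant.rank, hc] at hr
  have hmem : ∀ n : ℕ, (M.slice i n).germ ∈ germs k S := by
    intro n
    have := Orthant.slice_rank_add_one hi n
    exact ⟨M.slice i n, by omega,
      fun x hx => hL (hM ((Orthant.mem_slice_iff hi).1 hx).1), rfl⟩
  refine Infinite.of_injective (fun n : ℕ => (⟨_, hmem n⟩ : germs k S)) fun a b hab => ?_
  have h1 := (Orthant.germ_eq_iff.1 (congrArg Subtype.val hab)).2 i (by simp [Orthant.slice])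
  rw [M.slice_base_self, M.slice_base_self, add_right_inj] at h1
  exact_mod_cast mul_right_cancel₀ (fun h => hi (SignType.intCast_eq_zero.1 h)) h1

theorem mk_sigma_germAxis (k : ℕ) (S : Set (ZLat N)) :
    Cardinal.mk (Σ γ : germs k S, GermAxis γ) = k * Cardinal.mk (germs k S) := by
  have : ∀ γ : germs k S, Cardinal.mk (GermAxis γ) = k := by
    intro γ
    rw [Cardinal.mk_fintype, Fintype.card_subtype]
    exact_mod_cast germRep_rank γ
  rw [Cardinal.mk_sigma]
  simp only [this]
  rw [Cardinal.sum_const', mul_comm]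

end

/-! ### Assembly: kernels, the free abelian quotient, and the theorem. -/

section

variable {N k : ℕ} {S : Set (ZLat N)}

theorem coe_germFixerSubgroup (hS : IsOrthohedral S) (k : ℕ) :
    (germFixerSubgroup k S : Set (Equiv.Perm (ZLat N))) = germFixer k S := by
  ext g
  rw [SetLike.mem_coe, mem_germFixerSubgroup, germFixer, Set.mem_ofPred_eq, ← coe_rankSubgroup hS,
    SetLike.mem_coe]

theorem coe_germFixerOrdSubgroup (hS : IsOrthohedral S) (k : ℕ) :
    (germFixerOrdSubgroup k S : Set (Equiv.Perm (ZLat N))) = germFixerOrd k S := by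
  ext g
  rw [SetLike.mem_coe, mem_germFixerOrdSubgroup, germFixerOrd, Set.mem_ofPred_eq,
    ← coe_rankSubgroup hS, SetLike.mem_coe]

theorem germFixerSubgroup_le (k : ℕ) (S : Set (ZLat N)) :
    germFixerSubgroup k S ≤ rankSubgroup (k : ℤ) S :=
  fun _ hg => (mem_germFixerSubgroup.1 hg).1

theorem germFixerOrdSubgroup_le (k : ℕ) (S : Set (ZLat N)) :
    germFixerOrdSubgroup k S ≤ germFixerSubgroup k S := fun _ hg =>
  mem_germFixerSubgroup.2 ⟨(mem_germFixerOrdSubgroup.1 hg).1, fun γ hγ =>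
    ((mem_germFixerOrdSubgroup.1 hg).2 γ hγ).sendsGerm⟩

/-- The stabilizer was defined as the image of a kernel; inside the larger group it is that kernel
again, which yields normality and the quotient. -/
theorem germFixerSubgroup_subgroupOf (k : ℕ) (S : Set (ZLat N)) :
    (germFixerSubgroup k S).subgroupOf (rankSubgroup (k : ℤ) S) = (finitaryGermAction k S).ker :=
  Subgroup.comap_map_eq_self_of_injective (Subgroup.subtype_injective _) _

theorem germFixerOrdSubgroup_subgroupOf (k : ℕ) (S : Set (ZLat N)) :
    (germFixerOrdSubgroup k S).subgroupOf (germFixerSubgroup k S) = (directionAction k S).ker :=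
  Subgroup.comap_map_eq_self_of_injective (Subgroup.subtype_injective _) _

theorem rankSubgroup_subgroupOf (hS : IsOrthohedral S) (k : ℕ) :
    (rankSubgroup ((k : ℤ) - 1) S).subgroupOf (germFixerOrdSubgroup k S) =
      (translationHom k S).ker := by
  ext g
  rw [MonoidHom.mem_ker, translationHom_eq_one_iff hS]
  rfl

theorem Finsupp.eq_zero_of_sum_eq_zero {ι : Type*} {i₀ : ι} {f : ι →₀ ℤ}
    (hsum : (f.sum fun _ c => c) = 0) (h : ∀ i, i ≠ i₀ → f i = 0) : f = 0 := by
  have hf : f = Finsupp.single i₀ (f i₀) := by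
    classical
    ext i
    rw [Finsupp.single_apply]
    split_ifs with hi
    · rw [hi]
    · exact h i (Ne.symm hi)
  rw [hf, Finsupp.sum_single_index rfl] at hsum
  rw [hf, hsum, Finsupp.single_zero]

theorem Finsupp.exists_sum_eq_zero_subtypeDomain_eq {ι : Type*} (i₀ : ι)
    (h : {i // i ≠ i₀} →₀ ℤ) :
    ∃ f : ι →₀ ℤ, (f.sum fun _ c => c) = 0 ∧ f.subtypeDomain (· ≠ i₀) = h := by
  refine ⟨h.mapDomain Subtype.val - Finsupp.single i₀ (h.sum fun _ c => c), ?_, ?_⟩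
  · rw [Finsupp.sum_sub_index (fun _ _ _ => rfl), Finsupp.sum_single_index rfl,
      Finsupp.sum_mapDomain_index (fun _ => rfl) (fun _ _ _ => rfl), sub_self]
  · ext i
    rw [Finsupp.subtypeDomain_apply, Finsupp.sub_apply, Finsupp.single_eq_of_ne i.2, sub_zero,
      Finsupp.mapDomain_apply Subtype.val_injective]

theorem nonempty_sigma_germAxis (hk : 1 ≤ k) (h : ∃ L : Orthant N, L.carrier ⊆ S ∧ k ≤ L.rank) :
    Nonempty (Σ γ : germs k S, GermAxis γ) := by
  obtain ⟨L, hL, hr⟩ := h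
  obtain ⟨M, hM, hMr⟩ := L.exists_subset_rank_eq hr
  let γ : germs k S := ⟨M.germ, M, hMr, hM.trans hL, rfl⟩
  have h1 := germRep_rank γ
  obtain ⟨i, hi⟩ : ∃ i, (germRep γ).dir i ≠ 0 := by
    by_contra! hc
    simp [Orthant.rank, hc] at h1
    omega
  exact ⟨⟨γ, i, hi⟩⟩

theorem totalFlow_surjective (p : Σ γ : germs k S, GermAxis γ) :
    Function.Surjective (totalFlow k S) := fun n =>
  ⟨n • transBasis k S p, by rw [map_zsmul, totalFlow_transBasis, smul_eq_mul, mul_one]⟩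

/-- A group embedded into the direct sum of the translation groups as the kernel of the flow is
free abelian on all but one of the axes of the germs. -/
theorem nonempty_mulEquiv_finsupp_of_range_eq_ker {A : Type*} [Group A]
    {φ : A →* Multiplicative (TransSum k S)} (hφ : Function.Injective φ)
    (hex : ∀ z, totalFlow k S z = 0 ↔ ∃ a, (φ a).toAdd = z)
    (p : Σ γ : germs k S, GermAxis γ) :
    Nonempty (A ≃* Multiplicative ({q : Σ γ : germs k S, GermAxis γ // q ≠ p} →₀ ℤ)) := by
  -- Deleting the coordinate at `p` loses nothing on the kernel of the flow, where it is minus the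
  -- sum of the others.
  let ρ : TransSum k S →+ ({q : Σ γ : germs k S, GermAxis γ // q ≠ p} →₀ ℤ) :=
    (Finsupp.subtypeDomainAddMonoidHom (p := (· ≠ p))).comp
      (transBasis k S).repr.toLinearMap.toAddMonoidHom
  have hρ : ∀ z q, ρ z q = (transBasis k S).repr z q.1 := fun _ _ => rfl
  let ψ := (AddMonoidHom.toMultiplicative ρ).comp φ
  refine ⟨MulEquiv.ofBijective ψ ⟨?_, fun h => ?_⟩⟩
  · rw [injective_iff_map_eq_one]
    intro a ha
    have h0 : totalFlow k S (φ a).toAdd = 0 := (hex _).2 ⟨a, rfl⟩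
    rw [totalFlow_eq_repr_sum] at h0
    have h1 : ρ (φ a).toAdd = 0 := ha
    have h2 := Finsupp.eq_zero_of_sum_eq_zero (i₀ := p) h0 fun q hq => by
      rw [← hρ _ ⟨q, hq⟩, h1]
      rfl
    refine hφ ?_
    rw [map_one]
    exact (LinearEquiv.map_eq_zero_iff _).1 h2
  · obtain ⟨f, hf, hf'⟩ := Finsupp.exists_sum_eq_zero_subtypeDomain_eq p h.toAdd
    obtain ⟨a, ha⟩ := (hex ((transBasis k S).repr.symm f)).1 (by
      rw [totalFlow_eq_repr_sum, LinearEquiv.apply_symm_apply, hf])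
    refine ⟨a, ?_⟩
    have : ρ (φ a).toAdd = h.toAdd := by
      ext q
      rw [ha, hρ, LinearEquiv.apply_symm_apply, ← hf']
      rfl
    exact this

theorem exists_mem_closure_unitGenerators {z : TransSum k S} (hflow : totalFlow k S z = 0) :
    ∃ g ∈ Subgroup.closure {g : germFixerOrdSubgroup k S |
        (g : Equiv.Perm (ZLat N)) ∈ unitGenerators k S},
      translationHom k S g = Multiplicative.ofAdd z := by
  have hfin := finite_support_transSum z
  obtain ⟨R, T, hRT, hstd⟩ := exists_standard_subset hfin.toFinset germRep fun _ => 0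
  obtain ⟨g, hg, -, h⟩ := exists_mem_closure_translationHom_eq hRT (Z := hfin.toFinset)
    (fun γ hγ => ⟨(hstd γ hγ).1, (hstd γ hγ).2.trans (by
      rw [Orthant.push_zero]
      exact germRep_subset γ)⟩)
    (fun γ hγ => by_contra fun hc => hγ (hfin.mem_toFinset.2 hc)) hflow
  exact ⟨g, hg, h⟩

end

theorem mainTheorem7 {N : ℕ} (S : Set (ZLat N)) (hS : IsOrthohedral S) (k : ℕ)
    (hk : ∃ L : Orthant N, L.carrier ⊆ S ∧ k ≤ L.rank) :
    -- the four sets are subgroups, and each is normal in the next one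
    ∃ Gk C Cord Gk' : Subgroup (Equiv.Perm (ZLat N)),
      (Gk : Set (Equiv.Perm (ZLat N))) = rankGroup k S ∧
      (C : Set (Equiv.Perm (ZLat N))) = germFixer k S ∧
      (Cord : Set (Equiv.Perm (ZLat N))) = germFixerOrd k S ∧
      (Gk' : Set (Equiv.Perm (ZLat N))) = rankGroup ((k : ℤ) - 1) S ∧
      Gk' ≤ Cord ∧ Cord ≤ C ∧ C ≤ Gk ∧
      ∃ (_ : (C.subgroupOf Gk).Normal) (_ : (Cord.subgroupOf C).Normal)
        (_ : (Gk'.subgroupOf Cord).Normal),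
      -- (i)
      ((∀ γ ∈ germs k S, ∀ γ' ∈ germs k S, γ ≠ γ' →
          ∃ L ∈ γ, ∃ L' ∈ γ', L.carrier ⊆ S ∧ L'.carrier ⊆ S ∧
            ∃ g ∈ Gk, IsOrthantTransposition g L L' ∧ SendsGerm g γ γ' ∧ SendsGerm g γ' γ ∧
              ∀ δ ∈ germs k S, δ ≠ γ → δ ≠ γ' → SendsGerm g δ δ) ∧
        ∃ e : Gk ⧸ C.subgroupOf Gk ≃* finitarySym (germs k S),
          ∀ (g : Gk) (γ γ' : germs k S),
            SendsGerm (g : Equiv.Perm (ZLat N)) γ γ' ↔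
              (e (QuotientGroup.mk g) : Equiv.Perm (germs k S)) γ = γ') ∧
      -- (ii)
      ((∀ γ : germs k S, Nat.card (germDirections (γ : Set (Orthant N))) = k) ∧
        ∃ e : C ⧸ Cord.subgroupOf C ≃* finitaryProd
            (fun γ : germs k S => Equiv.Perm (germDirections (γ : Set (Orthant N)))),
          ∀ (g : C) (γ : germs k S) (σ : Equiv.Perm (germDirections (γ : Set (Orthant N)))),
            PermutesDirections (g : Equiv.Perm (ZLat N)) γ σ ↔
              (e (QuotientGroup.mk g)).1 γ = σ) ∧
      -- (iii)
      (1 ≤ k →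
        ∃ (φ : Cord ⧸ Gk'.subgroupOf Cord →*
              Multiplicative (DirectSum (germs k S) fun γ => TransGroup (γ : Set (Orthant N))))
          (fl : (DirectSum (germs k S) fun γ => TransGroup (γ : Set (Orthant N))) →+ ℤ),
          -- `φ` is induced by the action on the tangent cosets
          (∀ (g : Cord) (γ : germs k S) (v : TransGroup (γ : Set (Orthant N))),
            TranslatesGerm (g : Equiv.Perm (ZLat N)) γ v ↔
              (φ (QuotientGroup.mk g)).toAdd γ = v) ∧
          -- `fl` is the sum of the corank-1 germ flows, computed at any representatives
          (∀ (z : DirectSum (germs k S) fun γ => TransGroup (γ : Set (Orthant N)))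
            (L : germs k S → Orthant N), (∀ γ : germs k S, L γ ∈ (γ : Set (Orthant N))) →
              fl z = ∑ᶠ γ, flowAt k (L γ) (z γ)) ∧
          -- exactness
          Function.Injective φ ∧
          (∀ z, fl z = 0 ↔ ∃ a, (φ a).toAdd = z) ∧
          Function.Surjective fl ∧
          -- free abelian of rank `k * |Γ^k(S)| - 1`, which is infinite for `k < rk S`
          (∃ ι : Type, Nonempty (Cord ⧸ Gk'.subgroupOf Cord ≃* Multiplicative (ι →₀ ℤ)) ∧
            Cardinal.mk ι + 1 = k * Cardinal.mk (germs k S) ∧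
            ((∃ L : Orthant N, L.carrier ⊆ S ∧ k < L.rank) → Infinite ι)) ∧
          -- representatives supported on disjoint orthants
          (∀ a : Cord ⧸ Gk'.subgroupOf Cord, ∃ (g : Cord) (L : germs k S → Orthant N),
            QuotientGroup.mk g = a ∧
            (∀ γ : germs k S, L γ ∈ (γ : Set (Orthant N)) ∧ (L γ).carrier ⊆ S) ∧
            (∀ γ γ', (φ a).toAdd γ ≠ 0 → (φ a).toAdd γ' ≠ 0 → γ ≠ γ' →
              Disjoint (L γ).carrier (L γ').carrier) ∧
            peiSupp (g : Equiv.Perm (ZLat N)) =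
              ⋃ γ ∈ {γ : germs k S | (φ a).toAdd γ ≠ 0}, (L γ).carrier) ∧
          -- generation
          unitGenerators k S ⊆ Cord ∧
          Subgroup.closure {a : Cord ⧸ Gk'.subgroupOf Cord |
            ∃ g : Cord, (g : Equiv.Perm (ZLat N)) ∈ unitGenerators k S ∧
              QuotientGroup.mk g = a} = ⊤) := by
  have hC := germFixerSubgroup_subgroupOf k S
  have hCord := germFixerOrdSubgroup_subgroupOf k S
  have hG := rankSubgroup_subgroupOf hS k
  have nC : ((germFixerSubgroup k S).subgroupOf (rankSubgroup (k : ℤ) S)).Normal :=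
    hC ▸ inferInstance
  have nCord : ((germFixerOrdSubgroup k S).subgroupOf (germFixerSubgroup k S)).Normal :=
    hCord ▸ inferInstance
  have nG : ((rankSubgroup ((k : ℤ) - 1) S).subgroupOf (germFixerOrdSubgroup k S)).Normal :=
    hG ▸ inferInstance
  refine ⟨rankSubgroup (k : ℤ) S, germFixerSubgroup k S, germFixerOrdSubgroup k S,
    rankSubgroup ((k : ℤ) - 1) S, coe_rankSubgroup hS _, coe_germFixerSubgroup hS k,
    coe_germFixerOrdSubgroup hS k, coe_rankSubgroup hS _,
    rankSubgroup_le_germFixerOrdSubgroup k S, germFixerOrdSubgroup_le k S,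
    germFixerSubgroup_le k S, nC, nCord, nG,
    ⟨fun γ hγ γ' hγ' hne => exists_germ_transposition hγ hγ' hne, ?_⟩,
    ⟨fun γ => card_germDirections γ.2, ?_⟩, fun hk1 => ?_⟩
  · exact ⟨(QuotientGroup.quotientMulEquivOfEq hC).trans
      (QuotientGroup.quotientKerEquivOfSurjective _ (finitaryGermAction_surjective k S)),
      fun g γ γ' => (germAction_eq_iff k g γ γ').symm⟩
  · exact ⟨(QuotientGroup.quotientMulEquivOfEq hCord).trans
      (QuotientGroup.quotientKerEquivOfSurjective _ (directionAction_surjective k S)),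
      fun g γ σ => (directionAction_eq_iff g γ σ).symm⟩
  let φ := QuotientGroup.lift
    ((rankSubgroup ((k : ℤ) - 1) S).subgroupOf (germFixerOrdSubgroup k S)) (translationHom k S)
    hG.le
  have hφmk : ∀ g : germFixerOrdSubgroup k S, φ (QuotientGroup.mk g) = translationHom k S g :=
    fun _ => rfl
  have hφ : Function.Injective φ := by
    rw [injective_iff_map_eq_one]
    intro a
    induction a using QuotientGroup.induction_on with
    | H g =>
      intro h
      rw [QuotientGroup.eq_one_iff, hG]
      exact h
  have hflow : ∀ a, totalFlow k S (φ a).toAdd = 0 := by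
    intro a
    induction a using QuotientGroup.induction_on with
    | H g => exact totalFlow_translationHom hk1 hS g
  have hex : ∀ z, totalFlow k S z = 0 ↔ ∃ a, (φ a).toAdd = z := by
    refine fun z => ⟨fun hz => ?_, ?_⟩
    · obtain ⟨g, -, hg⟩ := exists_mem_closure_unitGenerators hz
      exact ⟨QuotientGroup.mk g, by rw [hφmk, hg]; rfl⟩
    · rintro ⟨a, rfl⟩
      exact hflow a
  obtain ⟨p⟩ := nonempty_sigma_germAxis hk1 hk
  -- Putting the deleted axis `p` back gives all axes, `k` for each germ. As an identity of
  -- cardinals it also covers infinitely many germs.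
  have hcard : Cardinal.mk {q : Σ γ : germs k S, GermAxis γ // q ≠ p} + 1 =
      k * Cardinal.mk (germs k S) := by
    classical
    rw [← Cardinal.mk_option, Cardinal.mk_congr (Equiv.optionSubtypeNe p), mk_sigma_germAxis]
  refine ⟨φ, totalFlow k S, fun g γ v => (translationHom_eq_iff g γ v).symm,
    totalFlow_eq_finsum hk1, hφ, hex, totalFlow_surjective p,
    ⟨_, nonempty_mulEquiv_finsupp_of_range_eq_ker hφ hex p, hcard, ?_⟩, fun a => ?_,
    unitGenerators_subset k S, ?_⟩
  · rintro ⟨L, hL, hr⟩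
    have := infinite_germs hL hr
    by_contra hfin
    rw [not_infinite_iff_finite] at hfin
    have h1 : Cardinal.mk {q : Σ γ : germs k S, GermAxis γ // q ≠ p} + 1 < Cardinal.aleph0 :=
      Cardinal.add_lt_aleph0 (Cardinal.lt_aleph0_of_finite _) Cardinal.one_lt_aleph0
    rw [hcard] at h1
    have h2 : Cardinal.mk (germs k S) ≤ k * Cardinal.mk (germs k S) :=
      le_mul_of_one_le_left zero_le (by exact_mod_cast hk1)
    exact absurd (Cardinal.aleph0_le_mk (germs k S)) (h2.trans_lt h1).not_ge
  · obtain ⟨g, L, hg, hL, hd, hs⟩ := exists_peiSupp_eq hk1 hS (hflow a)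
    exact ⟨g, L, hφ hg, hL, hd, hs⟩
  · rw [eq_top_iff]
    intro a _
    obtain ⟨g, hg, hz⟩ := exists_mem_closure_unitGenerators (hflow a)
    -- An element of the group generated by the unit generators has the same translations as `a`, so
    -- injectivity of `φ` identifies its class with `a`.
    have ha : QuotientGroup.mk' _ g = a := hφ hz
    have h := Subgroup.mem_map_of_mem (QuotientGroup.mk'
      ((rankSubgroup ((k : ℤ) - 1) S).subgroupOf (germFixerOrdSubgroup k S))) hg
    rw [MonoidHom.map_closure, ha] at h
    exact h
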